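/- Let $S_1,\dots,S_{n-1}$ be independent commuting stabilizer generators (signed Pauli strings) of an $[[n,1,d]]$ stabilizer code of distance $d$, let $H_0=-\sum_a S_a$, and let $V=\sum_i V_i$ be a $k$-local perturbation ($1\le k<d$; each $V_i$ is Hermitian and acts on at most $k$ qubits). For real $\lambda$ let $|\psi_0\rangle,|\psi_1\rangle$ be orthonormal eigenvectors of $H=H_0+\lambda V$ for its two lowest eigenvalues, let $|\Omega_i\rangle=\sum_j u_{ij}|\psi_j\rangle$ with a $2\times2$ unitary $u$ be the codewords, and let $|\Psi_{\theta,\phi}\rangle=\cos\theta\,|\Omega_0\rangle+e^{i\phi}\sin\theta\,|\Omega_1\rangle$. Let the noise be given by a probability distribution on Pauli strings $P_\alpha$ acting on at most $p$ qubits, let $\mu$ be a finite measure on $[0,\pi]\times[0,2\pi]$, and put $f_X=\sin2\theta\cos\phi$, $f_Y=\sin2\theta\sin\phi$, $f_Z=\cos2\theta$. The decoding error of an observable $O$ in the logical basis $Q\in\{X,Y,Z\}$ is $$\varepsilon_Q(O)=\mathbb E_\alpha\int d\mu(\theta,\phi)\,\bigl(\langle\Psi_{\theta,\phi}|P_\alpha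 O P_\alpha|\Psi_{\theta,\phi}\rangle-f_Q(\theta,\phi)\bigr)^2 .$$ Assume, in case $d-2p>k$, that the errors are independent in the following sense: if two noise operators $P_\alpha,P_\beta$ of positive probability act identically up to a phase on the unperturbed code (that is, $P_\alpha P_\beta$ is a stabilizer up to a phase), then $P_\alpha P_\beta$ commutes with $V$ (this holds trivially if no two distinct noise operators act identically on the unperturbed code). Then for every $Q\in\{X,Y,Z\}$ and every choice of the output qubit, with $Z_0$ the Pauli-$Z$ operator of that qubit, there is for every sufficiently small $\lambda\neq0$ and every choice of codewords a unitary $U_Q$ such that $$\varepsilon_Q(U_Q^\dagger Z_0U_Q)=O\bigl(|\lambda|^{4\lceil(d-2p)/k\rceil}\bigr)\qquad(\lambda\to0),$$ where the implied constant and the range of $\lambda$ may depend on everything except $\lambda$ and the choice of codewords. -/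

import Mathlib

open scoped Matrix BigOperators

noncomputable section

namespace PerturbedCode

/-! ### Qubits and Pauli operators -/

/-- Computational basis labels of `n` qubits (bit strings). -/
abbrev Bits (n : ℕ) : Type := Fin n → Fin 2

/-- Linear operators on the `n`-qubit space `(ℂ²)^{⊗ n}`, as matrices in the computational basis. -/
abbrev Op (n : ℕ) : Type := Matrix (Bits n) (Bits n) ℂ

/-- Vectors of the `n`-qubit space; the Hermitian product of `φ` and `ψ` is `star φ ⬝ᵥ ψ`. -/
abbrev Vec (n : ℕ) : Type := Bits n → ℂ

/-- Labels of the single-qubit Pauli operators, identity included. -/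
inductive Pauli : Type
  | I | X | Y | Z
  deriving DecidableEq

instance : Fintype Pauli where
  elems := {Pauli.I, Pauli.X, Pauli.Y, Pauli.Z}
  complete := by intro P; cases P <;> decide

/-- The single-qubit Pauli matrices. -/
def Pauli.mat : Pauli → Matrix (Fin 2) (Fin 2) ℂ
  | Pauli.I => !![1, 0; 0, 1]
  | Pauli.X => !![0, 1; 1, 0]
  | Pauli.Y => !![0, -Complex.I; Complex.I, 0]
  | Pauli.Z => !![1, 0; 0, -1]

/-- A Pauli string on `n` qubits: one Pauli label per qubit. -/
abbrev PauliString (n : ℕ) : Type := Fin n → Pauli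

/-- The tensor product `P₀ ⊗ ⋯ ⊗ Pₙ₋₁` of single-qubit Pauli matrices. -/
def pauliOp {n : ℕ} (P : PauliString n) : Op n :=
  Matrix.of fun x y => ∏ i, (P i).mat (x i) (y i)

/-- The weight of a Pauli string: the number of qubits on which it is not the identity. -/
def weight {n : ℕ} (P : PauliString n) : ℕ :=
  (Finset.univ.filter fun i => P i ≠ Pauli.I).card

/-- The operator `Z` on the qubit `t`, and the identity on all other qubits. -/
def pauliZAt {n : ℕ} (t : Fin n) : Op n :=
  pauliOp (Function.update (fun _ => Pauli.I) t Pauli.Z)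

/-- A Pauli string with a sign `±1`. -/
def signedPauli {n : ℕ} (s : ℤˣ) (P : PauliString n) : Op n :=
  (((s : ℤ) : ℂ)) • pauliOp P

/-! ### Stabilizer codes with one logical qubit -/

/-- A stabilizer code encoding one logical qubit into `n` physical qubits: `n - 1` commuting
signed Pauli strings that are independent (no nontrivial product of them is a multiple of the
identity; in particular `-1` is not such a product). -/
structure StabilizerCode (n : ℕ) where
  gen : Fin (n - 1) → PauliString n
  sign : Fin (n - 1) → ℤˣ
  comm : ∀ a b, Commute (signedPauli (sign a) (gen a)) (signedPauli (sign b) (gen b))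
  indep : ∀ (e : Fin (n - 1) → Fin 2) (c : ℂ),
    (List.ofFn fun a => signedPauli (sign a) (gen a) ^ (e a : ℕ)).prod = c • (1 : Op n) → e = 0

namespace StabilizerCode

variable {n : ℕ} (C : StabilizerCode n)

/-- The stabilizer generator `S_a`. -/
def S (a : Fin (n - 1)) : Op n := signedPauli (C.sign a) (C.gen a)

/-- `A` is a scalar multiple of an element of the stabilizer group, the group formed by the
products of the generators. -/
def InStabilizer (A : Op n) : Prop :=
  ∃ (e : Fin (n - 1) → Fin 2) (c : ℂ), A = c • (List.ofFn fun a => C.S a ^ (e a : ℕ)).prod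

/-- `P` is a nontrivial logical operator: it commutes with every stabilizer, without being a
stabilizer up to a phase. -/
def IsLogical (P : PauliString n) : Prop :=
  (∀ a, Commute (pauliOp P) (C.S a)) ∧ ¬ C.InStabilizer (pauliOp P)

/-- The code has distance `d`: this is the least weight of a nontrivial logical operator. -/
def HasDistance (d : ℕ) : Prop :=
  (∃ P : PauliString n, C.IsLogical P ∧ weight P = d) ∧
    ∀ P : PauliString n, C.IsLogical P → d ≤ weight P

/-- The perturbed Hamiltonian `H = H₀ + l V`, where `H₀ = -∑ₐ Sₐ`. -/
def hamiltonian (V : Op n) (l : ℝ) : Op n := -(∑ a, C.S a) + (l : ℂ) • V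

end StabilizerCode

/-! ### Local perturbations -/

/-- `A` acts only on the qubits in `T`: it is `M ⊗ 1` with `M` an operator on these qubits. -/
def ActsOn {n : ℕ} (T : Finset (Fin n)) (A : Op n) : Prop :=
  ∃ M : Matrix (T → Fin 2) (T → Fin 2) ℂ, ∀ x y : Bits n,
    ((∀ i, i ∉ T → x i = y i) → A x y = M (fun i => x i) (fun i => y i)) ∧
      ((∃ i, i ∉ T ∧ x i ≠ y i) → A x y = 0)

/-- A `k`-local perturbation: a sum of Hermitian terms, each acting on at most `k` qubits. -/
def IsLocal {n : ℕ} (k : ℕ) (V : Op n) : Prop :=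
  ∃ (N : ℕ) (W : Fin N → Op n),
    (∀ i, (W i).IsHermitian ∧ ∃ T : Finset (Fin n), T.card ≤ k ∧ ActsOn T (W i)) ∧ V = ∑ i, W i

/-! ### Codewords of the perturbed code -/

/-- `ψ 0, ψ 1` are orthonormal eigenvectors of `H` for its two lowest eigenvalues (counted with
multiplicity). -/
def IsLowestPair {n : ℕ} (H : Op n) (ψ : Fin 2 → Vec n) : Prop :=
  (∀ i j, star (ψ i) ⬝ᵥ ψ j = if i = j then 1 else 0) ∧
    ∃ E : Fin 2 → ℝ, (∀ i, H *ᵥ ψ i = (E i : ℂ) • ψ i) ∧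
      ∀ (e : ℝ) (χ : Vec n), χ ≠ 0 → H *ᵥ χ = (e : ℂ) • χ →
        (∀ i, star (ψ i) ⬝ᵥ χ = 0) → ∀ i, E i ≤ e

/-- The codewords `Ω_i = ∑ⱼ u_{ij} ψ_j`. -/
def codeword {n : ℕ} (u : Matrix (Fin 2) (Fin 2) ℂ) (ψ : Fin 2 → Vec n) (i : Fin 2) : Vec n :=
  ∑ j, u i j • ψ j

/-- The encoded state `cos θ Ω₀ + exp(iφ) sin θ Ω₁`. -/
def encoded {n : ℕ} (Ω : Fin 2 → Vec n) (θ φ : ℝ) : Vec n :=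
  (Real.cos θ : ℂ) • Ω 0 + (Complex.exp (φ * Complex.I) * (Real.sin θ : ℂ)) • Ω 1

/-! ### Noise and decoding error -/

/-- `prob` is a probability distribution on Pauli strings of weight at most `p`. -/
def IsNoise {n : ℕ} (p : ℕ) (prob : PauliString n → ℝ) : Prop :=
  (∀ P, 0 ≤ prob P) ∧ ∑ P, prob P = 1 ∧ ∀ P, prob P ≠ 0 → weight P ≤ p

/-- The three logical measurement bases. -/
inductive LogicalBasis : Type
  | X | Y | Z

/-- The ideal expectation value of the logical Pauli operator in the state with Bloch
angles `θ, φ`. -/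
def label : LogicalBasis → ℝ → ℝ → ℝ
  | LogicalBasis.X, θ, φ => Real.sin (2 * θ) * Real.cos φ
  | LogicalBasis.Y, θ, φ => Real.sin (2 * θ) * Real.sin φ
  | LogicalBasis.Z, θ, _ => Real.cos (2 * θ)

/-- The expectation value `⟨ψ|A|ψ⟩` (a real number for Hermitian `A`). -/
def expectation {n : ℕ} (A : Op n) (ψ : Vec n) : ℝ := (star ψ ⬝ᵥ (A *ᵥ ψ)).re

/-- The mean square decoding error of the observable `O`, for inputs encoded by the
codewords `Ω` with angles distributed by `μ` and corrupted by Pauli noise. -/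
def decodingError {n : ℕ} (μ : MeasureTheory.Measure (ℝ × ℝ)) (prob : PauliString n → ℝ)
    (Ω : Fin 2 → Vec n) (Q : LogicalBasis) (O : Op n) : ℝ :=
  ∑ P, prob P * ∫ x in Set.Icc (0 : ℝ) Real.pi ×ˢ Set.Icc (0 : ℝ) (2 * Real.pi),
    (expectation (pauliOp P * O * pauliOp P) (encoded Ω x.1 x.2) - label Q x.1 x.2) ^ 2 ∂μ

/-- The observable `U† Z_t U` measured by a quantum neural network with unitary `U` and
output qubit `t`. -/
def qnnObservable {n : ℕ} (t : Fin n) (U : Op n) : Op n := Uᴴ * pauliZAt t * U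

/-- The noise operators remain independent errors under the perturbation: two noise operators
that act in the same way (up to a phase) on the unperturbed code have a product commuting
with `V`. -/
def IndependentErrors {n : ℕ} (C : StabilizerCode n) (V : Op n) (prob : PauliString n → ℝ) :
    Prop :=
  ∀ P P' : PauliString n, prob P ≠ 0 → prob P' ≠ 0 →
    C.InStabilizer (pauliOp P * pauliOp P') → Commute (pauliOp P * pauliOp P') V

end PerturbedCode

end

open PerturbedCode

/-! Write D for the unperturbed Hamiltonian shifted to ground energy 0, P for the code projector, Ω
for the isometry whose columns are the codewords, σ for the logical Pauli matrix, and O for the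
measured observable. The integrand of the decoding error is at most δ², where δ bounds ‖Ω†EOEΩ − σ‖
over all noise operators E of positive probability (`decodingError_le`). It therefore suffices to
find O with δ = O(λ^(2(m+1))), where m + 1 = ⌈(d−2p)/k⌉; when d > 2p, this m is the largest integer
with 2p + mk < d.

Locality of the perturbed code. A Pauli string of weight below d either is a stabilizer up to phase,
hence scalar on the code space, or sends the code space into an eigenspace of D of positive energy.
Hence the Bloch equation can be solved order by order with a scalar effective energy as long as the
residual has weight below d (`exists_bloch`): the low-energy space is (1 + λB(λ))P applied to itself
up to O(λ^(m+1)), and the coefficient of λ^j in the dressing 1 + λB has weight at most jk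
(`exists_norm_sub_dressed_le`). A product of two noise operators has weight at most 2p, so
sandwiching it between two dressings stays below weight d through order λ^m. This gives Ω†EE'Ω = c·1
+ O(λ^(m+1)) (`exists_lowFrame_knill_laflamme`).

Doubling the exponent. Choose one noise operator E_b per syndrome. The Gram matrix of the blocks
E_bΩ is c ⊗ 1 + R with R = O(λ^(m+1)). Factor it as A†A and let O act as S = 1 ⊗ σ on the
orthonormalized family. Then A is chosen so that the compression of O to the original blocks is (c ⊗
1)S + (SR + RS)/2 + O(R²) (`exists_gram_factorization`). Only diagonal blocks enter the decoding
error, and there c is 1 and R vanishes because E_b² = 1, so the first-order term disappears and δ is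
quadratic in R. Squaring once more gives λ^(4(m+1)). `exists_decoder` realizes such an O as a
conjugate of Z on one qubit.

Degenerate errors. If E and E_b have the same syndrome, then E_bE is a stabilizer up to phase. By
the independence hypothesis it commutes with V, so it is a symmetry of the perturbed Hamiltonian and
acts on the low-energy space as the scalar by which it acts on the code space
(`exists_symmetry_mul_eq_smul`). Thus EΩ and E_bΩ agree up to a phase.

Independence is not assumed when 0 < d − 2p ≤ k. Then m = 0, and one decodes the normalized
projection of Ω to the unperturbed code; the excited part is O(λ) and orthogonality removes its
cross terms, so δ = O(λ²) (`exists_first_order_decoder`). If d ≤ 2p the exponent is nonpositive and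
boundedness suffices. -/

namespace PerturbedCode

/-! ### Tensor products of single-qubit operators -/

/-- The tensor product of single-qubit operators. -/
def tensorOp {n : ℕ} (F : Fin n → Matrix (Fin 2) (Fin 2) ℂ) : Op n :=
  Matrix.of fun x y => ∏ i, F i (x i) (y i)

theorem pauliOp_eq_tensorOp {n : ℕ} (P : PauliString n) :
    pauliOp P = tensorOp fun i => (P i).mat := rfl

theorem tensorOp_mul {n : ℕ} (F G : Fin n → Matrix (Fin 2) (Fin 2) ℂ) :
    tensorOp F * tensorOp G = tensorOp fun i => F i * G i := by
  ext x y
  simp only [tensorOp, Matrix.mul_apply, Matrix.of_apply, ← Finset.prod_mul_distrib]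
  rw [Finset.prod_univ_sum, Fintype.piFinset_univ]

theorem tensorOp_smul {n : ℕ} (c : Fin n → ℂ) (F : Fin n → Matrix (Fin 2) (Fin 2) ℂ) :
    tensorOp (fun i => c i • F i) = (∏ i, c i) • tensorOp F := by
  ext x y
  simp [tensorOp, Finset.prod_mul_distrib]

theorem tensorOp_sum {n : ℕ} {κ : Type*} [Fintype κ]
    (F : Fin n → κ → Matrix (Fin 2) (Fin 2) ℂ) :
    tensorOp (fun i => ∑ a, F i a) = ∑ f : Fin n → κ, tensorOp fun i => F i (f i) := by
  classical
  ext x y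
  simp only [tensorOp, Matrix.of_apply, Matrix.sum_apply]
  rw [Finset.prod_univ_sum, Fintype.piFinset_univ]

theorem tensorOp_one {n : ℕ} : tensorOp (fun _ : Fin n => 1) = 1 := by
  ext x y
  simp only [tensorOp, Matrix.of_apply, Matrix.one_apply]
  by_cases h : x = y
  · simp [h]
  · obtain ⟨i, hi⟩ := Function.ne_iff.1 h
    rw [if_neg h]
    exact Finset.prod_eq_zero (Finset.mem_univ i) (if_neg hi)

theorem tensorOp_conjTranspose {n : ℕ} (F : Fin n → Matrix (Fin 2) (Fin 2) ℂ) :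
    (tensorOp F)ᴴ = tensorOp fun i => (F i)ᴴ := by
  ext x y
  simp [tensorOp, Matrix.conjTranspose_apply]

theorem trace_tensorOp {n : ℕ} (F : Fin n → Matrix (Fin 2) (Fin 2) ℂ) :
    (tensorOp F).trace = ∏ i, (F i).trace := by
  simp only [Matrix.trace, Matrix.diag, tensorOp, Matrix.of_apply]
  rw [Finset.prod_univ_sum, Fintype.piFinset_univ]

/-! ### Algebra of Pauli operators -/

theorem Pauli.mat_I : Pauli.I.mat = 1 := by
  ext i j; fin_cases i <;> fin_cases j <;> simp [Pauli.mat]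

theorem Pauli.mat_conjTranspose (P : Pauli) : P.matᴴ = P.mat := by
  cases P <;> ext i j <;> fin_cases i <;> fin_cases j <;>
    simp [Pauli.mat, Matrix.conjTranspose_apply]

theorem Pauli.mat_mul_self (P : Pauli) : P.mat * P.mat = 1 := by
  cases P <;> ext i j <;> fin_cases i <;> fin_cases j <;>
    simp [Pauli.mat, Matrix.mul_apply, Fin.sum_univ_two]

theorem Pauli.trace_mat (P : Pauli) : P.mat.trace = if P = Pauli.I then 2 else 0 := by
  cases P <;> simp [Pauli.mat, Matrix.trace, Fin.sum_univ_two, one_add_one_eq_two]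

theorem Pauli.mat_comm (P Q : Pauli) :
    ∃ s : ℤˣ, P.mat * Q.mat = (((s : ℤ) : ℂ)) • (Q.mat * P.mat) := by
  cases P <;> cases Q <;>
  first
  | (refine ⟨1, ?_⟩
     ext i j; fin_cases i <;> fin_cases j <;>
      simp [Pauli.mat, Matrix.mul_apply, Fin.sum_univ_two]; done)
  | (refine ⟨-1, ?_⟩
     ext i j; fin_cases i <;> fin_cases j <;>
      simp [Pauli.mat, Matrix.mul_apply, Fin.sum_univ_two])

/-- The product of two Pauli labels, up to a phase. -/
def Pauli.mulLabel : Pauli → Pauli → Pauli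
  | Pauli.I, Q => Q
  | P, Pauli.I => P
  | Pauli.X, Pauli.X => Pauli.I
  | Pauli.Y, Pauli.Y => Pauli.I
  | Pauli.Z, Pauli.Z => Pauli.I
  | Pauli.X, Pauli.Y => Pauli.Z
  | Pauli.Y, Pauli.X => Pauli.Z
  | Pauli.Y, Pauli.Z => Pauli.X
  | Pauli.Z, Pauli.Y => Pauli.X
  | Pauli.X, Pauli.Z => Pauli.Y
  | Pauli.Z, Pauli.X => Pauli.Y

theorem Pauli.mat_mul (P Q : Pauli) :
    ∃ c : ℂ, c ≠ 0 ∧ P.mat * Q.mat = c • (Pauli.mulLabel P Q).mat := by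
  cases P <;> cases Q <;>
  first
  | (refine ⟨1, one_ne_zero, ?_⟩
     ext i j; fin_cases i <;> fin_cases j <;>
      simp [Pauli.mat, Pauli.mulLabel, Matrix.mul_apply, Fin.sum_univ_two]; done)
  | (refine ⟨Complex.I, Complex.I_ne_zero, ?_⟩
     ext i j; fin_cases i <;> fin_cases j <;>
      simp [Pauli.mat, Pauli.mulLabel, Matrix.mul_apply, Fin.sum_univ_two]; done)
  | (refine ⟨-Complex.I, neg_ne_zero.2 Complex.I_ne_zero, ?_⟩
     ext i j; fin_cases i <;> fin_cases j <;>
      simp [Pauli.mat, Pauli.mulLabel, Matrix.mul_apply, Fin.sum_univ_two])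

theorem pauliOp_one {n : ℕ} : pauliOp (fun _ : Fin n => Pauli.I) = 1 := by
  rw [pauliOp_eq_tensorOp]
  simp only [Pauli.mat_I, tensorOp_one]

theorem pauliOp_isHermitian {n : ℕ} (P : PauliString n) : (pauliOp P)ᴴ = pauliOp P := by
  rw [pauliOp_eq_tensorOp, tensorOp_conjTranspose]
  simp only [Pauli.mat_conjTranspose]

theorem pauliOp_mul_self {n : ℕ} (P : PauliString n) : pauliOp P * pauliOp P = 1 := by
  rw [pauliOp_eq_tensorOp, tensorOp_mul]
  simp only [Pauli.mat_mul_self, tensorOp_one]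

theorem trace_pauliOp {n : ℕ} (P : PauliString n) (hP : ∃ i, P i ≠ Pauli.I) :
    (pauliOp P).trace = 0 := by
  obtain ⟨i, hi⟩ := hP
  rw [pauliOp_eq_tensorOp, trace_tensorOp]
  exact Finset.prod_eq_zero (Finset.mem_univ i) (by rw [Pauli.trace_mat, if_neg hi])

theorem pauliOp_comm {n : ℕ} (P Q : PauliString n) :
    ∃ s : ℤˣ, pauliOp P * pauliOp Q = (((s : ℤ) : ℂ)) • (pauliOp Q * pauliOp P) := by
  choose s hs using fun i => Pauli.mat_comm (P i) (Q i)
  refine ⟨∏ i, s i, ?_⟩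
  simp only [pauliOp_eq_tensorOp, tensorOp_mul, hs]
  rw [tensorOp_smul (fun i => ((s i : ℤ) : ℂ))]
  congr 1
  push_cast
  rfl

theorem pauliOp_mul {n : ℕ} (P Q : PauliString n) :
    ∃ c : ℂ, c ≠ 0 ∧
      pauliOp P * pauliOp Q = c • pauliOp fun i => Pauli.mulLabel (P i) (Q i) := by
  choose c hc h using fun i => Pauli.mat_mul (P i) (Q i)
  refine ⟨∏ i, c i, Finset.prod_ne_zero_iff.2 fun i _ => hc i, ?_⟩
  simp only [pauliOp_eq_tensorOp, tensorOp_mul, h]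
  rw [tensorOp_smul c]

theorem weight_mulLabel_le {n : ℕ} (P Q : PauliString n) :
    weight (fun i => Pauli.mulLabel (P i) (Q i)) ≤ weight P + weight Q := by
  unfold weight
  refine (Finset.card_le_card ?_).trans (Finset.card_union_le _ _)
  intro i hi
  simp only [Finset.mem_filter, Finset.mem_univ, true_and, Finset.mem_union] at hi ⊢
  by_contra! h
  rw [h.1, h.2] at hi
  exact hi rfl

/-! ### Operators of bounded Pauli weight -/

/-- The span of the Pauli strings of weight at most `w`. -/
def localOps (n w : ℕ) : Submodule ℂ (Op n) :=
  Submodule.span ℂ {A | ∃ P : PauliString n, weight P ≤ w ∧ A = pauliOp P}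

theorem pauliOp_mem_localOps {n w : ℕ} {P : PauliString n} (h : weight P ≤ w) :
    pauliOp P ∈ localOps n w := Submodule.subset_span ⟨P, h, rfl⟩

theorem localOps_mono {n v w : ℕ} (h : v ≤ w) : localOps n v ≤ localOps n w := by
  refine Submodule.span_mono ?_
  rintro A ⟨P, hP, rfl⟩
  exact ⟨P, hP.trans h, rfl⟩

theorem one_mem_localOps {n : ℕ} (w : ℕ) : (1 : Op n) ∈ localOps n w := by
  rw [← pauliOp_one]
  exact pauliOp_mem_localOps (by simp [weight])

theorem mul_mem_localOps {n v w : ℕ} {A B : Op n} (hA : A ∈ localOps n v)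
    (hB : B ∈ localOps n w) : A * B ∈ localOps n (v + w) := by
  unfold localOps at hA hB
  induction hA, hB using Submodule.span_induction₂ with
  | mem_mem A B hA hB =>
    obtain ⟨P, hP, rfl⟩ := hA
    obtain ⟨Q, hQ, rfl⟩ := hB
    obtain ⟨c, -, h⟩ := pauliOp_mul P Q
    rw [h]
    exact Submodule.smul_mem _ _
      (pauliOp_mem_localOps ((weight_mulLabel_le P Q).trans (add_le_add hP hQ)))
  | zero_left => simp
  | zero_right => simp
  | add_left A B X _ _ _ h1 h2 => rw [add_mul]; exact Submodule.add_mem _ h1 h2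
  | add_right A B X _ _ _ h1 h2 => rw [mul_add]; exact Submodule.add_mem _ h1 h2
  | smul_left r A B _ _ h => rw [smul_mul_assoc]; exact Submodule.smul_mem _ _ h
  | smul_right r A B _ _ h => rw [mul_smul_comm]; exact Submodule.smul_mem _ _ h

theorem conjTranspose_mem_localOps {n w : ℕ} {A : Op n} (hA : A ∈ localOps n w) :
    Aᴴ ∈ localOps n w := by
  unfold localOps at hA
  induction hA using Submodule.span_induction with
  | mem A hA =>
    obtain ⟨P, hP, rfl⟩ := hA
    rw [pauliOp_isHermitian]
    exact pauliOp_mem_localOps hP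
  | zero => simp
  | add A B _ _ h1 h2 => rw [Matrix.conjTranspose_add]; exact Submodule.add_mem _ h1 h2
  | smul r A _ h => rw [Matrix.conjTranspose_smul]; exact Submodule.smul_mem _ _ h

theorem exists_pauli_expansion (F : Matrix (Fin 2) (Fin 2) ℂ) :
    ∃ c : Pauli → ℂ, F = ∑ P, c P • P.mat := by
  refine ⟨fun P => match P with
    | Pauli.I => (F 0 0 + F 1 1) / 2
    | Pauli.X => (F 0 1 + F 1 0) / 2
    | Pauli.Y => Complex.I * (F 0 1 - F 1 0) / 2
    | Pauli.Z => (F 0 0 - F 1 1) / 2, ?_⟩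
  have hu : (Finset.univ : Finset Pauli) = {Pauli.I, Pauli.X, Pauli.Y, Pauli.Z} := rfl
  have hI := Complex.I_mul_I
  rw [hu]
  ext i j
  fin_cases i <;> fin_cases j <;> simp [Pauli.mat] <;> ring_nf <;> simp [Complex.I_sq] <;> ring

/-- Each factor is expanded in the Pauli basis, the factors outside `T` with only an identity
coefficient; every surviving product string is then the identity outside `T`. -/
theorem tensorOp_mem_localOps {n : ℕ} (T : Finset (Fin n))
    (F : Fin n → Matrix (Fin 2) (Fin 2) ℂ) (hF : ∀ i, i ∉ T → F i = 1) :
    tensorOp F ∈ localOps n T.card := by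
  have h : ∀ i, ∃ c : Pauli → ℂ, F i = ∑ P, c P • P.mat ∧ (i ∉ T → ∀ P, P ≠ Pauli.I → c P = 0) := by
    intro i
    by_cases hi : i ∈ T
    · obtain ⟨c, hc⟩ := exists_pauli_expansion (F i)
      exact ⟨c, hc, fun h => absurd hi h⟩
    · refine ⟨fun P => if P = Pauli.I then 1 else 0, ?_, fun _ P hP => if_neg hP⟩
      simp [hF i hi, Pauli.mat_I]
  choose c hc hc0 using h
  have : tensorOp F = ∑ f : Fin n → Pauli, (∏ i, c i (f i)) • pauliOp f := by
    have h1 : F = fun i => ∑ P, c i P • P.mat := funext hc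
    rw [h1, tensorOp_sum]
    exact Finset.sum_congr rfl fun f _ => tensorOp_smul (fun i => c i (f i)) _
  rw [this]
  refine Submodule.sum_mem _ fun f _ => ?_
  by_cases hf : ∀ i, i ∉ T → f i = Pauli.I
  · refine Submodule.smul_mem _ _ (pauliOp_mem_localOps (Finset.card_le_card fun i hi => ?_))
    by_contra hiT
    exact (Finset.mem_filter.1 hi).2 (hf i hiT)
  · push Not at hf
    obtain ⟨i, hi, hi'⟩ := hf
    rw [Finset.prod_eq_zero (Finset.mem_univ i) (hc0 i hi _ hi'), zero_smul]
    exact Submodule.zero_mem _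

theorem ActsOn.mem_localOps {n : ℕ} {T : Finset (Fin n)} {A : Op n} (hA : ActsOn T A) :
    A ∈ localOps n T.card := by
  classical
  obtain ⟨M, hM⟩ := hA
  -- A product of matrix units on `T` and identities elsewhere. These tensor products span the
  -- operators supported on `T`, with the entries of `M` as coefficients.
  let F : (T → Fin 2) → (T → Fin 2) → Fin n → Matrix (Fin 2) (Fin 2) ℂ := fun a b i =>
    if h : i ∈ T then Matrix.single (a ⟨i, h⟩) (b ⟨i, h⟩) 1 else 1
  have key : A = ∑ a, ∑ b, M a b • tensorOp (F a b) := by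
    ext x y
    simp only [Matrix.sum_apply, Matrix.smul_apply, smul_eq_mul]
    have hz : ∀ a b : T → Fin 2, (a ≠ (fun i : T => x i) ∨ b ≠ (fun i : T => y i)) → tensorOp (F a b) x y = 0 := by
      intro a b hab
      have : ∃ i : T, a i ≠ x i ∨ b i ≠ y i := by
        rcases hab with h | h <;> obtain ⟨i, hi⟩ := Function.ne_iff.1 h
        · exact ⟨i, Or.inl hi⟩
        · exact ⟨i, Or.inr hi⟩
      obtain ⟨i, hi⟩ := this
      refine Finset.prod_eq_zero (Finset.mem_univ i.1) ?_
      simp only [F, dif_pos i.2, Matrix.single_apply]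
      rw [if_neg]
      rintro ⟨h1, h2⟩
      rcases hi with h | h
      · exact h h1
      · exact h h2
    have hz' : ∀ a b : T → Fin 2, (a ≠ (fun i : T => x i) ∨ b ≠ (fun i : T => y i)) →
        M a b * tensorOp (F a b) x y = 0 := fun a b h => by rw [hz a b h, mul_zero]
    have hs : ∑ a, ∑ b, M a b * tensorOp (F a b) x y =
        M (fun i => x i) (fun i => y i) * tensorOp (F (fun i => x i) fun i => y i) x y :=
      (Fintype.sum_eq_single (fun i : T => x i) fun a ha =>
        Finset.sum_eq_zero fun b _ => hz' a b (Or.inl ha)).trans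
        (Fintype.sum_eq_single (fun i : T => y i) fun b hb => hz' _ b (Or.inr hb))
    rw [hs]
    by_cases h : ∀ i, i ∉ T → x i = y i
    · rw [(hM x y).1 h]
      have : tensorOp (F (fun i => x i) fun i => y i) x y = 1 := by
        change ∏ i, F (fun i => x i) (fun i => y i) i (x i) (y i) = 1
        refine Finset.prod_eq_one fun i _ => ?_
        by_cases hi : i ∈ T
        · simp [F, hi]
        · simp [F, hi, h i hi]
      rw [this, mul_one]
    · push Not at h
      obtain ⟨i, hi, hi'⟩ := h
      rw [(hM x y).2 ⟨i, hi, hi'⟩]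
      have : tensorOp (F (fun i => x i) fun i => y i) x y = 0 :=
        Finset.prod_eq_zero (Finset.mem_univ i) (by simp [F, hi, hi'])
      rw [this, mul_zero]
  rw [key]
  refine Submodule.sum_mem _ fun a _ => Submodule.sum_mem _ fun b _ => Submodule.smul_mem _ _ ?_
  exact tensorOp_mem_localOps T _ fun i hi => dif_neg hi

theorem IsLocal.mem_localOps {n k : ℕ} {V : Op n} (hV : IsLocal k V) : V ∈ localOps n k := by
  obtain ⟨N, W, hW, rfl⟩ := hV
  refine Submodule.sum_mem _ fun i _ => ?_
  obtain ⟨T, hT, h⟩ := (hW i).2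
  exact localOps_mono hT h.mem_localOps

theorem IsLocal.isHermitian {n k : ℕ} {V : Op n} (hV : IsLocal k V) : Vᴴ = V := by
  obtain ⟨N, W, hW, rfl⟩ := hV
  rw [Matrix.conjTranspose_sum]
  exact Finset.sum_congr rfl fun i _ => (hW i).1

end PerturbedCode

namespace PerturbedCode

open scoped ComplexOrder

/-! ### Products of commuting projections -/

/-- The last claim is a union bound for commuting projections and becomes the spectral gap of the
code Hamiltonian. The induction adds one projection `q 0` to the product `T` of the others; the
inequality then grows by (1 − q₀)(1 − T), a product of commuting projections and therefore
nonnegative. -/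
theorem list_prod_projection {ι : Type*} [Fintype ι] [DecidableEq ι] {m : ℕ}
    (q : Fin m → Matrix ι ι ℂ) (hq : ∀ a, (q a)ᴴ = q a) (hq2 : ∀ a, q a * q a = q a)
    (hc : ∀ a b, Commute (q a) (q b)) :
    ((List.ofFn q).prod)ᴴ = (List.ofFn q).prod ∧
      (List.ofFn q).prod * (List.ofFn q).prod = (List.ofFn q).prod ∧
      (∀ a, q a * (List.ofFn q).prod = (List.ofFn q).prod) ∧
      (∑ a, (1 - q a) - (1 - (List.ofFn q).prod)).PosSemidef := by
  induction m with
  | zero => simp [Matrix.PosSemidef.zero]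
  | succ m ih =>
    obtain ⟨h1, h2, h3, h4⟩ := ih (fun a => q a.succ) (fun a => hq _) (fun a => hq2 _)
      (fun a b => hc _ _)
    rw [List.ofFn_succ, List.prod_cons]
    set T := (List.ofFn fun a : Fin m => q a.succ).prod with hT
    have hcT : Commute (q 0) T := by
      refine Commute.list_prod_right _ _ fun x hx => ?_
      obtain ⟨a, rfl⟩ := (List.mem_ofFn' _ _).1 hx
      exact hc _ _
    refine ⟨?_, ?_, ?_, ?_⟩
    · rw [Matrix.conjTranspose_mul, h1, hq, hcT.eq]
    · calc q 0 * T * (q 0 * T) = q 0 * (T * q 0) * T := by simp only [mul_assoc]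
        _ = (q 0 * q 0) * (T * T) := by rw [← hcT.eq]; simp only [mul_assoc]
        _ = q 0 * T := by rw [hq2, h2]
    · intro a
      refine Fin.cases ?_ (fun a => ?_) a
      · rw [← mul_assoc, hq2]
      · rw [← mul_assoc, (hc a.succ 0).eq, mul_assoc, h3]
    · rw [Fin.sum_univ_succ]
      have hp : (q 0 * (1 - T)) = (q 0 * (1 - T))ᴴ * (q 0 * (1 - T)) := by
        have hc' : Commute (q 0) (1 - T) := (Commute.one_right _).sub_right hcT
        have h2' : (1 - T) * (1 - T) = 1 - T := by
          rw [sub_mul, mul_sub, mul_sub, h2]; simp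
        rw [Matrix.conjTranspose_mul, Matrix.conjTranspose_sub, h1, hq, Matrix.conjTranspose_one]
        calc q 0 * (1 - T) = (q 0 * q 0) * ((1 - T) * (1 - T)) := by rw [hq2, h2']
          _ = (q 0 * (q 0 * (1 - T))) * (1 - T) := by simp only [mul_assoc]
          _ = (1 - T) * q 0 * (q 0 * (1 - T)) := by
            rw [hc'.eq, ← mul_assoc, hc'.eq]; simp only [mul_assoc]; rw [hc'.eq]
      have : (1 - q 0 + ∑ a : Fin m, (1 - q a.succ) - (1 - q 0 * T)) =
          (∑ a : Fin m, (1 - q a.succ) - (1 - T)) +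
            ((1 - q 0) * (1 - T))ᴴ * ((1 - q 0) * (1 - T)) := by
        have h2' : (1 - T) * (1 - T) = 1 - T := by
          rw [sub_mul, mul_sub, mul_sub, h2]; simp
        have hq2' : (1 - q 0) * (1 - q 0) = 1 - q 0 := by
          rw [sub_mul, mul_sub, mul_sub, hq2]; simp
        have hc' : Commute (1 - q 0) (1 - T) :=
          ((Commute.one_left _).sub_left ((Commute.one_right _).sub_right hcT))
        have : ((1 - q 0) * (1 - T))ᴴ * ((1 - q 0) * (1 - T)) = (1 - q 0) * (1 - T) := by
          rw [Matrix.conjTranspose_mul, Matrix.conjTranspose_sub, Matrix.conjTranspose_sub, h1, hq,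
            Matrix.conjTranspose_one, ← hc'.eq]
          calc (1 - q 0) * (1 - T) * ((1 - q 0) * (1 - T))
              = (1 - q 0) * ((1 - T) * (1 - q 0)) * (1 - T) := by simp only [mul_assoc]
            _ = ((1 - q 0) * (1 - q 0)) * ((1 - T) * (1 - T)) := by
              rw [← hc'.eq]; simp only [mul_assoc]
            _ = _ := by rw [h2', hq2']
        rw [this]
        noncomm_ring
      rw [this]
      exact h4.add (Matrix.posSemidef_conjTranspose_mul_self _)

/-- Expresses the code projector as the average of the stabilizer group, which makes its trace
computable. -/
theorem list_prod_one_add {R : Type*} [Ring R] [Algebra ℂ R] {m : ℕ} (S : Fin m → R) :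
    (List.ofFn fun a => (1 / 2 : ℂ) • (1 + S a)).prod =
      (1 / 2 : ℂ) ^ m • ∑ e : Fin m → Fin 2, (List.ofFn fun a => S a ^ (e a : ℕ)).prod := by
  induction m with
  | zero => simp
  | succ m ih =>
    rw [List.ofFn_succ, List.prod_cons, ih fun a => S a.succ,
      ← (Fin.consEquiv fun _ : Fin (m + 1) => Fin 2).sum_comp, Fintype.sum_prod_type,
      Fin.sum_univ_two]
    simp only [List.ofFn_succ, List.prod_cons, Fin.consEquiv_apply, Fin.cons_zero, Fin.cons_succ]
    simp only [Fin.val_zero, pow_zero, one_mul, Fin.val_one, pow_one, ← Finset.mul_sum]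
    rw [smul_mul_smul_comm, pow_succ', add_mul, one_mul]

/-! ### The code projector and the gap of the unperturbed Hamiltonian -/

namespace StabilizerCode

variable {n : ℕ} (C : StabilizerCode n)

theorem S_isHermitian (a : Fin (n - 1)) : (C.S a)ᴴ = C.S a := by
  simp [S, signedPauli, pauliOp_isHermitian]

theorem S_mul_self (a : Fin (n - 1)) : C.S a * C.S a = 1 := by
  rw [S, signedPauli, smul_mul_smul_comm, pauliOp_mul_self]
  rcases Int.units_eq_one_or (C.sign a) with h | h <;> simp [h]

/-- The projector onto the code space. -/
noncomputable def proj : Op n := (List.ofFn fun a => (1 / 2 : ℂ) • (1 + C.S a)).prod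

/-- The unperturbed Hamiltonian, shifted so that its ground state energy is zero. -/
noncomputable def excitation : Op n := ∑ a, (1 - C.S a)

/-- Apply `list_prod_projection` to (1 + S_a)/2. Since 1 − S_a is twice the complementary
projection, the union bound says that leaving the code space costs energy at least 2. -/
theorem proj_spec :
    C.projᴴ = C.proj ∧ C.proj * C.proj = C.proj ∧ (∀ a, C.S a * C.proj = C.proj) ∧
      (C.excitation - (2 : ℂ) • (1 - C.proj)).PosSemidef := by
  obtain ⟨h1, h2, h3, h4⟩ := list_prod_projection (fun a => (1 / 2 : ℂ) • (1 + C.S a))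
    (fun a => by
      rw [Matrix.conjTranspose_smul, Matrix.conjTranspose_add, C.S_isHermitian,
        Matrix.conjTranspose_one]
      simp)
    (fun a => by
      rw [smul_mul_smul_comm, add_mul, mul_add (C.S a), C.S_mul_self, one_mul, mul_one,
        add_comm (C.S a) 1, ← two_smul ℂ (1 + C.S a), smul_smul]
      norm_num)
    (fun a b => by
      have : Commute (C.S a) (C.S b) := C.comm a b
      exact (((Commute.one_left _).add_left (Commute.add_right (Commute.one_right _)
        this)).smul_left _).smul_right _)
  refine ⟨h1, h2, fun a => ?_, ?_⟩
  · have h := h3 a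
    change ((1 / 2 : ℂ) • (1 + C.S a)) * C.proj = C.proj at h
    have h' : (2 : ℂ) • (((1 / 2 : ℂ) • (1 + C.S a)) * C.proj) = (2 : ℂ) • C.proj := by rw [h]
    rw [smul_mul_assoc, smul_smul, add_mul, one_mul, two_smul] at h'
    norm_num at h'
    exact h'
  · have h5 := h4.smul (a := (2 : ℂ)) (by norm_num)
    convert h5 using 1
    change _ = (2 : ℂ) • (_ - (1 - C.proj))
    rw [smul_sub (2 : ℂ) (∑ a, (1 - (1 / 2 : ℂ) • (1 + C.S a))), Finset.smul_sum, excitation]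
    congr 1
    refine Finset.sum_congr rfl fun a _ => ?_
    module

theorem proj_isHermitian : C.projᴴ = C.proj := C.proj_spec.1

theorem proj_mul_self : C.proj * C.proj = C.proj := C.proj_spec.2.1

theorem S_mul_proj (a : Fin (n - 1)) : C.S a * C.proj = C.proj := C.proj_spec.2.2.1 a

theorem proj_mul_S (a : Fin (n - 1)) : C.proj * C.S a = C.proj := by
  have h := congrArg Matrix.conjTranspose (C.S_mul_proj a)
  rwa [Matrix.conjTranspose_mul, C.proj_isHermitian, C.S_isHermitian] at h

theorem excitation_isHermitian : C.excitationᴴ = C.excitation := by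
  simp [excitation, Matrix.conjTranspose_sum, C.S_isHermitian]

theorem excitation_mul_proj : C.excitation * C.proj = 0 := by
  simp [excitation, Finset.sum_mul, sub_mul, C.S_mul_proj]

theorem proj_mul_excitation : C.proj * C.excitation = 0 := by
  rw [excitation, Finset.mul_sum]
  exact Finset.sum_eq_zero fun a _ => by rw [mul_sub, mul_one, C.proj_mul_S, sub_self]

theorem hamiltonian_eq (V : Op n) (l : ℝ) :
    C.hamiltonian V l = C.excitation + (l : ℂ) • V - ((n - 1 : ℕ) : ℂ) • 1 := by
  rw [hamiltonian, excitation, Finset.sum_sub_distrib, Finset.sum_const, Finset.card_univ,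
    Fintype.card_fin, Nat.cast_smul_eq_nsmul]
  abel

theorem excitation_posSemidef : C.excitation.PosSemidef := by
  have h1 := C.proj_spec.2.2.2
  have h2 : (1 - C.proj).PosSemidef := by
    have : (1 - C.proj) = (1 - C.proj)ᴴ * (1 - C.proj) := by
      rw [Matrix.conjTranspose_sub, C.proj_isHermitian, Matrix.conjTranspose_one, sub_mul, mul_sub,
        mul_sub, C.proj_mul_self]
      simp
    rw [this]
    exact Matrix.posSemidef_conjTranspose_mul_self _
  have h3 := h1.add (h2.smul (a := (2 : ℂ)) (by norm_num))
  simpa using h3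

/-- The excitation energy is invertible on the complement of the code space. -/
theorem exists_pseudoinverse : ∃ G : Op n, G * C.excitation = 1 - C.proj := by
  have h2 : C.proj.PosSemidef := by
    have : C.proj = C.projᴴ * C.proj := by rw [C.proj_isHermitian, C.proj_mul_self]
    rw [this]
    exact Matrix.posSemidef_conjTranspose_mul_self _
  -- By the gap, D + 2P dominates 2·1. Its inverse G satisfies GD = G(D + 2P)(1 − P) = 1 − P.
  have h3 : (C.excitation + (2 : ℂ) • C.proj).PosDef := by
    have h := Matrix.PosDef.posSemidef_add C.proj_spec.2.2.2
      ((Matrix.PosDef.one (n := Bits n) (R := ℂ)).smul (a := (2 : ℂ)) (by norm_num))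
    convert h using 1
    rw [smul_sub]; abel
  have hu := h3.isUnit
  obtain ⟨G, hG⟩ := hu.exists_left_inv
  refine ⟨G, ?_⟩
  have : C.excitation = (C.excitation + (2 : ℂ) • C.proj) * (1 - C.proj) := by
    rw [mul_sub, mul_one, add_mul, C.excitation_mul_proj, smul_mul_assoc, C.proj_mul_self]
    abel
  rw [this, ← mul_assoc, hG, one_mul]

theorem exists_prod_eq_pauliOp {m : ℕ} (s : Fin m → ℤˣ) (P : Fin m → PauliString n)
    (e : Fin m → Fin 2) :
    ∃ (c : ℂ) (R : PauliString n), c ≠ 0 ∧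
      (List.ofFn fun a => signedPauli (s a) (P a) ^ (e a : ℕ)).prod = c • pauliOp R := by
  induction m with
  | zero => exact ⟨1, fun _ => Pauli.I, one_ne_zero, by simp [pauliOp_one]⟩
  | succ m ih =>
    obtain ⟨c, R, hc, h⟩ := ih (fun a => s a.succ) (fun a => P a.succ) (fun a => e a.succ)
    rw [List.ofFn_succ, List.prod_cons, h]
    have h0 : ∀ x : Fin 2, x = 0 ∨ x = 1 := by decide
    rcases h0 (e 0) with he | he
    · exact ⟨c, R, hc, by simp [he]⟩
    · obtain ⟨c', hc', h'⟩ := pauliOp_mul (P 0) R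
      have hs : ((s 0 : ℤ) : ℂ) ≠ 0 := by exact_mod_cast (s 0).ne_zero
      refine ⟨((s 0 : ℤ) : ℂ) * c * c', fun i => Pauli.mulLabel (P 0 i) (R i),
        mul_ne_zero (mul_ne_zero hs hc) hc', ?_⟩
      rw [he, Fin.val_one, pow_one, signedPauli, smul_mul_smul_comm, h', smul_smul]

/-- Independence makes every nontrivial product of generators a multiple of a non-identity Pauli
string, hence traceless. Only the identity term of the group average contributes, giving 2^n /
2^(n−1). -/
theorem trace_proj (hn : 1 ≤ n) : C.proj.trace = 2 := by
  rw [proj, list_prod_one_add, Matrix.trace_smul, Matrix.trace_sum, Finset.sum_eq_single 0]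
  · have h1 : (List.ofFn fun a => C.S a ^ ((0 : Fin (n - 1) → Fin 2) a : ℕ)).prod = 1 := by
      refine List.prod_eq_one fun x hx => ?_
      obtain ⟨a, rfl⟩ := (List.mem_ofFn' _ _).1 hx
      simp
    rw [h1, Matrix.trace_one]
    obtain ⟨m, rfl⟩ := Nat.exists_eq_add_of_le' hn
    simp only [Nat.add_sub_cancel, Fintype.card_pi, Fintype.card_fin, Finset.prod_const,
      Finset.card_univ, smul_eq_mul]
    push_cast
    rw [pow_succ, ← mul_assoc, ← mul_pow]
    norm_num
  · intro e _ he
    obtain ⟨c, R, -, h⟩ := exists_prod_eq_pauliOp C.sign C.gen e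
    change (List.ofFn fun a => signedPauli (C.sign a) (C.gen a) ^ (e a : ℕ)).prod.trace = 0
    rw [h, Matrix.trace_smul, trace_pauliOp, smul_zero]
    by_contra! hR
    have : R = fun _ => Pauli.I := funext hR
    rw [this, pauliOp_one] at h
    exact he (C.indep e c h)
  · simp

/-! ### Knill–Laflamme conditions -/

theorem prod_mul_proj (e : Fin (n - 1) → Fin 2) :
    (List.ofFn fun a => C.S a ^ (e a : ℕ)).prod * C.proj = C.proj := by
  have : ∀ L : List (Op n), (∀ A ∈ L, A * C.proj = C.proj) → L.prod * C.proj = C.proj := by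
    intro L
    induction L with
    | nil => simp
    | cons A L ih =>
      intro h
      rw [List.prod_cons, mul_assoc, ih fun B hB => h B (List.mem_cons_of_mem _ hB)]
      exact h A List.mem_cons_self
  refine this _ fun A hA => ?_
  obtain ⟨a, rfl⟩ := (List.mem_ofFn' _ _).1 hA
  have h0 : ∀ x : Fin 2, x = 0 ∨ x = 1 := by decide
  rcases h0 (e a) with he | he <;> simp [he, C.S_mul_proj]

theorem InStabilizer.mul_proj {A : Op n} (hA : C.InStabilizer A) :
    ∃ x : ℂ, A * C.proj = x • C.proj := by
  obtain ⟨e, c, rfl⟩ := hA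
  exact ⟨c, by rw [smul_mul_assoc, C.prod_mul_proj]⟩

theorem InStabilizer.commute_S {A : Op n} (hA : C.InStabilizer A) (a : Fin (n - 1)) :
    Commute A (C.S a) := by
  obtain ⟨e, c, rfl⟩ := hA
  refine Commute.smul_left ?_ _
  refine Commute.list_prod_left _ _ fun x hx => ?_
  obtain ⟨b, rfl⟩ := (List.mem_ofFn' _ _).1 hx
  exact Commute.pow_left (C.comm b a) _

theorem inStabilizer_smul {A : Op n} (c : ℂ) (hA : C.InStabilizer A) : C.InStabilizer (c • A) := by
  obtain ⟨e, c', rfl⟩ := hA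
  exact ⟨e, c * c', by rw [smul_smul]⟩

theorem S_mul_pauliOp (a : Fin (n - 1)) (P : PauliString n) :
    ∃ s : ℤˣ, C.S a * pauliOp P = (((s : ℤ) : ℂ)) • (pauliOp P * C.S a) := by
  obtain ⟨s, hs⟩ := pauliOp_comm (C.gen a) P
  refine ⟨s, ?_⟩
  rw [S, signedPauli, smul_mul_assoc, hs, mul_smul_comm, smul_comm]

/-- Two Pauli strings that do not commute anticommute, so inserting the generator, which is absorbed
by the projector on either side, shows that the compression equals its own negative. -/
theorem proj_mul_pauliOp_mul_proj_of_not_commute {P : PauliString n} {a : Fin (n - 1)}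
    (h : ¬ Commute (pauliOp P) (C.S a)) : C.proj * pauliOp P * C.proj = 0 := by
  obtain ⟨s, hs⟩ := C.S_mul_pauliOp a P
  rcases Int.units_eq_one_or s with rfl | rfl
  · exact absurd (show pauliOp P * C.S a = C.S a * pauliOp P by simpa using hs.symm) h
  · have h1 : C.proj * pauliOp P * C.proj = -(C.proj * pauliOp P * C.proj) := by
      calc C.proj * pauliOp P * C.proj = C.proj * (C.S a * pauliOp P) * C.proj := by
            rw [← mul_assoc, C.proj_mul_S]
        _ = -(C.proj * (pauliOp P * (C.S a * C.proj))) := by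
            rw [hs]; simp [mul_assoc]
        _ = _ := by rw [C.S_mul_proj, ← mul_assoc]
    have h2 : (2 : ℂ) • (C.proj * pauliOp P * C.proj) = 0 := by
      rw [two_smul]
      exact add_eq_zero_iff_eq_neg.2 h1
    exact (smul_eq_zero.1 h2).resolve_left two_ne_zero

/-- A Pauli operator of weight less than the distance acts on the code space as a scalar, up to an
operator in the range of the excitation energy. -/
theorem exists_reduced_pauliOp {d w : ℕ} (hd : C.HasDistance d) (hw : w < d) (P : PauliString n)
    (hP : weight P ≤ w) :
    ∃ (x : ℂ) (Y : Op n), Y ∈ localOps n w ∧ C.proj * Y * C.proj = 0 ∧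
      pauliOp P * C.proj = x • C.proj + C.excitation * Y * C.proj := by
  by_cases h : ∀ a, Commute (pauliOp P) (C.S a)
  -- Otherwise the string would be a logical operator of weight below the distance.
  · have hs : C.InStabilizer (pauliOp P) := by
      by_contra hs
      exact absurd (hd.2 P ⟨h, hs⟩) (by omega)
    obtain ⟨x, hx⟩ := hs.mul_proj
    exact ⟨x, 0, Submodule.zero_mem _, by simp, by simp [hx]⟩
  · push Not at h
    obtain ⟨a, ha⟩ := h
    choose s hs using fun b => C.S_mul_pauliOp b P
    have hsa : s a = -1 := by
      rcases Int.units_eq_one_or (s a) with h1 | h1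
      · have h2 := hs a
        rw [h1] at h2
        exact absurd (show pauliOp P * C.S a = C.S a * pauliOp P by simpa using h2.symm) ha
      · exact h1
    -- The energy of the syndrome of `P`: each anticommuting generator contributes 2. The string
    -- maps the code space into the eigenspace of D with this eigenvalue, so `γ⁻¹ • pauliOp P` is a
    -- preimage under D.
    set γ : ℂ := ∑ b, (1 - ((s b : ℤ) : ℂ)) with hγ
    have hγ0 : γ ≠ 0 := by
      have h1 : γ = ((∑ b, (1 - (s b : ℤ)) : ℤ) : ℂ) := by push_cast; rfl
      have h2 : 0 < ∑ b, (1 - (s b : ℤ)) := by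
        refine Finset.sum_pos' (fun b _ => ?_) ⟨a, Finset.mem_univ a, by simp [hsa]⟩
        rcases Int.units_eq_one_or (s b) with h | h <;> simp [h]
      rw [h1]
      exact_mod_cast h2.ne'
    have hDP : C.excitation * pauliOp P * C.proj = γ • (pauliOp P * C.proj) := by
      rw [excitation, Finset.sum_mul, Finset.sum_mul, hγ, Finset.sum_smul]
      refine Finset.sum_congr rfl fun b _ => ?_
      rw [sub_mul, sub_mul, one_mul, hs, smul_mul_assoc, mul_assoc, C.S_mul_proj, sub_smul,
        one_smul]
    refine ⟨0, γ⁻¹ • pauliOp P, Submodule.smul_mem _ _ (pauliOp_mem_localOps hP), ?_, ?_⟩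
    · rw [mul_smul_comm, smul_mul_assoc, C.proj_mul_pauliOp_mul_proj_of_not_commute ha, smul_zero]
    · rw [mul_smul_comm, smul_mul_assoc, hDP, smul_smul, inv_mul_cancel₀ hγ0]
      simp

/-- On the code space, a local operator equals a scalar up to an operator in the range of the
excitation energy. -/
theorem exists_reduced {d w : ℕ} (hd : C.HasDistance d) (hw : w < d) {X : Op n}
    (hX : X ∈ localOps n w) :
    ∃ (x : ℂ) (Y : Op n), Y ∈ localOps n w ∧ C.proj * Y * C.proj = 0 ∧
      X * C.proj = x • C.proj + C.excitation * Y * C.proj := by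
  unfold localOps at hX
  induction hX using Submodule.span_induction with
  | mem A hA =>
    obtain ⟨P, hP, rfl⟩ := hA
    exact C.exists_reduced_pauliOp hd hw P hP
  | zero => exact ⟨0, 0, Submodule.zero_mem _, by simp, by simp⟩
  | add A B _ _ h1 h2 =>
    obtain ⟨x, Y, hY, h3, h4⟩ := h1
    obtain ⟨x', Y', hY', h3', h4'⟩ := h2
    refine ⟨x + x', Y + Y', Submodule.add_mem _ hY hY', ?_, ?_⟩
    · rw [mul_add, add_mul, h3, h3', add_zero]
    · rw [add_mul, h4, h4', add_smul, mul_add, add_mul]; abel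
  | smul r A _ h =>
    obtain ⟨x, Y, hY, h3, h4⟩ := h
    refine ⟨r * x, r • Y, Submodule.smul_mem _ _ hY, ?_, ?_⟩
    · rw [mul_smul_comm, smul_mul_assoc, h3, smul_zero]
    · rw [smul_mul_assoc, h4, smul_add, smul_smul, mul_smul_comm, smul_mul_assoc]

/-- The Knill–Laflamme condition. -/
theorem exists_proj_mul_mul_proj {d w : ℕ} (hd : C.HasDistance d) (hw : w < d) {X : Op n}
    (hX : X ∈ localOps n w) : ∃ x : ℂ, C.proj * X * C.proj = x • C.proj := by
  obtain ⟨x, Y, -, -, h⟩ := C.exists_reduced hd hw hX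
  refine ⟨x, ?_⟩
  rw [mul_assoc, h, mul_add, mul_smul_comm, C.proj_mul_self, ← mul_assoc, ← mul_assoc,
    C.proj_mul_excitation]
  simp

end StabilizerCode

end PerturbedCode

namespace PerturbedCode

open scoped ComplexOrder Matrix.Norms.L2Operator

/-! ### Operator-valued polynomials of graded locality -/

/-- Operator-valued polynomials in the coupling whose coefficient of degree `j` has Pauli weight at
most `w + j * k`. -/
def graded (n k w : ℕ) : Submodule ℂ (ℝ → Op n) :=
  Submodule.span ℂ {F | ∃ (j : ℕ) (M : Op n), M ∈ localOps n (w + j * k) ∧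
    F = fun l : ℝ => (l : ℂ) ^ j • M}

variable {n k : ℕ}

theorem monomial_mem_graded {w : ℕ} (j : ℕ) {M : Op n} (hM : M ∈ localOps n (w + j * k)) :
    (fun l : ℝ => (l : ℂ) ^ j • M) ∈ graded n k w := Submodule.subset_span ⟨j, M, hM, rfl⟩

theorem const_mem_graded {w : ℕ} {M : Op n} (hM : M ∈ localOps n w) :
    (fun _ => M) ∈ graded n k w := by
  have := monomial_mem_graded (k := k) (w := w) 0 (M := M) (by simpa using hM)
  simpa using this

theorem graded_mono {v w : ℕ} (h : v ≤ w) : graded n k v ≤ graded n k w := by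
  refine Submodule.span_mono ?_
  rintro F ⟨j, M, hM, rfl⟩
  exact ⟨j, M, localOps_mono (by omega) hM, rfl⟩

/-- Each power of the coupling pays for `k` units of weight, one application of the perturbation. -/
theorem smul_mem_graded {w : ℕ} {F : ℝ → Op n} (hF : F ∈ graded n k (w + k)) :
    (fun l : ℝ => (l : ℂ) • F l) ∈ graded n k w := by
  unfold graded at hF
  induction hF using Submodule.span_induction with
  | mem F hF =>
    obtain ⟨j, M, hM, rfl⟩ := hF
    simp only [smul_smul, ← pow_succ']
    refine monomial_mem_graded (j + 1) (localOps_mono (le_of_eq ?_) hM)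
    ring
  | zero =>
    simp only [Pi.zero_apply, smul_zero]
    exact Submodule.zero_mem (graded n k w)
  | add F G _ _ h1 h2 =>
    simp only [Pi.add_apply, smul_add]
    exact Submodule.add_mem _ h1 h2
  | smul r F _ h =>
    simp only [Pi.smul_apply, smul_comm _ r]
    exact Submodule.smul_mem _ r h

theorem eval_smul_mem_graded {w : ℕ} (p : Polynomial ℂ) {F : ℝ → Op n}
    (hF : F ∈ graded n k w) : (fun l : ℝ => p.eval (l : ℂ) • F l) ∈ graded n k w := by
  induction p using Polynomial.induction_on' with
  | add p q h1 h2 =>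
    simp only [Polynomial.eval_add, add_smul]
    exact Submodule.add_mem _ h1 h2
  | monomial j a =>
    simp only [Polynomial.eval_monomial, mul_smul]
    refine Submodule.smul_mem _ a ?_
    induction j with
    | zero => simpa using hF
    | succ j ih =>
      simp only [pow_succ', mul_smul]
      exact smul_mem_graded (graded_mono (by omega) ih)

/-- Splits off the leading coefficient, the one that the next step of the perturbation expansion has
to remove. -/
theorem exists_eq_const_add_smul {w : ℕ} {F : ℝ → Op n} (hF : F ∈ graded n k w) :
    ∃ M ∈ localOps n w, ∃ G ∈ graded n k (w + k), ∀ l : ℝ, F l = M + (l : ℂ) • G l := by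
  unfold graded at hF
  induction hF using Submodule.span_induction with
  | mem F hF =>
    obtain ⟨j, M, hM, rfl⟩ := hF
    cases j with
    | zero => exact ⟨M, by simpa using hM, 0, Submodule.zero_mem _, by simp⟩
    | succ j =>
      refine ⟨0, Submodule.zero_mem _, fun l => (l : ℂ) ^ j • M,
        monomial_mem_graded j (localOps_mono (le_of_eq ?_) hM), fun l => ?_⟩
      · ring
      · simp only [zero_add, smul_smul, pow_succ']
  | zero => exact ⟨0, Submodule.zero_mem _, 0, Submodule.zero_mem _, by simp⟩
  | add F G _ _ h1 h2 =>
    obtain ⟨M, hM, F', hF', h⟩ := h1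
    obtain ⟨N, hN, G', hG', h'⟩ := h2
    refine ⟨M + N, Submodule.add_mem _ hM hN, F' + G', Submodule.add_mem _ hF' hG', fun l => ?_⟩
    simp only [Pi.add_apply, h, h', smul_add]
    abel
  | smul r F _ h =>
    obtain ⟨M, hM, F', hF', h⟩ := h
    refine ⟨r • M, Submodule.smul_mem _ _ hM, r • F', Submodule.smul_mem _ _ hF', fun l => ?_⟩
    simp only [Pi.smul_apply, h, smul_add, smul_comm _ r]

theorem exists_bound_of_mem_graded {w : ℕ} {F : ℝ → Op n} (hF : F ∈ graded n k w) :
    ∃ K, 0 ≤ K ∧ ∀ l : ℝ, |l| ≤ 1 → ‖F l‖ ≤ K := by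
  unfold graded at hF
  induction hF using Submodule.span_induction with
  | mem F hF =>
    obtain ⟨j, M, hM, rfl⟩ := hF
    refine ⟨‖M‖, norm_nonneg _, fun l hl => ?_⟩
    rw [norm_smul, norm_pow, Complex.norm_real, Real.norm_eq_abs]
    exact mul_le_of_le_one_left (norm_nonneg _) (pow_le_one₀ (abs_nonneg _) hl)
  | zero => exact ⟨0, le_rfl, by simp⟩
  | add F G _ _ h1 h2 =>
    obtain ⟨K, hK, h⟩ := h1
    obtain ⟨K', hK', h'⟩ := h2
    exact ⟨K + K', add_nonneg hK hK', fun l hl =>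
      (norm_add_le _ _).trans (add_le_add (h l hl) (h' l hl))⟩
  | smul r F _ h =>
    obtain ⟨K, hK, h⟩ := h
    refine ⟨‖r‖ * K, by positivity, fun l hl => ?_⟩
    rw [Pi.smul_apply, norm_smul]
    exact mul_le_mul_of_nonneg_left (h l hl) (norm_nonneg _)

theorem exists_bound_eval (p : Polynomial ℂ) :
    ∃ K, 0 ≤ K ∧ ∀ l : ℝ, |l| ≤ 1 → ‖p.eval (l : ℂ)‖ ≤ K := by
  induction p using Polynomial.induction_on' with
  | add p q h1 h2 =>
    obtain ⟨K, hK, h⟩ := h1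
    obtain ⟨K', hK', h'⟩ := h2
    refine ⟨K + K', add_nonneg hK hK', fun l hl => ?_⟩
    rw [Polynomial.eval_add]
    exact (norm_add_le _ _).trans (add_le_add (h l hl) (h' l hl))
  | monomial j a =>
    refine ⟨‖a‖, norm_nonneg _, fun l hl => ?_⟩
    rw [Polynomial.eval_monomial, norm_mul, norm_pow, Complex.norm_real, Real.norm_eq_abs]
    exact mul_le_of_le_one_right (norm_nonneg _) (pow_le_one₀ (abs_nonneg _) hl)

/-! ### The Bloch equation and dressed local operators -/

namespace StabilizerCode

variable (C : StabilizerCode n)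

/-- Approximate solutions of the Bloch equation: a local dressing of the code space on which the
perturbed Hamiltonian acts as a scalar up to an error of order `j + 1`. -/
theorem exists_bloch {d : ℕ} (hd : C.HasDistance d) {V : Op n} (hV : V ∈ localOps n k) (j : ℕ)
    (hj : j * k < d) :
    ∃ B ∈ graded n k k, ∃ p : Polynomial ℂ, ∃ X ∈ graded n k ((j + 1) * k), ∀ l : ℝ,
      C.proj * B l * C.proj = 0 ∧
      (C.excitation + (l : ℂ) • V - ((l : ℂ) * p.eval (l : ℂ)) • 1) * (1 + (l : ℂ) • B l) * C.proj =
        (l : ℂ) ^ (j + 1) • (X l * C.proj) := by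
  induction j with
  | zero =>
    refine ⟨0, Submodule.zero_mem _, 0, fun _ => V, const_mem_graded (by simpa using hV),
      fun l => ?_⟩
    simp [add_mul, C.excitation_mul_proj]
  | succ j ih =>
    obtain ⟨B, hB, p, X, hX, h⟩ := ih (lt_of_le_of_lt (Nat.mul_le_mul_right _ (by omega)) hj)
    obtain ⟨X₀, hX₀, X', hX', hXX⟩ := exists_eq_const_add_smul hX
    -- The leading residual has weight at most (j + 1)k < d, so on the code space it is a scalar `x`
    -- plus D applied to a local `Y`. The scalar is absorbed into the energy, and the other part is
    -- cancelled by correcting the dressing by −λ^(j+1) Y.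
    obtain ⟨x, Y, hY, hYP, hxY⟩ := C.exists_reduced hd hj hX₀
    have hYk : Y ∈ localOps n (k + j * k) := localOps_mono (le_of_eq (by ring)) hY
    have hYc : (fun _ => Y) ∈ graded n k ((j + 1 + 1) * k) :=
      const_mem_graded (localOps_mono (Nat.mul_le_mul_right _ (by omega)) hY)
    have e1 : (fun l => B l - (l : ℂ) ^ j • Y) ∈ graded n k k :=
      Submodule.sub_mem _ hB (monomial_mem_graded j hYk)
    -- The new residual: the higher-order tail of the old one and all products created by the two
    -- corrections. The term `V * Y` uses the full weight allowance of (j + 2)k.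
    have e2 : (fun l => X' l - V * Y + p.eval (l : ℂ) • Y - x • B l
        + x • (Polynomial.X ^ j : Polynomial ℂ).eval (l : ℂ) • Y) ∈
        graded n k ((j + 1 + 1) * k) := by
      refine Submodule.add_mem _ (Submodule.sub_mem _ (Submodule.add_mem _ (Submodule.sub_mem _
        (graded_mono (le_of_eq (by ring)) hX') (const_mem_graded (localOps_mono (le_of_eq (by ring))
        (mul_mem_localOps hV hY)))) (eval_smul_mem_graded p hYc))
        (Submodule.smul_mem _ x (graded_mono ?_ hB)))
        (Submodule.smul_mem _ x (eval_smul_mem_graded _ hYc))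
      exact Nat.le_mul_of_pos_left k (Nat.succ_pos _)
    refine ⟨_, e1, p + Polynomial.C x * Polynomial.X ^ j, _, e2, fun l => ⟨?_, ?_⟩⟩
    · rw [mul_sub, sub_mul, (h l).1, mul_smul_comm, smul_mul_assoc, hYP, smul_zero, sub_zero]
    · have h1 := (h l).2
      rw [hXX, add_mul, hxY] at h1
      -- Expanding the corrected equation isolates −λ^(j+1) D Y and −λ^(j+1) x, which cancel the
      -- reduced leading residual.
      have h2 : (C.excitation + (l : ℂ) • V -
            ((l : ℂ) * (p + Polynomial.C x * Polynomial.X ^ j).eval (l : ℂ)) • 1) *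
            (1 + (l : ℂ) • (B l - (l : ℂ) ^ j • Y)) * C.proj =
          (C.excitation + (l : ℂ) • V - ((l : ℂ) * p.eval (l : ℂ)) • 1) * (1 + (l : ℂ) • B l) *
            C.proj - (l : ℂ) ^ (j + 1) • ((C.excitation + (l : ℂ) • V -
              ((l : ℂ) * p.eval (l : ℂ)) • 1) * Y * C.proj) -
            ((l : ℂ) ^ (j + 1) * x) • ((1 + (l : ℂ) • (B l - (l : ℂ) ^ j • Y)) * C.proj) := by
        simp only [Polynomial.eval_add, Polynomial.eval_mul, Polynomial.eval_C,
          Polynomial.eval_pow, Polynomial.eval_X, add_mul, sub_mul, mul_add, mul_sub, mul_one,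
          one_mul, smul_mul_assoc, mul_smul_comm]
        module
      rw [h2, h1]
      simp only [Polynomial.eval_pow, Polynomial.eval_X, add_mul, sub_mul, one_mul,
        smul_mul_assoc]
      module

/-- The Knill–Laflamme condition for dressed operators, up to an error of order `m + 1`. -/
theorem exists_dressed_knill_laflamme {d w m : ℕ} (hd : C.HasDistance d) {X : Op n}
    (hX : X ∈ localOps n w) (hm : w + m * k < d) {F G : ℝ → Op n} (hF : F ∈ graded n k 0)
    (hG : G ∈ graded n k 0) :
    ∃ (g : ℝ → ℂ) (K : ℝ), 0 ≤ K ∧ ∀ l : ℝ, |l| ≤ 1 →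
      ‖C.proj * ((F l)ᴴ * X * G l) * C.proj - g l • C.proj‖ ≤ K * |l| ^ (m + 1) := by
  unfold graded at hF hG
  induction hF, hG using Submodule.span_induction₂ with
  | mem_mem F G hF hG =>
    obtain ⟨i, M, hM, rfl⟩ := hF
    obtain ⟨j, N, hN, rfl⟩ := hG
    rw [zero_add] at hM hN
    have hMN : Mᴴ * X * N ∈ localOps n (i * k + w + j * k) :=
      mul_mem_localOps (mul_mem_localOps (conjTranspose_mem_localOps hM) hX) hN
    have he : ∀ l : ℝ, C.proj * (((l : ℂ) ^ i • M)ᴴ * X * ((l : ℂ) ^ j • N)) * C.proj =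
        (l : ℂ) ^ (i + j) • (C.proj * (Mᴴ * X * N) * C.proj) := by
      intro l
      have hl : star (l : ℂ) = l := Complex.conj_ofReal l
      rw [Matrix.conjTranspose_smul]
      simp only [smul_mul_assoc, mul_smul_comm, star_pow, hl]
      module
    -- Monomials of total degree at most m have weight below d and satisfy the exact condition; all
    -- others are already of order m + 1.
    by_cases hij : i + j ≤ m
    · have : i * k + w + j * k < d := by
        have h1 : (i + j) * k ≤ m * k := Nat.mul_le_mul_right _ hij
        rw [add_mul] at h1
        omega
      obtain ⟨x, hx⟩ := C.exists_proj_mul_mul_proj hd this hMN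
      refine ⟨fun l => (l : ℂ) ^ (i + j) * x, 0, le_rfl, fun l _ => ?_⟩
      rw [he, hx, smul_smul, sub_self]
      simp
    · refine ⟨0, ‖C.proj * (Mᴴ * X * N) * C.proj‖, norm_nonneg _, fun l hl => ?_⟩
      rw [he, Pi.zero_apply, zero_smul, sub_zero, norm_smul, norm_pow, Complex.norm_real,
        Real.norm_eq_abs, mul_comm]
      exact mul_le_mul_of_nonneg_left (pow_le_pow_of_le_one (abs_nonneg _) hl (by omega))
        (norm_nonneg _)
  | zero_left G hG => exact ⟨0, 0, le_rfl, by simp⟩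
  | zero_right F hF => exact ⟨0, 0, le_rfl, by simp⟩
  | add_left F F' G _ _ _ h1 h2 =>
    obtain ⟨g, K, hK, h⟩ := h1
    obtain ⟨g', K', hK', h'⟩ := h2
    refine ⟨g + g', K + K', add_nonneg hK hK', fun l hl => ?_⟩
    rw [add_mul]
    refine le_trans (le_of_eq ?_) ((norm_add_le _ _).trans (add_le_add (h l hl) (h' l hl)))
    congr 1
    simp only [Pi.add_apply, Matrix.conjTranspose_add, add_mul, mul_add, add_smul]
    abel
  | add_right F G G' _ _ _ h1 h2 =>
    obtain ⟨g, K, hK, h⟩ := h1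
    obtain ⟨g', K', hK', h'⟩ := h2
    refine ⟨g + g', K + K', add_nonneg hK hK', fun l hl => ?_⟩
    rw [add_mul]
    refine le_trans (le_of_eq ?_) ((norm_add_le _ _).trans (add_le_add (h l hl) (h' l hl)))
    congr 1
    simp only [Pi.add_apply, add_mul, mul_add, add_smul]
    abel
  | smul_left r F G _ _ h =>
    obtain ⟨g, K, hK, h⟩ := h
    refine ⟨star r • g, ‖r‖ * K, by positivity, fun l hl => ?_⟩
    rw [mul_assoc ‖r‖, ← norm_star r]
    refine le_trans (le_of_eq ?_) (mul_le_mul_of_nonneg_left (h l hl) (norm_nonneg _))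
    rw [← norm_smul]
    congr 1
    simp only [Pi.smul_apply, Matrix.conjTranspose_smul, smul_mul_assoc, mul_smul_comm, smul_sub,
      smul_smul, smul_eq_mul]
  | smul_right r F G _ _ h =>
    obtain ⟨g, K, hK, h⟩ := h
    refine ⟨r • g, ‖r‖ * K, by positivity, fun l hl => ?_⟩
    rw [mul_assoc ‖r‖]
    refine le_trans (le_of_eq ?_) (mul_le_mul_of_nonneg_left (h l hl) (norm_nonneg _))
    rw [← norm_smul]
    congr 1
    simp only [Pi.smul_apply, smul_mul_assoc, mul_smul_comm, smul_sub, smul_smul, smul_eq_mul]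

end StabilizerCode

end PerturbedCode

namespace PerturbedCode

open scoped ComplexOrder Matrix.Norms.L2Operator

/-! ### Low-energy frames -/

/-- Vectors are viewed as one-column matrices, so that the C*-identity and submultiplicativity of
the operator norm replace the Cauchy–Schwarz inequality. -/
theorem norm_dotProduct_mulVec_le {ι : Type*} [Fintype ι] [DecidableEq ι] (A : Matrix ι ι ℂ)
    (y : ι → ℂ) : ‖star y ⬝ᵥ (A *ᵥ y)‖ ≤ ‖A‖ * ‖star y ⬝ᵥ y‖ := by
  have h1 : ∀ x : ι → ℂ, ‖star y ⬝ᵥ x‖ =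
      ‖(Matrix.replicateCol Unit y)ᴴ * Matrix.replicateCol Unit x‖ := by
    intro x
    have : (Matrix.replicateCol Unit y)ᴴ * Matrix.replicateCol Unit x =
        Matrix.diagonal fun _ => star y ⬝ᵥ x := by
      ext i j
      simp [Matrix.mul_apply, dotProduct]
    rw [this, Matrix.l2_opNorm_diagonal]
    simp
  rw [h1, h1, Matrix.replicateCol_mulVec, Matrix.l2_opNorm_conjTranspose_mul_self]
  refine (Matrix.l2_opNorm_mul _ _).trans ?_
  rw [Matrix.l2_opNorm_conjTranspose]
  have h2 := Matrix.l2_opNorm_mul A (Matrix.replicateCol Unit y)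
  calc _ ≤ ‖Matrix.replicateCol Unit y‖ * (‖A‖ * ‖Matrix.replicateCol Unit y‖) :=
        mul_le_mul_of_nonneg_left h2 (norm_nonneg _)
    _ = _ := by ring

theorem norm_le_one_of_isometry {ι κ : Type*} [Fintype ι] [DecidableEq ι] [Fintype κ]
    [DecidableEq κ] {W : Matrix ι κ ℂ} (h : Wᴴ * W = 1) : ‖W‖ ≤ 1 := by
  have h1 := Matrix.l2_opNorm_conjTranspose_mul_self W
  have h2 : ‖(1 : Matrix κ κ ℂ)‖ ≤ 1 := by
    rw [← Matrix.diagonal_one, Matrix.l2_opNorm_diagonal]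
    exact (pi_norm_le_iff_of_nonneg zero_le_one).2 fun _ => by simp
  rw [h] at h1
  nlinarith [norm_nonneg W]

variable {n k : ℕ}

/-- The matrix whose columns are two given vectors. -/
def frame (ψ : Fin 2 → Vec n) : Matrix (Bits n) (Fin 2) ℂ := Matrix.of fun x i => ψ i x

theorem frame_codeword (u : Matrix (Fin 2) (Fin 2) ℂ) (ψ : Fin 2 → Vec n) :
    frame (codeword u ψ) = frame ψ * uᵀ := by
  ext x i
  simp [frame, codeword, Matrix.mul_apply, mul_comm]

theorem frame_conjTranspose_mul_self {ψ : Fin 2 → Vec n}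
    (h : ∀ i j, star (ψ i) ⬝ᵥ ψ j = if i = j then 1 else 0) : (frame ψ)ᴴ * frame ψ = 1 := by
  ext i j
  rw [Matrix.one_apply, ← h i j]
  simp [frame, Matrix.mul_apply, dotProduct]

theorem mul_frame {H : Op n} {ψ : Fin 2 → Vec n} {E : Fin 2 → ℂ}
    (h : ∀ i, H *ᵥ ψ i = E i • ψ i) : H * frame ψ = frame ψ * Matrix.diagonal E := by
  ext x i
  rw [Matrix.mul_diagonal]
  have := congrFun (h i) x
  simp only [Matrix.mulVec, dotProduct, Pi.smul_apply, smul_eq_mul] at this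
  simp [frame, Matrix.mul_apply, this, mul_comm]

/-- The variational principle, obtained from minimality that is only given for eigenvectors. It
supplies upper bounds on the low energies by trial vectors orthogonal to the other low eigenvector
alone. -/
theorem nonneg_of_orthogonal_of_isLowest {H : Op n} (hH : Hᴴ = H) {ψ : Fin 2 → Vec n}
    {E : Fin 2 → ℝ} (horth : ∀ i j, star (ψ i) ⬝ᵥ ψ j = if i = j then 1 else 0)
    (hE : ∀ i, H *ᵥ ψ i = (E i : ℂ) • ψ i)
    (hmin : ∀ (e : ℝ) (χ : Vec n), χ ≠ 0 → H *ᵥ χ = (e : ℂ) • χ →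
        (∀ i, star (ψ i) ⬝ᵥ χ = 0) → ∀ i, E i ≤ e)
    {i : Fin 2} {χ : Vec n} (hχ : ∀ j, j ≠ i → star (ψ j) ⬝ᵥ χ = 0) :
    0 ≤ star χ ⬝ᵥ (H *ᵥ χ - (E i : ℂ) • χ) := by
  -- This operator kills both low eigenvectors and equals H − E_i on their complement. An
  -- eigenvector of it is either orthogonal to both, hence an eigenvector of H of energy at least
  -- E_i, or overlaps one of them and has eigenvalue 0; so it is positive semidefinite. The rank-one
  -- term of index i has coefficient 0, which is why `χ` need not be orthogonal to `ψ i`.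
  set B : Op n := H + ∑ j, (((E i - E j : ℝ) : ℂ)) • Matrix.vecMulVec (ψ j) (star (ψ j))
    - (E i : ℂ) • 1 with hB
  have hBv : ∀ y, B *ᵥ y = H *ᵥ y +
      ∑ j, ((((E i - E j : ℝ) : ℂ)) * (star (ψ j) ⬝ᵥ y)) • ψ j - (E i : ℂ) • y := by
    intro y
    rw [hB, Matrix.sub_mulVec, Matrix.add_mulVec, Matrix.sum_mulVec]
    simp only [Matrix.smul_mulVec, Matrix.one_mulVec, Matrix.vecMulVec_mulVec,
      op_smul_eq_smul, smul_smul]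
  have hBh : Bᴴ = B := by
    rw [hB, Matrix.conjTranspose_sub, Matrix.conjTranspose_add, Matrix.conjTranspose_sum, hH]
    simp [Matrix.conjTranspose_smul, Matrix.conjTranspose_vecMulVec]
  have hBψ : ∀ j, B *ᵥ ψ j = 0 := by
    intro j
    rw [hBv, hE, Finset.sum_eq_single j]
    · rw [horth, if_pos rfl]
      push_cast
      module
    · intro j' _ hj'
      rw [horth, if_neg hj', mul_zero, zero_smul]
    · simp
  have hPSD : B.PosSemidef := by
    have hBH : B.IsHermitian := hBh
    refine hBH.posSemidef_iff_eigenvalues_nonneg.2 fun a => ?_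
    change 0 ≤ hBH.eigenvalues a
    set η : Vec n := (hBH.eigenvectorBasis a).ofLp with hη
    have h1 : B *ᵥ η = ((hBH.eigenvalues a : ℝ) : ℂ) • η := hBH.mulVec_eigenvectorBasis a
    have hη0 : η ≠ 0 := by
      intro h0
      have : hBH.eigenvectorBasis a = 0 := by
        ext x
        exact congrFun h0 x
      exact hBH.eigenvectorBasis.orthonormal.ne_zero a this
    by_cases hc : ∀ j, star (ψ j) ⬝ᵥ η = 0
    · have h2 : H *ᵥ η = ((E i + hBH.eigenvalues a : ℝ) : ℂ) • η := by
        rw [hBv] at h1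
        simp only [hc, mul_zero, zero_smul, Finset.sum_const_zero, add_zero] at h1
        rw [sub_eq_iff_eq_add.1 h1]
        push_cast
        module
      have := hmin _ η hη0 h2 hc i
      linarith
    · push Not at hc
      obtain ⟨j, hj⟩ := hc
      have h2 : star (ψ j) ⬝ᵥ (B *ᵥ η) = 0 := by
        rw [Matrix.dotProduct_mulVec, ← hBh, ← Matrix.star_mulVec, hBψ]
        simp
      rw [h1, dotProduct_smul, smul_eq_mul] at h2
      have h3 := (mul_eq_zero.1 h2).resolve_right hj
      exact le_of_eq (by exact_mod_cast h3.symm)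
  have h := hPSD.dotProduct_mulVec_nonneg χ
  rw [hBv, Finset.sum_eq_zero, add_zero] at h
  · exact h
  · intro j _
    by_cases hj : j = i
    · rw [hj]; simp
    · rw [hχ j hj, mul_zero, zero_smul]

/-! ### Energies of the perturbed codewords -/

namespace StabilizerCode

variable (C : StabilizerCode n)

/-- The code space has dimension 2, so a single linear condition leaves a nonzero vector. The
dimension is available as a trace: if no such vector existed, the projector would have rank at most
one. -/
theorem exists_code_vector_orthogonal (hn : 1 ≤ n) (ψ : Vec n) :
    ∃ χ : Vec n, χ ≠ 0 ∧ C.proj *ᵥ χ = χ ∧ star ψ ⬝ᵥ χ = 0 := by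
  by_contra! hcon
  have htr := C.trace_proj hn
  set g := C.proj *ᵥ ψ with hg
  have hψ : ∀ y, star ψ ⬝ᵥ (C.proj *ᵥ y) = star g ⬝ᵥ y := by
    intro y
    rw [hg, Matrix.star_mulVec, C.proj_isHermitian, Matrix.dotProduct_mulVec]
  have hgg : C.proj *ᵥ g = g := by rw [hg, Matrix.mulVec_mulVec, C.proj_mul_self]
  have h1 : (star g ⬝ᵥ g) • C.proj = Matrix.vecMulVec g (star g) := by
    refine Matrix.ext_of_mulVec_single fun x => ?_
    generalize (Pi.single x 1 : Vec n) = y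
    rw [Matrix.smul_mulVec, Matrix.vecMulVec_mulVec, op_smul_eq_smul]
    by_contra hne
    set χ := (star g ⬝ᵥ g) • C.proj *ᵥ y - (star g ⬝ᵥ y) • g with hχ
    have hPχ : C.proj *ᵥ χ = χ := by
      rw [hχ, Matrix.mulVec_sub, Matrix.mulVec_smul, Matrix.mulVec_smul, hgg, Matrix.mulVec_mulVec,
        C.proj_mul_self]
    refine hcon χ (sub_ne_zero.2 hne) hPχ ?_
    rw [← hPχ, hψ, hχ, dotProduct_sub, dotProduct_smul, dotProduct_smul]
    have : star g ⬝ᵥ C.proj *ᵥ y = star g ⬝ᵥ y := by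
      rw [Matrix.dotProduct_mulVec, ← C.proj_isHermitian, ← Matrix.star_mulVec, hgg]
    rw [this, smul_eq_mul, smul_eq_mul, mul_comm, sub_self]
  have h2 := congrArg Matrix.trace h1
  rw [Matrix.trace_smul, Matrix.trace_vecMulVec, htr, dotProduct_comm g, smul_eq_mul] at h2
  have h3 : star g ⬝ᵥ g = 0 := by linear_combination h2
  have hg0 : g = 0 := dotProduct_star_self_eq_zero.1 h3
  have h4 : C.proj = 0 := by
    refine Matrix.ext_of_mulVec_single fun x => ?_
    generalize (Pi.single x 1 : Vec n) = y
    rw [Matrix.zero_mulVec]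
    by_contra hne
    refine hcon _ hne (by rw [Matrix.mulVec_mulVec, C.proj_mul_self]) ?_
    rw [hψ, hg0]; simp
  rw [h4] at htr
  simp at htr

/-- The columns of `Ω` form an orthonormal basis of an invariant subspace of the perturbed
Hamiltonian on which its energy above the unperturbed ground state is at most `|l| ‖V‖`. -/
def IsLowFrame (V : Op n) (l : ℝ) (Ω : Matrix (Bits n) (Fin 2) ℂ) : Prop :=
  Ωᴴ * Ω = 1 ∧ ∃ T : Matrix (Fin 2) (Fin 2) ℂ, ‖T‖ ≤ |l| * ‖V‖ ∧
    (C.excitation + (l : ℂ) • V) * Ω = Ω * T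

/-- The lower energy bound comes from D ≥ 0, the upper one from a code vector orthogonal to the
other eigenvector, on which D vanishes. -/
theorem isLowFrame_of_isLowestPair (hn : 1 ≤ n) {V : Op n} (hV : Vᴴ = V) {l : ℝ}
    {ψ : Fin 2 → Vec n} (h : IsLowestPair (C.hamiltonian V l) ψ) :
    C.IsLowFrame V l (frame ψ) := by
  obtain ⟨horth, E, hE, hmin⟩ := h
  set N : ℝ := ((n - 1 : ℕ) : ℝ) with hN
  have hham : ∀ y, C.hamiltonian V l *ᵥ y =
      (C.excitation + (l : ℂ) • V) *ᵥ y - (N : ℂ) • y := by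
    intro y
    rw [C.hamiltonian_eq, Matrix.sub_mulVec, Matrix.smul_mulVec, Matrix.one_mulVec, hN]
    norm_cast
  have hl : star (l : ℂ) = l := Complex.conj_ofReal l
  have hHh : (C.hamiltonian V l)ᴴ = C.hamiltonian V l := by
    rw [C.hamiltonian_eq, Matrix.conjTranspose_sub, Matrix.conjTranspose_add,
      C.excitation_isHermitian, Matrix.conjTranspose_smul, Matrix.conjTranspose_smul, hV, hl]
    simp
  have hexc : ∀ i, (C.excitation + (l : ℂ) • V) *ᵥ ψ i = ((E i + N : ℝ) : ℂ) • ψ i := by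
    intro i
    have := hE i
    rw [hham, sub_eq_iff_eq_add] at this
    rw [this]; push_cast; module
  have hVb : ∀ y : Vec n, |l * (star y ⬝ᵥ (V *ᵥ y)).re| ≤ |l| * ‖V‖ * (star y ⬝ᵥ y).re := by
    intro y
    rw [abs_mul, mul_assoc]
    refine mul_le_mul_of_nonneg_left ?_ (abs_nonneg _)
    refine (Complex.abs_re_le_norm _).trans ((norm_dotProduct_mulVec_le V y).trans (le_of_eq ?_))
    have : 0 ≤ star y ⬝ᵥ y := dotProduct_star_self_nonneg y
    rw [← Complex.re_eq_norm.2 this]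
  have hup : ∀ i, E i + N ≤ |l| * ‖V‖ := by
    intro i
    -- In `Fin 2`, `i + 1` is the index other than `i`.
    obtain ⟨χ, hχ0, hχP, hχ⟩ := C.exists_code_vector_orthogonal hn (ψ (i + 1))
    have h1 := nonneg_of_orthogonal_of_isLowest hHh horth hE hmin (i := i) (χ := χ) (by
      intro j hj
      have : j = i + 1 := (by decide : ∀ i j : Fin 2, j ≠ i → j = i + 1) i j hj
      rw [this, hχ])
    have h2 : (C.excitation + (l : ℂ) • V) *ᵥ χ = (l : ℂ) • V *ᵥ χ := by
      rw [Matrix.add_mulVec, ← hχP, Matrix.mulVec_mulVec, C.excitation_mul_proj, hχP,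
        Matrix.zero_mulVec, zero_add, Matrix.smul_mulVec]
    rw [hham, h2, dotProduct_sub, dotProduct_sub, dotProduct_smul, dotProduct_smul,
      dotProduct_smul] at h1
    have h3 := (Complex.le_def.1 h1).1
    simp only [Complex.sub_re, smul_eq_mul, Complex.re_ofReal_mul, Complex.zero_re] at h3
    have h4 := (abs_le.1 (hVb χ)).2
    have h5 : 0 < (star χ ⬝ᵥ χ).re :=
      (Complex.lt_def.1 (Matrix.dotProduct_star_self_pos_iff.2 hχ0)).1
    by_contra! hlt
    nlinarith
  have hlow : ∀ i, -(|l| * ‖V‖) ≤ E i + N := by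
    intro i
    have h1 := C.excitation_posSemidef.dotProduct_mulVec_nonneg (ψ i)
    have h2 : star (ψ i) ⬝ᵥ ((C.excitation + (l : ℂ) • V) *ᵥ ψ i) = ((E i + N : ℝ) : ℂ) := by
      rw [hexc, dotProduct_smul, horth]; simp
    rw [Matrix.add_mulVec, dotProduct_add, Matrix.smul_mulVec, dotProduct_smul, smul_eq_mul] at h2
    have h3 := congrArg Complex.re h2
    rw [Complex.add_re, Complex.re_ofReal_mul, Complex.ofReal_re] at h3
    have h4 := (Complex.le_def.1 h1).1
    have h5 := (abs_le.1 (hVb (ψ i))).1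
    rw [horth] at h5
    simp only [if_true, Complex.one_re, mul_one] at h5
    simp only [Complex.zero_re] at h4
    linarith
  refine ⟨frame_conjTranspose_mul_self horth, Matrix.diagonal fun i => ((E i + N : ℝ) : ℂ), ?_,
    mul_frame hexc⟩
  rw [Matrix.l2_opNorm_diagonal]
  refine (pi_norm_le_iff_of_nonneg (by positivity)).2 fun i => ?_
  rw [Complex.norm_real, Real.norm_eq_abs]
  exact abs_le.2 ⟨hlow i, hup i⟩

/-- Low frames do not single out eigenvectors, so all later estimates are uniform in the choice of
codewords. -/
theorem IsLowFrame.mul_unitary {V : Op n} {l : ℝ} {Ω : Matrix (Bits n) (Fin 2) ℂ}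
    (h : C.IsLowFrame V l Ω) {w : Matrix (Fin 2) (Fin 2) ℂ} (hw : wᴴ * w = 1) :
    C.IsLowFrame V l (Ω * w) := by
  obtain ⟨h1, T, hT, h2⟩ := h
  have hw' : w * wᴴ = 1 := mul_eq_one_comm.1 hw
  have hn1 : ‖w‖ ≤ 1 := norm_le_one_of_isometry hw
  have hn2 : ‖wᴴ‖ ≤ 1 := by rw [Matrix.l2_opNorm_conjTranspose]; exact hn1
  refine ⟨?_, wᴴ * T * w, ?_, ?_⟩
  · rw [Matrix.conjTranspose_mul, Matrix.mul_assoc, ← Matrix.mul_assoc Ωᴴ, h1, Matrix.one_mul, hw]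
  · refine le_trans ?_ hT
    calc ‖wᴴ * T * w‖ ≤ ‖wᴴ‖ * ‖T‖ * ‖w‖ :=
          (norm_mul_le _ _).trans (mul_le_mul_of_nonneg_right (norm_mul_le _ _) (norm_nonneg _))
      _ ≤ 1 * ‖T‖ * 1 := by gcongr
      _ = ‖T‖ := by ring
  · rw [← Matrix.mul_assoc, h2]
    simp only [Matrix.mul_assoc]
    rw [← Matrix.mul_assoc w, hw', Matrix.one_mul]

theorem isLowFrame_codeword (hn : 1 ≤ n) {V : Op n} (hV : Vᴴ = V) {l : ℝ}
    {ψ : Fin 2 → Vec n} (h : IsLowestPair (C.hamiltonian V l) ψ)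
    {u : Matrix (Fin 2) (Fin 2) ℂ} (hu : u ∈ Matrix.unitaryGroup (Fin 2) ℂ) :
    C.IsLowFrame V l (frame (codeword u ψ)) := by
  rw [frame_codeword]
  refine (C.isLowFrame_of_isLowestPair hn hV h).mul_unitary C ?_
  have h1 : u * uᴴ = 1 := Matrix.mem_unitaryGroup_iff.1 hu
  have h2 := congrArg Matrix.transpose h1
  rw [Matrix.transpose_mul, Matrix.transpose_one] at h2
  exact h2

end StabilizerCode

end PerturbedCode

namespace PerturbedCode

open scoped ComplexOrder Matrix.Norms.L2Operator

variable {n k : ℕ}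

namespace StabilizerCode

variable (C : StabilizerCode n)

/-! ### Low-energy frames are close to the dressed code space -/

theorem norm_proj_le_one : ‖C.proj‖ ≤ 1 := by
  have h := Matrix.l2_opNorm_conjTranspose_mul_self C.proj
  rw [C.proj_isHermitian, C.proj_mul_self] at h
  by_contra! hlt
  nlinarith

variable {C} in
theorem IsLowFrame.norm_le_one {V : Op n} {l : ℝ} {Ω : Matrix (Bits n) (Fin 2) ℂ}
    (h : C.IsLowFrame V l Ω) : ‖Ω‖ ≤ 1 := norm_le_one_of_isometry h.1

/-- Apply the pseudoinverse of D to DΩ = ΩT − λVΩ. Orthonormality of the columns is not required, so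
that the bound also applies to the image of a frame under a symmetry. -/
theorem norm_excited_part_le {G : Op n} (hG : G * C.excitation = 1 - C.proj) {V : Op n} {l : ℝ}
    {Ω : Matrix (Bits n) (Fin 2) ℂ} {T : Matrix (Fin 2) (Fin 2) ℂ} (hT : ‖T‖ ≤ |l| * ‖V‖)
    (hΩ : (C.excitation + (l : ℂ) • V) * Ω = Ω * T) :
    ‖(1 - C.proj) * Ω‖ ≤ ‖G‖ * (2 * ‖V‖) * |l| * ‖Ω‖ := by
  have h1 : (1 - C.proj) * Ω = G * (Ω * T - (l : ℂ) • (V * Ω)) := by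
    rw [← hG, Matrix.mul_assoc, ← hΩ, Matrix.add_mul, Matrix.smul_mul, add_sub_cancel_right]
  rw [h1]
  refine (Matrix.l2_opNorm_mul _ _).trans ?_
  have h2 : ‖Ω * T - (l : ℂ) • (V * Ω)‖ ≤ ‖Ω‖ * (|l| * ‖V‖) + |l| * (‖V‖ * ‖Ω‖) := by
    refine (norm_sub_le _ _).trans (add_le_add ?_ ?_)
    · exact (Matrix.l2_opNorm_mul _ _).trans (mul_le_mul_of_nonneg_left hT (norm_nonneg _))
    · rw [norm_smul, Complex.norm_real, Real.norm_eq_abs]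
      exact mul_le_mul_of_nonneg_left (Matrix.l2_opNorm_mul _ _) (abs_nonneg _)
  calc _ ≤ ‖G‖ * (‖Ω‖ * (|l| * ‖V‖) + |l| * (‖V‖ * ‖Ω‖)) :=
        mul_le_mul_of_nonneg_left h2 (norm_nonneg _)
    _ = _ := by ring

theorem exists_norm_excited_part_le (V : Op n) :
    ∃ K, 0 ≤ K ∧ ∀ (l : ℝ) (Ω : Matrix (Bits n) (Fin 2) ℂ), C.IsLowFrame V l Ω →
      ‖(1 - C.proj) * Ω‖ ≤ K * |l| := by
  obtain ⟨G, hG⟩ := C.exists_pseudoinverse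
  refine ⟨‖G‖ * (2 * ‖V‖), by positivity, fun l Ω h => ?_⟩
  obtain ⟨h1, T, hT, h2⟩ := id h
  refine (C.norm_excited_part_le hG hT h2).trans ?_
  exact mul_le_of_le_one_right (by positivity) h.norm_le_one

/-- A symmetry of the perturbed Hamiltonian that is a scalar on the code space is the same scalar on
the low-energy space. -/
theorem exists_symmetry_mul_eq_smul (V : Op n) :
    ∃ l₀, 0 < l₀ ∧ ∀ l : ℝ, |l| < l₀ → ∀ Ω : Matrix (Bits n) (Fin 2) ℂ, C.IsLowFrame V l Ω →
      ∀ (M : Op n) (x : ℂ), C.proj * M = x • C.proj → Commute M C.excitation → Commute M V →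
        M * Ω = x • Ω := by
  obtain ⟨G, hG⟩ := C.exists_pseudoinverse
  refine ⟨1 / (1 + ‖G‖ * (2 * ‖V‖)), by positivity, fun l hl Ω hΩ M x hM hMD hMV => ?_⟩
  obtain ⟨-, T, hT, h2⟩ := hΩ
  have hMH : (M - x • 1) * (C.excitation + (l : ℂ) • V) =
      (C.excitation + (l : ℂ) • V) * (M - x • 1) := by
    have : Commute (M - x • 1) (C.excitation + (l : ℂ) • V) :=
      (Commute.add_right hMD (hMV.smul_right _)).sub_left ((Commute.one_left _).smul_left x)
    exact this
  -- (M − x)Ω obeys the same eigenvalue relation as Ω but has no code-space component. It is thus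
  -- its own excited part, whose norm is at most a small multiple of itself, and so it vanishes.
  have h3 : (C.excitation + (l : ℂ) • V) * ((M - x • 1) * Ω) = ((M - x • 1) * Ω) * T := by
    rw [← Matrix.mul_assoc, ← hMH, Matrix.mul_assoc, h2, Matrix.mul_assoc]
  have h4 := C.norm_excited_part_le hG hT h3
  have h5 : C.proj * ((M - x • 1) * Ω) = 0 := by
    rw [← Matrix.mul_assoc, mul_sub, hM, mul_smul_comm, mul_one, sub_self, Matrix.zero_mul]
  rw [Matrix.sub_mul, h5, Matrix.one_mul, sub_zero] at h4
  have h6 : (M - x • 1) * Ω = 0 := by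
    rw [← norm_le_zero_iff]
    by_contra! hpos
    rw [lt_div_iff₀ (by positivity)] at hl
    have h7 : 0 ≤ ‖G‖ * (2 * ‖V‖) := by positivity
    have h8 : ‖G‖ * (2 * ‖V‖) * |l| < 1 := by nlinarith [abs_nonneg l]
    nlinarith
  rw [Matrix.sub_mul, sub_eq_zero, Matrix.smul_mul, Matrix.one_mul] at h6
  exact h6

variable {C} in
theorem IsLowFrame.norm_one_sub_le {V : Op n} {l : ℝ} {Ω : Matrix (Bits n) (Fin 2) ℂ}
    (h : C.IsLowFrame V l Ω) : ‖1 - Ωᴴ * C.proj * Ω‖ ≤ ‖(1 - C.proj) * Ω‖ := by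
  have h1 : 1 - Ωᴴ * C.proj * Ω = Ωᴴ * ((1 - C.proj) * Ω) := by
    rw [Matrix.sub_mul, Matrix.mul_sub, Matrix.one_mul, h.1, Matrix.mul_assoc]
  rw [h1]
  refine (Matrix.l2_opNorm_mul _ _).trans ?_
  rw [Matrix.l2_opNorm_conjTranspose]
  exact mul_le_of_le_one_left (norm_nonneg _) h.norm_le_one

/-- Bootstrap: the defect Φ = Ω − A(PΩ) has no code component, so the gap controls it by DΦ.
Subtracting the approximate Bloch equation from the exact one expresses DΦ by small multiples of Φ,
the residual R, and the difference Δ between the exact and the scalar effective energies. -/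
theorem exists_norm_sub_dressed_le {d : ℕ} (hd : C.HasDistance d) {V : Op n}
    (hV : V ∈ localOps n k) (j : ℕ) (hj : j * k < d) :
    ∃ A ∈ graded n k 0, ∃ K l₀, 0 ≤ K ∧ 0 < l₀ ∧ l₀ ≤ 1 ∧ ∀ l : ℝ, |l| < l₀ →
      ∀ Ω : Matrix (Bits n) (Fin 2) ℂ, C.IsLowFrame V l Ω →
        ‖Ω - A l * (C.proj * Ω)‖ ≤ K * |l| ^ (j + 1) := by
  obtain ⟨B, hB, p, X, hX, h⟩ := C.exists_bloch hd hV j hj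
  obtain ⟨Kx, hKx, hXb⟩ := exists_bound_of_mem_graded hX
  obtain ⟨Kp, hKp, hpb⟩ := exists_bound_eval p
  obtain ⟨G, hG⟩ := C.exists_pseudoinverse
  have hA : (fun l : ℝ => 1 + (l : ℂ) • B l) ∈ graded n k 0 :=
    Submodule.add_mem _ (const_mem_graded (one_mem_localOps 0))
      (smul_mem_graded (by rw [zero_add]; exact hB))
  obtain ⟨g, hg⟩ : ∃ g, g = ‖G‖ := ⟨_, rfl⟩
  obtain ⟨v, hv⟩ : ∃ v, v = ‖V‖ := ⟨_, rfl⟩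
  have hg0 : 0 ≤ g := hg ▸ norm_nonneg _
  have hv0 : 0 ≤ v := hv ▸ norm_nonneg _
  -- With |λ| < 1/(2S), both the coefficient of ‖Φ‖ in the final estimate and the excited part of Ω
  -- are at most 1/2.
  obtain ⟨S, hS⟩ : ∃ S, S = 1 + g * (3 * v + Kp) + g * (2 * v) := ⟨_, rfl⟩
  have hS1 : 1 ≤ S := by
    have : 0 ≤ g * (3 * v + Kp) + g * (2 * v) := by positivity
    linarith
  refine ⟨_, hA, 6 * g * Kx, 1 / (2 * S), by positivity, by positivity, ?_, fun l hl Ω hΩ => ?_⟩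
  · rw [div_le_one (by positivity)]; linarith
  obtain ⟨horth, T, hT, hΩT⟩ := id hΩ
  obtain ⟨hBP, hbl⟩ := h l
  obtain ⟨a, ha⟩ : ∃ a, a = |l| := ⟨_, rfl⟩
  rw [← ha] at hl ⊢
  have ha0 : 0 ≤ a := ha ▸ abs_nonneg _
  have haS : a * S < 1 / 2 := by
    rw [lt_div_iff₀ (by positivity)] at hl
    linarith
  have ha1 : a ≤ 1 := by nlinarith
  have haS1 : a * (g * (3 * v + Kp)) ≤ 1 / 2 := by
    have : g * (3 * v + Kp) ≤ S := by
      have : 0 ≤ g * (2 * v) := by positivity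
      linarith
    nlinarith
  have haS2 : a * (g * (2 * v)) ≤ 1 / 2 := by
    have : g * (2 * v) ≤ S := by
      have : 0 ≤ g * (3 * v + Kp) := by positivity
      linarith
    nlinarith
  set A : Op n := 1 + (l : ℂ) • B l with hAdef
  set ε : ℂ := (l : ℂ) * p.eval (l : ℂ) with hε
  have hεn : ‖ε‖ ≤ a * Kp := by
    rw [hε, norm_mul, Complex.norm_real, Real.norm_eq_abs, ← ha]
    exact mul_le_mul_of_nonneg_left (hpb l (ha ▸ ha1)) ha0
  set Φ := Ω - A * (C.proj * Ω) with hΦ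
  set R := (l : ℂ) ^ (j + 1) • (X l * (C.proj * Ω)) with hR
  have hPΩ : ‖C.proj * Ω‖ ≤ 1 := by
    refine (Matrix.l2_opNorm_mul _ _).trans ?_
    exact mul_le_one₀ C.norm_proj_le_one (norm_nonneg _) hΩ.norm_le_one
  have hRn : ‖R‖ ≤ Kx * a ^ (j + 1) := by
    rw [hR, norm_smul, norm_pow, Complex.norm_real, Real.norm_eq_abs, mul_comm, ← ha]
    refine mul_le_mul_of_nonneg_right ?_ (by positivity)
    refine (Matrix.l2_opNorm_mul _ _).trans ?_
    calc _ ≤ Kx * 1 := mul_le_mul (hXb l (ha ▸ ha1)) hPΩ (norm_nonneg _) hKx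
      _ = Kx := mul_one _
  have hPA : C.proj * A * C.proj = C.proj := by
    rw [hAdef, mul_add, add_mul, mul_one, C.proj_mul_self, mul_smul_comm, smul_mul_assoc, hBP,
      smul_zero, add_zero]
  have hPΦ : C.proj * Φ = 0 := by
    rw [hΦ, Matrix.mul_sub, ← Matrix.mul_assoc, ← Matrix.mul_assoc, hPA, sub_self]
  set Δ := T - ε • (1 : Matrix (Fin 2) (Fin 2) ℂ) with hΔ
  have hblΩ : (C.excitation + (l : ℂ) • V - ε • 1) * (A * (C.proj * Ω)) = R := by
    rw [← Matrix.mul_assoc, ← Matrix.mul_assoc, hbl, hR, Matrix.smul_mul, Matrix.mul_assoc]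
  have hDΦ : C.excitation * Φ = Ω * Δ - (l : ℂ) • (V * Φ) + ε • Φ - R := by
    rw [← hblΩ, hΔ, Matrix.mul_sub Ω, ← hΩT, hΦ]
    simp only [Matrix.add_mul, Matrix.sub_mul, Matrix.mul_sub, Matrix.smul_mul, Matrix.mul_smul,
      Matrix.one_mul, Matrix.mul_one]
    module
  -- Projecting the equation for DΦ to the code space removes D and the terms containing PΦ. Since
  -- Ω†PΩ is within 1/2 of the identity, this bounds Δ by λVΦ and R.
  have hΔn : ‖Δ‖ ≤ 2 * (a * v * ‖Φ‖ + ‖R‖) := by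
    have h1 : Ωᴴ * C.proj * Ω * Δ = Ωᴴ * (C.proj * ((l : ℂ) • (V * Φ) + R)) := by
      have h2 : C.proj * (C.excitation * Φ) = 0 := by
        rw [← Matrix.mul_assoc, C.proj_mul_excitation, Matrix.zero_mul]
      rw [hDΦ, Matrix.mul_sub, Matrix.mul_add, Matrix.mul_sub, Matrix.mul_smul, Matrix.mul_smul,
        hPΦ, smul_zero, add_zero, sub_sub, sub_eq_zero] at h2
      rw [Matrix.mul_add, Matrix.mul_smul, ← h2]
      simp only [Matrix.mul_assoc]
    have h3 : ‖Ωᴴ * C.proj * Ω * Δ‖ ≤ a * v * ‖Φ‖ + ‖R‖ := by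
      rw [h1]
      have h4 : ‖(l : ℂ) • (V * Φ) + R‖ ≤ a * v * ‖Φ‖ + ‖R‖ := by
        refine (norm_add_le _ _).trans (add_le_add ?_ le_rfl)
        rw [norm_smul, Complex.norm_real, Real.norm_eq_abs, mul_assoc, hv, ← ha]
        exact mul_le_mul_of_nonneg_left (Matrix.l2_opNorm_mul _ _) ha0
      refine (Matrix.l2_opNorm_mul _ _).trans ?_
      rw [Matrix.l2_opNorm_conjTranspose]
      refine (mul_le_of_le_one_left (norm_nonneg _) hΩ.norm_le_one).trans ?_
      refine (Matrix.l2_opNorm_mul _ _).trans ?_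
      exact (mul_le_of_le_one_left (norm_nonneg _) C.norm_proj_le_one).trans h4
    have h5 : Δ = Ωᴴ * C.proj * Ω * Δ + (1 - Ωᴴ * C.proj * Ω) * Δ := by
      rw [Matrix.sub_mul, Matrix.one_mul]; abel
    have h6 : ‖(1 - Ωᴴ * C.proj * Ω) * Δ‖ ≤ 1 / 2 * ‖Δ‖ := by
      refine (Matrix.l2_opNorm_mul _ _).trans (mul_le_mul_of_nonneg_right ?_ (norm_nonneg _))
      refine hΩ.norm_one_sub_le.trans ((C.norm_excited_part_le hG hT hΩT).trans ?_)
      refine (mul_le_of_le_one_right (by positivity) hΩ.norm_le_one).trans ?_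
      rw [← hg, ← hv, ← ha]
      linarith
    have h7 : ‖Δ‖ ≤ ‖Ωᴴ * C.proj * Ω * Δ‖ + ‖(1 - Ωᴴ * C.proj * Ω) * Δ‖ := by
      conv_lhs => rw [h5]
      exact norm_add_le _ _
    linarith
  have hΦ' : Φ = G * (C.excitation * Φ) := by
    rw [← Matrix.mul_assoc, hG, Matrix.sub_mul, Matrix.one_mul, hPΦ, sub_zero]
  have hDΦn : ‖C.excitation * Φ‖ ≤ ‖Δ‖ + a * v * ‖Φ‖ + a * Kp * ‖Φ‖ + ‖R‖ := by
    rw [hDΦ]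
    refine (norm_sub_le _ _).trans (add_le_add ((norm_add_le _ _).trans (add_le_add
      ((norm_sub_le _ _).trans (add_le_add ?_ ?_)) ?_)) le_rfl)
    · refine (Matrix.l2_opNorm_mul _ _).trans ?_
      exact mul_le_of_le_one_left (norm_nonneg _) hΩ.norm_le_one
    · rw [norm_smul, Complex.norm_real, Real.norm_eq_abs, mul_assoc, hv, ← ha]
      exact mul_le_mul_of_nonneg_left (Matrix.l2_opNorm_mul _ _) ha0
    · rw [norm_smul]
      exact mul_le_mul_of_nonneg_right hεn (norm_nonneg _)
  have hΦn : ‖Φ‖ ≤ g * ‖C.excitation * Φ‖ := by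
    conv_lhs => rw [hΦ']
    rw [hg]
    exact Matrix.l2_opNorm_mul _ _
  -- One copy of ‖R‖ and of |λ|‖V‖‖Φ‖ is direct and two come from Δ. Absorbing half of ‖Φ‖ gives ‖Φ‖
  -- ≤ 6g‖R‖.
  have h8 : ‖Φ‖ ≤ g * (3 * (a * v * ‖Φ‖) + a * Kp * ‖Φ‖ + 3 * ‖R‖) :=
    hΦn.trans (mul_le_mul_of_nonneg_left (by linarith) hg0)
  have h9 : g * (3 * (a * v * ‖Φ‖) + a * Kp * ‖Φ‖) ≤ 1 / 2 * ‖Φ‖ := by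
    have := mul_le_mul_of_nonneg_right haS1 (norm_nonneg Φ)
    linarith
  have h10 : g * ‖R‖ ≤ g * (Kx * a ^ (j + 1)) := mul_le_mul_of_nonneg_left hRn hg0
  linarith

/-- Approximate Knill–Laflamme condition for the perturbed code. -/
theorem exists_lowFrame_knill_laflamme {d w m : ℕ} (hd : C.HasDistance d) {V : Op n}
    (hV : V ∈ localOps n k) {X : Op n} (hX : X ∈ localOps n w) (hm : w + m * k < d) :
    ∃ K l₀, 0 ≤ K ∧ 0 < l₀ ∧ ∀ l : ℝ, |l| < l₀ → ∀ Ω : Matrix (Bits n) (Fin 2) ℂ,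
      C.IsLowFrame V l Ω → ∃ c : ℂ, ‖Ωᴴ * X * Ω - c • 1‖ ≤ K * |l| ^ (m + 1) := by
  obtain ⟨A, hA, KA, l₁, hKA, hl₁, hl₁', h⟩ :=
    C.exists_norm_sub_dressed_le hd hV m (by omega)
  obtain ⟨KP, hKP, hP⟩ := C.exists_norm_excited_part_le V
  obtain ⟨L, hL, hAb⟩ := exists_bound_of_mem_graded hA
  -- The dressed condition yields a scalar times Ω†PΩ, and Ω†PΩ is not yet known to be nearly scalar
  -- to the required order.
  have key : ∀ (Y : Op n) (v : ℕ), Y ∈ localOps n v → v + m * k < d →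
      ∃ (g : ℝ → ℂ) (K : ℝ), 0 ≤ K ∧ ∀ l : ℝ, |l| < l₁ → ∀ Ω : Matrix (Bits n) (Fin 2) ℂ,
        C.IsLowFrame V l Ω → ‖Ωᴴ * Y * Ω - g l • (Ωᴴ * C.proj * Ω)‖ ≤ K * |l| ^ (m + 1) := by
    intro Y v hY hv
    obtain ⟨g, K, hK, hg⟩ := C.exists_dressed_knill_laflamme hd hY hv hA hA
    refine ⟨g, KA * ‖Y‖ + L * ‖Y‖ * KA + K, by positivity, fun l hl Ω hΩ => ?_⟩
    have hl1 : |l| ≤ 1 := (hl.trans_le hl₁').le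
    set Z := A l * (C.proj * Ω) with hZ
    have h1 : Ωᴴ * Y * Ω - g l • (Ωᴴ * C.proj * Ω) = (Ω - Z)ᴴ * (Y * Ω) + Zᴴ * (Y * (Ω - Z)) +
        Ωᴴ * ((C.proj * ((A l)ᴴ * Y * A l) * C.proj - g l • C.proj) * Ω) := by
      have h2 : Ωᴴ * ((C.proj * ((A l)ᴴ * Y * A l) * C.proj) * Ω) = Zᴴ * (Y * Z) := by
        rw [hZ, Matrix.conjTranspose_mul, Matrix.conjTranspose_mul, C.proj_isHermitian]
        simp only [Matrix.mul_assoc]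
      rw [Matrix.sub_mul, Matrix.mul_sub Ωᴴ, h2]
      simp only [Matrix.conjTranspose_sub, Matrix.sub_mul, Matrix.mul_sub, Matrix.smul_mul,
        Matrix.mul_smul, Matrix.mul_assoc]
      abel
    have hΩ1 := hΩ.norm_le_one
    have hΩ1' : ‖Ωᴴ‖ ≤ 1 := by rw [Matrix.l2_opNorm_conjTranspose]; exact hΩ1
    have hZn : ‖Zᴴ‖ ≤ L := by
      rw [Matrix.l2_opNorm_conjTranspose]
      refine (Matrix.l2_opNorm_mul _ _).trans ?_
      calc _ ≤ L * 1 := mul_le_mul (hAb l hl1) ((Matrix.l2_opNorm_mul _ _).trans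
            (mul_le_one₀ C.norm_proj_le_one (norm_nonneg _) hΩ1)) (norm_nonneg _) hL
        _ = L := mul_one L
    have hΦ := h l hl Ω hΩ
    have b1 : ‖(Ω - Z)ᴴ * (Y * Ω)‖ ≤ KA * |l| ^ (m + 1) * ‖Y‖ := by
      refine (Matrix.l2_opNorm_mul _ _).trans ?_
      rw [Matrix.l2_opNorm_conjTranspose]
      refine mul_le_mul hΦ ?_ (norm_nonneg _) (by positivity)
      exact (Matrix.l2_opNorm_mul _ _).trans (mul_le_of_le_one_right (norm_nonneg _) hΩ1)
    have b2 : ‖Zᴴ * (Y * (Ω - Z))‖ ≤ L * (‖Y‖ * (KA * |l| ^ (m + 1))) := by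
      refine (Matrix.l2_opNorm_mul _ _).trans (mul_le_mul hZn ?_ (norm_nonneg _) hL)
      exact (Matrix.l2_opNorm_mul _ _).trans (mul_le_mul_of_nonneg_left hΦ (norm_nonneg _))
    have b3 : ‖Ωᴴ * ((C.proj * ((A l)ᴴ * Y * A l) * C.proj - g l • C.proj) * Ω)‖ ≤
        K * |l| ^ (m + 1) := by
      refine (Matrix.l2_opNorm_mul _ _).trans
        ((mul_le_of_le_one_left (norm_nonneg _) hΩ1').trans ?_)
      refine (Matrix.l2_opNorm_mul _ _).trans
        ((mul_le_of_le_one_right (norm_nonneg _) hΩ1).trans (hg l hl1))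
    rw [h1]
    have := norm_add₃_le (a := (Ω - Z)ᴴ * (Y * Ω)) (b := Zᴴ * (Y * (Ω - Z)))
      (c := Ωᴴ * ((C.proj * ((A l)ᴴ * Y * A l) * C.proj - g l • C.proj) * Ω))
    linarith
  obtain ⟨g, K, hK, hg⟩ := key X w hX hm
  -- The case of the identity operator reads 1 ≈ g₁ Ω†PΩ, so Ω†PΩ can be eliminated and the scalar
  -- for `X` is g / g₁.
  obtain ⟨g₁, K₁, hK₁, hg₁⟩ := key 1 0 (one_mem_localOps 0) (by omega)
  refine ⟨K + 4 * (‖X‖ + K) * K₁, min l₁ (1 / (2 * (1 + KP + K₁))), by positivity, by positivity,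
    fun l hl Ω hΩ => ?_⟩
  have hl1 : |l| < l₁ := hl.trans_le (min_le_left _ _)
  have hl1' : |l| ≤ 1 := (hl1.trans_le hl₁').le
  have hl2 := hl.trans_le (min_le_right _ _)
  rw [lt_div_iff₀ (by positivity)] at hl2
  have ha0 := abs_nonneg l
  set a := |l| with ha
  have hpa : a ^ (m + 1) ≤ a := pow_le_of_le_one ha0 hl1' (by omega)
  have hpa0 : 0 ≤ a ^ (m + 1) := by positivity
  have hKPa : KP * a ≤ 1 / 2 := by nlinarith
  have hK₁a : K₁ * a ^ (m + 1) ≤ 1 / 2 := by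
    have : K₁ * a ^ (m + 1) ≤ K₁ * a := mul_le_mul_of_nonneg_left hpa hK₁
    nlinarith
  set q := Ωᴴ * C.proj * Ω with hq
  have hq1 : ‖1 - q‖ ≤ 1 / 2 := hΩ.norm_one_sub_le.trans ((hP l Ω hΩ).trans hKPa)
  have hone : ‖(1 : Matrix (Fin 2) (Fin 2) ℂ)‖ = 1 := norm_one
  have hqlow : 1 / 2 ≤ ‖q‖ := by
    have := norm_sub_norm_le (1 : Matrix (Fin 2) (Fin 2) ℂ) q
    linarith
  have hΩ1 := hΩ.norm_le_one
  have hΩ1' : ‖Ωᴴ‖ ≤ 1 := by rw [Matrix.l2_opNorm_conjTranspose]; exact hΩ1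
  have hsand : ∀ Y : Op n, ‖Ωᴴ * Y * Ω‖ ≤ ‖Y‖ := fun Y =>
    (Matrix.l2_opNorm_mul _ _).trans ((mul_le_of_le_one_right (norm_nonneg _) hΩ1).trans
      ((Matrix.l2_opNorm_mul _ _).trans (mul_le_of_le_one_left (norm_nonneg _) hΩ1')))
  have hqup : ‖q‖ ≤ 1 := (hsand _).trans C.norm_proj_le_one
  have e1 := hg l hl1 Ω hΩ
  have e2 := hg₁ l hl1 Ω hΩ
  rw [Matrix.mul_one, hΩ.1] at e2
  have hg₁low : 1 / 2 ≤ ‖g₁ l‖ := by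
    have h1 := norm_sub_norm_le (1 : Matrix (Fin 2) (Fin 2) ℂ) (g₁ l • q)
    rw [norm_smul, hone] at h1
    nlinarith [norm_nonneg (g₁ l)]
  have hgup : ‖g l‖ ≤ 2 * (‖X‖ + K) := by
    have h1 := norm_sub_norm_le (g l • q) (Ωᴴ * X * Ω)
    rw [norm_smul, norm_sub_rev] at h1
    have h2 := hsand X
    have h3 : K * a ^ (m + 1) ≤ K := mul_le_of_le_one_right hK (hpa.trans hl1')
    nlinarith [norm_nonneg (g l)]
  have hg₁0 : g₁ l ≠ 0 := by
    intro h0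
    rw [h0, norm_zero] at hg₁low
    linarith
  refine ⟨g l / g₁ l, ?_⟩
  have e3 : Ωᴴ * X * Ω - (g l / g₁ l) • 1 =
      (Ωᴴ * X * Ω - g l • q) - (g l / g₁ l) • (1 - g₁ l • q) := by
    rw [smul_sub, smul_smul, div_mul_cancel₀ _ hg₁0]
    abel
  rw [e3]
  have e4 : ‖g l / g₁ l‖ ≤ 4 * (‖X‖ + K) := by
    rw [norm_div, div_le_iff₀ (by linarith)]
    have : 0 ≤ ‖X‖ + K := by positivity
    nlinarith
  have e5 : ‖(g l / g₁ l) • (1 - g₁ l • q)‖ ≤ 4 * (‖X‖ + K) * (K₁ * a ^ (m + 1)) := by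
    rw [norm_smul]
    exact mul_le_mul e4 e2 (norm_nonneg _) (by positivity)
  have e6 := norm_sub_le (Ωᴴ * X * Ω - g l • q) ((g l / g₁ l) • (1 - g₁ l • q))
  linarith

end StabilizerCode

end PerturbedCode

namespace PerturbedCode

open scoped ComplexOrder Matrix.Norms.L2Operator Kronecker

variable {n : ℕ}

/-! ### Square roots near the identity -/

section Sqrt

variable {κ : Type*} [Fintype κ] [DecidableEq κ]

theorem norm_one_matrix_le : ‖(1 : Matrix κ κ ℂ)‖ ≤ 1 :=
  norm_le_one_of_isometry (by simp)

/-- Functional calculus with √(1+x). The second-order estimate rests on √(1+x) − 1 − x/2 = −(√(1+x)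
− 1)²/2. -/
theorem exists_sqrt_one_add {X : Matrix κ κ ℂ} (hX : Xᴴ = X) (hX1 : ‖X‖ ≤ 1 / 2) :
    ∃ Y : Matrix κ κ ℂ, Yᴴ = Y ∧ Y * Y = 1 + X ∧ ‖Y - 1‖ ≤ ‖X‖ ∧
      ‖Y - (1 + (1 / 2 : ℂ) • X)‖ ≤ ‖X‖ ^ 2 ∧ ∀ S, Commute X S → Commute Y S := by
  have hsa : IsSelfAdjoint X := hX
  have hspec : ∀ x ∈ spectrum ℝ X, |x| ≤ ‖X‖ := by
    intro x hx
    have h1 := spectrum.norm_le_norm_mul_of_mem hx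
    rw [Real.norm_eq_abs] at h1
    exact h1.trans (mul_le_of_le_one_right (norm_nonneg _) norm_one_matrix_le)
  have hs : ∀ x ∈ spectrum ℝ X, 0 ≤ 1 + x := fun x hx => by
    have := (abs_le.1 (hspec x hx)).1
    linarith
  have h1 : ∀ x : ℝ, 0 ≤ 1 + x → |√(1 + x) - 1| ≤ |x| := by
    intro x hx
    have h2 := Real.sq_sqrt hx
    have h3 := Real.sqrt_nonneg (1 + x)
    have h4 : x = (√(1 + x) - 1) * (√(1 + x) + 1) := by linarith
    conv_rhs => rw [h4, abs_mul]
    refine le_mul_of_one_le_right (abs_nonneg _) ?_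
    rw [abs_of_nonneg (by linarith)]
    linarith
  have hY2 : cfc (fun x : ℝ => √(1 + x)) X * cfc (fun x : ℝ => √(1 + x)) X = 1 + X := by
    rw [← cfc_mul (fun x : ℝ => √(1 + x)) (fun x : ℝ => √(1 + x)) X]
    have : cfc (fun x : ℝ => √(1 + x) * √(1 + x)) X = cfc (fun x : ℝ => 1 + x) X :=
      cfc_congr fun x hx => Real.mul_self_sqrt (hs x hx)
    rw [this, cfc_const_add (1 : ℝ) (fun x => x) X, cfc_id' ℝ X]
    simp
  refine ⟨cfc (fun x : ℝ => √(1 + x)) X, cfc_predicate (fun x : ℝ => √(1 + x)) X, hY2, ?_, ?_,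
    fun S hS => hS.cfc_real _⟩
  · have h2 : cfc (fun x : ℝ => √(1 + x)) X - 1 = cfc (fun x : ℝ => √(1 + x) - 1) X := by
      rw [cfc_sub (fun x : ℝ => √(1 + x)) (fun _ => (1 : ℝ)) X, cfc_const_one ℝ X]
    rw [h2]
    exact norm_cfc_le (norm_nonneg _) fun x hx => (h1 x (hs x hx)).trans (hspec x hx)
  · have h2 : cfc (fun x : ℝ => √(1 + x)) X - (1 + (1 / 2 : ℂ) • X) =
        cfc (fun x : ℝ => √(1 + x) - (1 + (1 / 2 : ℝ) * x)) X := by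
      rw [cfc_sub (fun x : ℝ => √(1 + x)) (fun x => (1 + (1 / 2 : ℝ) * x)) X,
        cfc_const_add (1 : ℝ) (fun x => (1 / 2 : ℝ) * x) X,
        cfc_const_mul (1 / 2 : ℝ) (fun x => x) X, cfc_id' ℝ X, map_one]
      congr 2
      ext i j
      simp [Complex.real_smul]
    rw [h2]
    refine norm_cfc_le (by positivity) fun x hx => ?_
    have h3 := h1 x (hs x hx)
    have h4 := hspec x hx
    have h5 : √(1 + x) - (1 + (1 / 2 : ℝ) * x) = -((√(1 + x) - 1) ^ 2 / 2) := by
      have := Real.sq_sqrt (hs x hx)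
      linarith
    rw [h5, norm_neg, Real.norm_eq_abs, abs_of_nonneg (by positivity), ← sq_abs]
    have h6 : |√(1 + x) - 1| ^ 2 ≤ ‖X‖ ^ 2 :=
      pow_le_pow_left₀ (abs_nonneg _) (h3.trans h4) 2
    have : 0 ≤ ‖X‖ ^ 2 := by positivity
    linarith

theorem exists_inv_of_norm_sub_one_le {Y : Matrix κ κ ℂ} (hY : ‖Y - 1‖ ≤ 1 / 2) :
    ∃ Z : Matrix κ κ ℂ, Y * Z = 1 ∧ Z * Y = 1 ∧ ‖Z‖ ≤ 2 := by
  have hu : IsUnit Y := by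
    have := isUnit_one_sub_of_norm_lt_one (x := 1 - Y) (by rw [norm_sub_rev]; linarith)
    simpa using this
  obtain ⟨Z, hZ⟩ := hu.exists_right_inv
  refine ⟨Z, hZ, mul_eq_one_comm.1 hZ, ?_⟩
  have h1 : Z = 1 - (Y - 1) * Z := by rw [sub_mul, hZ, one_mul]; abel
  have h2 : ‖Z‖ ≤ ‖(1 : Matrix κ κ ℂ)‖ + ‖(Y - 1) * Z‖ := by
    conv_lhs => rw [h1]
    exact norm_sub_le _ _
  have h3 : ‖(Y - 1) * Z‖ ≤ 1 / 2 * ‖Z‖ :=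
    (norm_mul_le _ _).trans (mul_le_mul_of_nonneg_right hY (norm_nonneg _))
  have h4 := norm_one_matrix_le (κ := κ)
  linarith

theorem norm_triple_le (A B D : Matrix κ κ ℂ) {a b c : ℝ} (hA : ‖A‖ ≤ a) (hB : ‖B‖ ≤ b)
    (hD : ‖D‖ ≤ c) : ‖A * B * D‖ ≤ a * b * c := by
  have ha := (norm_nonneg _).trans hA
  have hb := (norm_nonneg _).trans hB
  calc ‖A * B * D‖ ≤ ‖A‖ * ‖B‖ * ‖D‖ :=
        (norm_mul_le _ _).trans (mul_le_mul_of_nonneg_right (norm_mul_le _ _) (norm_nonneg _))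
    _ ≤ a * b * c := by gcongr

/-- A factorization `Aᴴ A = C + R` of a perturbed Gram matrix that compresses a symmetry `S` of the
unperturbed one to `C S + (S R + R S) / 2`, up to an error of second order in `R`. -/
theorem exists_gram_factorization {C R S : Matrix κ κ ℂ} (hC : Cᴴ = C) (hR : Rᴴ = R)
    (hS : ‖S‖ ≤ 1) (hCS : Commute C S) (hC1 : ‖C - 1‖ ≤ 1 / 2) (hR1 : ‖R‖ ≤ 1 / 8) :
    ∃ A B : Matrix κ κ ℂ, A * B = 1 ∧ Aᴴ * A = C + R ∧
      ‖Aᴴ * S * A - (C * S + (1 / 2 : ℂ) • (S * R + R * S))‖ ≤ 108 * ‖R‖ ^ 2 := by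
  -- The root is taken in two stages, C = Y² and C + R = Y(1 + Q)Y with Q = Y⁻¹RY⁻¹. `Y` commutes
  -- with the symmetry, so only Z = √(1+Q), close to 1 at order R, disturbs it.
  obtain ⟨Y, hYh, hYY, hY1, -, hYc⟩ := exists_sqrt_one_add (X := C - 1)
    (by rw [Matrix.conjTranspose_sub, hC, Matrix.conjTranspose_one]) hC1
  have hYY' : Y * Y = C := by rw [hYY]; abel
  have hYS : Commute Y S := hYc S (hCS.sub_left (Commute.one_left S))
  obtain ⟨I, hYI, hIY, hI2⟩ := exists_inv_of_norm_sub_one_le (hY1.trans hC1)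
  have hIh : Iᴴ = I := by
    have h1 := congrArg Matrix.conjTranspose hIY
    rw [Matrix.conjTranspose_mul, hYh, Matrix.conjTranspose_one] at h1
    calc Iᴴ = I * Y * Iᴴ := by rw [hIY, one_mul]
      _ = I := by rw [mul_assoc, h1, mul_one]
  have hIS : I * S = S * I := by
    calc I * S = I * (S * Y) * I := by rw [mul_assoc, mul_assoc, hYI, mul_one]
      _ = S * I := by rw [← hYS.eq, ← mul_assoc, hIY, one_mul]
  set Q := I * R * I with hQ
  have hQn : ‖Q‖ ≤ 4 * ‖R‖ := by
    have := norm_triple_le I R I hI2 le_rfl hI2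
    linarith
  have hQ1 : ‖Q‖ ≤ 1 / 2 := by linarith
  obtain ⟨Z, hZh, hZZ, hZ1, hZ2, -⟩ := exists_sqrt_one_add (X := Q)
    (by rw [hQ, Matrix.conjTranspose_mul, Matrix.conjTranspose_mul, hIh, hR, mul_assoc]) hQ1
  obtain ⟨J, hZJ, -, -⟩ := exists_inv_of_norm_sub_one_le (hZ1.trans hQ1)
  have hYQY : Y * Q * Y = R := by
    calc Y * Q * Y = (Y * I) * R * (I * Y) := by rw [hQ]; simp only [mul_assoc]
      _ = R := by rw [hYI, hIY, one_mul, mul_one]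
  refine ⟨Z * Y, I * J, ?_, ?_, ?_⟩
  · calc Z * Y * (I * J) = Z * (Y * I) * J := by simp only [mul_assoc]
      _ = 1 := by rw [hYI, mul_one, hZJ]
  · rw [Matrix.conjTranspose_mul, hYh, hZh]
    calc Y * Z * (Z * Y) = Y * (Z * Z) * Y := by simp only [mul_assoc]
      _ = C + R := by rw [hZZ, mul_add, add_mul, mul_one, hYY', hYQY]
  · obtain ⟨q, hq⟩ : ∃ q, q = ‖Q‖ := ⟨_, rfl⟩
    have hq0 : 0 ≤ q := hq ▸ norm_nonneg _
    rw [← hq] at hZ1 hZ2 hQ1 hQn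
    set D := Z - (1 + (1 / 2 : ℂ) • Q) with hD
    have hZeq : Z = 1 + (1 / 2 : ℂ) • Q + D := by rw [hD]; abel
    have h1n := norm_one_matrix_le (κ := κ)
    have hZn : ‖Z‖ ≤ 3 / 2 := by
      have h1 : Z = 1 + (Z - 1) := by abel
      have h2 : ‖Z‖ ≤ ‖(1 : Matrix κ κ ℂ)‖ + ‖Z - 1‖ := by
        conv_lhs => rw [h1]
        exact norm_add_le _ _
      linarith
    have hYn : ‖Y‖ ≤ 3 / 2 := by
      have h1 : Y = 1 + (Y - 1) := by abel
      have h2 : ‖Y‖ ≤ ‖(1 : Matrix κ κ ℂ)‖ + ‖Y - 1‖ := by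
        conv_lhs => rw [h1]
        exact norm_add_le _ _
      linarith
    have hhalf : ‖(1 / 2 : ℂ) • Q‖ = q / 2 := by
      rw [norm_smul, ← hq]; norm_num; ring
    have hLn : ‖1 + (1 / 2 : ℂ) • Q‖ ≤ 5 / 4 := by
      refine (norm_add_le _ _).trans ?_
      rw [hhalf]; linarith
    -- All terms of ZSZ of second order in Q. The final constant 108 is 3 · 4² · (3/2)², from ‖E‖ ≤
    -- 3‖Q‖², ‖Q‖ ≤ 4‖R‖ and ‖Y‖ ≤ 3/2.
    set E := D * S * Z + (1 + (1 / 2 : ℂ) • Q) * S * D +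
      ((1 / 2 : ℂ) • Q) * S * ((1 / 2 : ℂ) • Q) with hE
    have hEn : ‖E‖ ≤ 3 * q ^ 2 := by
      have b1 := norm_triple_le D S Z hZ2 hS hZn
      have b2 := norm_triple_le _ S D hLn hS hZ2
      have b3 := norm_triple_le _ S _ hhalf.le hS hhalf.le
      have := norm_add₃_le (a := D * S * Z) (b := (1 + (1 / 2 : ℂ) • Q) * S * D)
        (c := ((1 / 2 : ℂ) • Q) * S * ((1 / 2 : ℂ) • Q))
      rw [← hE] at this
      nlinarith
    have hZSZ : Z * S * Z = S + (1 / 2 : ℂ) • (S * Q + Q * S) + E := by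
      have h1 : Z * S * Z = (1 + (1 / 2 : ℂ) • Q) * S * (1 + (1 / 2 : ℂ) • Q) +
          D * S * Z + (1 + (1 / 2 : ℂ) • Q) * S * D := by
        calc Z * S * Z = (1 + (1 / 2 : ℂ) • Q) * S * Z + D * S * Z := by
              conv_lhs => rw [hZeq, add_mul, add_mul, ← hZeq]
          _ = (1 + (1 / 2 : ℂ) • Q) * S * (1 + (1 / 2 : ℂ) • Q) +
              (1 + (1 / 2 : ℂ) • Q) * S * D + D * S * Z := by
              congr 1
              conv_lhs => rw [hZeq, mul_add]
          _ = _ := by abel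
      rw [h1, hE]
      simp only [add_mul, mul_add, one_mul, mul_one]
      simp only [smul_mul_assoc, mul_smul_comm, smul_add]
      abel
    have hfin : (Z * Y)ᴴ * S * (Z * Y) - (C * S + (1 / 2 : ℂ) • (S * R + R * S)) = Y * E * Y := by
      have h1 : (Z * Y)ᴴ * S * (Z * Y) = Y * (Z * S * Z) * Y := by
        rw [Matrix.conjTranspose_mul, hYh, hZh]; simp only [mul_assoc]
      have h2 : Y * S * Y = C * S := by rw [mul_assoc, ← hYS.eq, ← mul_assoc, hYY']
      have h3 : Y * (S * Q) * Y = S * R := by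
        rw [← hYQY, ← mul_assoc, hYS.eq]; simp only [mul_assoc]
      have h4 : Y * (Q * S) * Y = R * S := by
        rw [← hYQY]; simp only [mul_assoc]; rw [hYS.eq]
      rw [h1, hZSZ, mul_add, mul_add, add_mul, add_mul, mul_smul_comm, smul_mul_assoc, mul_add,
        add_mul, h2, h3, h4]
      abel
    rw [hfin]
    have h5 := norm_triple_le Y E Y hYn hEn hYn
    have h6 : q ^ 2 ≤ (4 * ‖R‖) ^ 2 := pow_le_pow_left₀ hq0 hQn 2
    nlinarith

end Sqrt

/-! ### Observables with prescribed logical action -/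

/-- The logical Pauli matrix of a measurement basis. -/
def LogicalBasis.mat : LogicalBasis → Matrix (Fin 2) (Fin 2) ℂ
  | LogicalBasis.X => Pauli.X.mat
  | LogicalBasis.Y => Pauli.Y.mat
  | LogicalBasis.Z => Pauli.Z.mat

theorem LogicalBasis.mat_mul_self (Q : LogicalBasis) : Q.mat * Q.mat = 1 := by
  cases Q <;> exact Pauli.mat_mul_self _

theorem LogicalBasis.mat_conjTranspose (Q : LogicalBasis) : Q.matᴴ = Q.mat := by
  cases Q <;> exact Pauli.mat_conjTranspose _

theorem LogicalBasis.norm_mat_le_one (Q : LogicalBasis) : ‖Q.mat‖ ≤ 1 :=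
  norm_le_one_of_isometry (by rw [Q.mat_conjTranspose, Q.mat_mul_self])

theorem LogicalBasis.exists_diagonalization (Q : LogicalBasis) :
    ∃ T : Matrix (Fin 2) (Fin 2) ℂ, Tᴴ * T = 1 ∧ Q.mat * T = T * Pauli.Z.mat := by
  have h2 : ((√2 : ℝ) : ℂ) * ((√2 : ℝ) : ℂ) = 2 := by
    rw [← Complex.ofReal_mul, Real.mul_self_sqrt (by norm_num)]
    norm_num
  have h0 : ((√2 : ℝ) : ℂ) ≠ 0 := by
    intro h; rw [h] at h2; norm_num at h2
  have h3 : ((√2 : ℝ) : ℂ)⁻¹ * ((√2 : ℝ) : ℂ)⁻¹ = 1 / 2 := by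
    rw [← mul_inv, h2]; norm_num
  cases Q
  · refine ⟨((√2 : ℝ) : ℂ)⁻¹ • !![1, 1; 1, -1], ?_, ?_⟩
    · rw [Matrix.conjTranspose_smul, smul_mul_smul_comm]
      simp only [star_inv₀, Complex.star_def, Complex.conj_ofReal, h3]
      ext i j
      fin_cases i <;> fin_cases j <;> simp [Matrix.mul_apply, Fin.sum_univ_two] <;> norm_num
    · rw [Matrix.mul_smul, Matrix.smul_mul]
      congr 1
      ext i j
      fin_cases i <;> fin_cases j <;>
        simp [LogicalBasis.mat, Pauli.mat, Matrix.mul_apply, Fin.sum_univ_two]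
  · refine ⟨((√2 : ℝ) : ℂ)⁻¹ • !![1, 1; Complex.I, -Complex.I], ?_, ?_⟩
    · rw [Matrix.conjTranspose_smul, smul_mul_smul_comm]
      simp only [star_inv₀, Complex.star_def, Complex.conj_ofReal, h3]
      ext i j
      fin_cases i <;> fin_cases j <;> simp [Matrix.mul_apply, Fin.sum_univ_two] <;> norm_num
    · rw [Matrix.mul_smul, Matrix.smul_mul]
      congr 1
      ext i j
      fin_cases i <;> fin_cases j <;>
        simp [LogicalBasis.mat, Pauli.mat, Matrix.mul_apply, Fin.sum_univ_two]
  · exact ⟨1, by simp, by simp [LogicalBasis.mat]⟩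

theorem pauliZAt_eq_diagonal (t : Fin n) :
    pauliZAt t = Matrix.diagonal fun x : Bits n => Pauli.Z.mat (x t) (x t) := by
  ext x y
  rw [Matrix.diagonal_apply]
  change ∏ i, (Function.update (fun _ => Pauli.I) t Pauli.Z i).mat (x i) (y i) = _
  split_ifs with h
  · subst h
    rw [Fintype.prod_eq_single t]
    · simp
    · intro i hi
      rw [Function.update_of_ne hi, Pauli.mat_I, Matrix.one_apply_eq]
  · obtain ⟨i, hi⟩ := Function.ne_iff.1 h
    refine Finset.prod_eq_zero (Finset.mem_univ i) ?_
    by_cases hit : i = t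
    · subst hit
      rw [Function.update_self]
      have : ∀ a b : Fin 2, a ≠ b → Pauli.Z.mat a b = 0 := by
        intro a b hab
        fin_cases a <;> fin_cases b <;> simp_all [Pauli.mat]
      exact this _ _ hi
    · rw [Function.update_of_ne hit, Pauli.mat_I, Matrix.one_apply_ne hi]

theorem orthonormal_columns {ι κ : Type*} [Fintype ι] [DecidableEq ι] [DecidableEq κ]
    {W : Matrix ι κ ℂ} (hW : Wᴴ * W = 1) :
    Orthonormal ℂ fun a : κ => (WithLp.toLp 2 fun x => W x a : EuclideanSpace ℂ ι) := by
  rw [orthonormal_iff_ite]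
  intro a b
  have := congrFun (congrFun hW a) b
  rw [Matrix.one_apply, Matrix.mul_apply] at this
  rw [← this]
  simp [PiLp.inner_apply, mul_comm]

/-- An orthonormal frame of pairs of vectors can be decoded to a single output qubit: some
observable unitarily equivalent to `Z` on that qubit acts as the logical Pauli matrix on each
pair. -/
theorem exists_decoder {ι : Type*} [Fintype ι] [DecidableEq ι] (t : Fin n) (Q : LogicalBasis)
    {W : Matrix (Bits n) (ι × Fin 2) ℂ} (hW : Wᴴ * W = 1) :
    ∃ U ∈ Matrix.unitaryGroup (Bits n) ℂ,
      qnnObservable t U * W = W * ((1 : Matrix ι ι ℂ) ⊗ₖ Q.mat) := by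
  obtain ⟨T, hT, hQT⟩ := Q.exists_diagonalization
  have hTT : T * Tᴴ = 1 := mul_eq_one_comm.1 hT
  -- Rotating each pair to the eigenbasis of the logical Pauli matrix reduces the problem to `Z`.
  set W' := W * ((1 : Matrix ι ι ℂ) ⊗ₖ T) with hW'
  have hW'1 : W'ᴴ * W' = 1 := by
    rw [hW', Matrix.conjTranspose_mul, Matrix.mul_assoc, ← Matrix.mul_assoc Wᴴ, hW, Matrix.one_mul,
      Matrix.conjTranspose_kronecker, ← Matrix.mul_kronecker_mul, hT]
    simp
  have hon := orthonormal_columns hW'1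
  let R := {j : Fin n // j ≠ t} → Fin 2
  -- An isometry into 2^n dimensions leaves room for at most 2^(n−1) pairs, so the pair labels fit
  -- into the qubits other than the output.
  have hcard : Fintype.card ι ≤ Fintype.card R := by
    have h1 := hon.linearIndependent.fintype_card_le_finrank
    rw [finrank_euclideanSpace, Fintype.card_prod, Fintype.card_congr (Equiv.funSplitAt t (Fin 2)),
      Fintype.card_prod] at h1
    simp only [Fintype.card_fin] at h1
    change _ ≤ 2 * Fintype.card R at h1
    omega
  obtain ⟨emb⟩ := Function.Embedding.nonempty_of_card_le hcard
  -- The index within the pair goes to the output qubit and the pair label to the others. Extending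
  -- the columns at these basis labels to an orthonormal basis gives the inverse of the decoding
  -- unitary.
  let f : ι × Fin 2 → Bits n := fun a => (Equiv.funSplitAt t (Fin 2)).symm (a.2, emb a.1)
  have hf : Function.Injective f := by
    intro a b hab
    have := (Equiv.funSplitAt t (Fin 2)).symm.injective hab
    rw [Prod.mk.injEq] at this
    exact Prod.ext (emb.injective this.2) this.1
  have hft : ∀ a, f a t = a.2 := by
    intro a
    have := congrArg Prod.fst ((Equiv.funSplitAt t (Fin 2)).apply_symm_apply (a.2, emb a.1))
    exact this
  let v : Bits n → EuclideanSpace ℂ (Bits n) :=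
    Function.extend f (fun a => WithLp.toLp 2 fun x => W' x a) 0
  have hvf : ∀ a, v (f a) = WithLp.toLp 2 fun x => W' x a := fun a => hf.extend_apply _ _ a
  have hv : Orthonormal ℂ ((Set.range f).domRestrict v) := by
    have he : (fun a => WithLp.toLp 2 fun x => W' x a) =
        (Set.range f).domRestrict v ∘ (Equiv.ofInjective f hf) := by
      funext a
      exact (hvf a).symm
    rw [he] at hon
    have := hon.comp (Equiv.ofInjective f hf).symm (Equiv.injective _)
    rwa [Function.comp_assoc, Equiv.self_comp_symm, Function.comp_id] at this
  obtain ⟨b, hb⟩ := hv.exists_orthonormalBasis_extension_of_card_eq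
    (by rw [finrank_euclideanSpace])
  let B : Op n := Matrix.of fun x y => b y x
  have hBB : Bᴴ * B = 1 := by
    ext x y
    have := orthonormal_iff_ite.1 b.orthonormal x y
    rw [Matrix.one_apply, ← this, Matrix.mul_apply]
    simp [B, PiLp.inner_apply, mul_comm]
  have hBB' : B * Bᴴ = 1 := mul_eq_one_comm.1 hBB
  let F : Matrix (Bits n) (ι × Fin 2) ℂ := Matrix.of fun x a => if x = f a then 1 else 0
  have hBF : B * F = W' := by
    ext x a
    rw [Matrix.mul_apply]
    simp only [F, B, Matrix.of_apply, mul_ite, mul_one, mul_zero, Finset.sum_ite_eq',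
      Finset.mem_univ, if_true]
    rw [hb (f a) ⟨a, rfl⟩, hvf]
  have hZF : pauliZAt t * F = F * ((1 : Matrix ι ι ℂ) ⊗ₖ Pauli.Z.mat) := by
    have hZd : (1 : Matrix ι ι ℂ) ⊗ₖ Pauli.Z.mat =
        Matrix.diagonal fun a : ι × Fin 2 => Pauli.Z.mat a.2 a.2 := by
      ext a c
      rw [Matrix.kroneckerMap_apply, Matrix.diagonal_apply, Matrix.one_apply]
      obtain ⟨a1, a2⟩ := a
      obtain ⟨c1, c2⟩ := c
      by_cases h1 : a1 = c1
      · subst h1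
        fin_cases a2 <;> fin_cases c2 <;> simp [Pauli.mat]
      · simp [h1]
    rw [pauliZAt_eq_diagonal, hZd]
    ext x a
    rw [Matrix.diagonal_mul, Matrix.mul_diagonal]
    simp only [F, Matrix.of_apply]
    split_ifs with h
    · rw [h, hft, mul_comm]
    · simp
  refine ⟨Bᴴ, ?_, ?_⟩
  · rw [Matrix.mem_unitaryGroup_iff, Matrix.star_eq_conjTranspose, Matrix.conjTranspose_conjTranspose,
      hBB]
  · have h1 : qnnObservable t Bᴴ * W' = W' * ((1 : Matrix ι ι ℂ) ⊗ₖ Pauli.Z.mat) := by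
      rw [qnnObservable, Matrix.conjTranspose_conjTranspose, ← hBF, Matrix.mul_assoc,
        ← Matrix.mul_assoc Bᴴ, hBB, Matrix.one_mul, Matrix.mul_assoc, hZF, Matrix.mul_assoc]
    have h2 : W = W' * ((1 : Matrix ι ι ℂ) ⊗ₖ Tᴴ) := by
      rw [hW', Matrix.mul_assoc, ← Matrix.mul_kronecker_mul, hTT]
      simp
    have h3 : T * Pauli.Z.mat * Tᴴ = Q.mat := by
      rw [← hQT, Matrix.mul_assoc, hTT, Matrix.mul_one]
    calc qnnObservable t Bᴴ * W
        = qnnObservable t Bᴴ * W' * ((1 : Matrix ι ι ℂ) ⊗ₖ Tᴴ) := by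
          rw [Matrix.mul_assoc, ← h2]
      _ = W * (((1 : Matrix ι ι ℂ) ⊗ₖ T) * ((1 : Matrix ι ι ℂ) ⊗ₖ Pauli.Z.mat) *
            ((1 : Matrix ι ι ℂ) ⊗ₖ Tᴴ)) := by
          rw [h1, hW']; simp only [Matrix.mul_assoc]
      _ = _ := by
          rw [← Matrix.mul_kronecker_mul, ← Matrix.mul_kronecker_mul, h3]; simp

theorem qnnObservable_isHermitian (t : Fin n) (U : Op n) :
    (qnnObservable t U)ᴴ = qnnObservable t U := by
  rw [qnnObservable, Matrix.conjTranspose_mul, Matrix.conjTranspose_mul,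
    Matrix.conjTranspose_conjTranspose, pauliZAt, pauliOp_isHermitian, Matrix.mul_assoc]

theorem norm_pauliOp_le_one (P : PauliString n) : ‖pauliOp P‖ ≤ 1 :=
  norm_le_one_of_isometry (by rw [pauliOp_isHermitian, pauliOp_mul_self])

theorem norm_qnnObservable_le_one (t : Fin n) {U : Op n}
    (hU : U ∈ Matrix.unitaryGroup (Bits n) ℂ) : ‖qnnObservable t U‖ ≤ 1 := by
  have h1 : ‖U‖ ≤ 1 := norm_le_one_of_isometry (Matrix.mem_unitaryGroup_iff'.1 hU)
  have h2 := norm_triple_le Uᴴ (pauliZAt t) U ((Matrix.l2_opNorm_conjTranspose U).trans_le h1)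
    (norm_pauliOp_le_one _) h1
  rwa [mul_one, mul_one] at h2

/-! ### The decoding error -/

theorem encoded_eq_mulVec (Ω : Fin 2 → Vec n) (θ φ : ℝ) :
    encoded Ω θ φ = frame Ω *ᵥ ![(Real.cos θ : ℂ), Complex.exp (φ * Complex.I) * Real.sin θ] := by
  ext x
  simp [encoded, frame, Matrix.mulVec, dotProduct, Fin.sum_univ_two, mul_comm]

/-- Both numbers are quadratic forms of 2×2 matrices at the same unit vector of Bloch coordinates,
so the operator norm bounds their difference for all angles at once. -/
theorem abs_expectation_sub_label_le (A : Op n) (Ω : Fin 2 → Vec n) (Q : LogicalBasis)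
    (θ φ : ℝ) : |expectation A (encoded Ω θ φ) - label Q θ φ| ≤
      ‖(frame Ω)ᴴ * A * frame Ω - Q.mat‖ := by
  set z : Fin 2 → ℂ := ![(Real.cos θ : ℂ), Complex.exp (φ * Complex.I) * Real.sin θ] with hz
  have hexp : Complex.exp (φ * Complex.I) = Real.cos φ + Real.sin φ * Complex.I := by
    rw [Complex.exp_mul_I, Complex.ofReal_cos, Complex.ofReal_sin]
  have hstar : ∀ M : Matrix (Fin 2) (Fin 2) ℂ, star z ⬝ᵥ (M *ᵥ z) =
      Real.cos θ * (M 0 0 * Real.cos θ + M 0 1 *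
        ((Real.cos φ + Real.sin φ * Complex.I) * Real.sin θ)) +
      (Real.cos φ - Real.sin φ * Complex.I) * Real.sin θ * (M 1 0 * Real.cos θ + M 1 1 *
        ((Real.cos φ + Real.sin φ * Complex.I) * Real.sin θ)) := by
    intro M
    simp only [hz, hexp, dotProduct, Matrix.mulVec, Fin.sum_univ_two, Pi.star_apply,
      Matrix.cons_val_zero, Matrix.cons_val_one, Complex.star_def, map_mul, map_add,
      Complex.conj_ofReal, Complex.conj_I]
    ring
  have hlabel : (star z ⬝ᵥ (Q.mat *ᵥ z)).re = label Q θ φ := by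
    have h1 := Real.sin_sq_add_cos_sq φ
    rw [hstar]
    cases Q
    · simp [LogicalBasis.mat, Pauli.mat, label, Real.sin_two_mul, -Complex.ofReal_cos,
        -Complex.ofReal_sin]
      ring
    · simp [LogicalBasis.mat, Pauli.mat, label, Real.sin_two_mul, -Complex.ofReal_cos,
        -Complex.ofReal_sin]
      ring
    · simp [LogicalBasis.mat, Pauli.mat, label, Real.cos_two_mul', -Complex.ofReal_cos,
        -Complex.ofReal_sin]
      linear_combination -(Real.sin θ ^ 2) * h1
  have hnorm : ‖star z ⬝ᵥ z‖ = 1 := by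
    have h1 := hstar 1
    have hI := Complex.I_mul_I
    have h2 : (Real.sin φ : ℂ) ^ 2 + (Real.cos φ : ℂ) ^ 2 = 1 := by
      exact_mod_cast Real.sin_sq_add_cos_sq φ
    have h3 : (Real.sin θ : ℂ) ^ 2 + (Real.cos θ : ℂ) ^ 2 = 1 := by
      exact_mod_cast Real.sin_sq_add_cos_sq θ
    rw [Matrix.one_mulVec] at h1
    have h4 : star z ⬝ᵥ z = 1 := by
      rw [h1]
      simp only [Matrix.one_apply_eq, Matrix.one_apply_ne (zero_ne_one : (0 : Fin 2) ≠ 1),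
        Matrix.one_apply_ne (one_ne_zero : (1 : Fin 2) ≠ 0)]
      linear_combination (Real.sin θ : ℂ) ^ 2 * h2 + h3 -
        (Real.sin φ : ℂ) ^ 2 * (Real.sin θ : ℂ) ^ 2 * hI
    rw [h4, norm_one]
  have hexpect : expectation A (encoded Ω θ φ) =
      (star z ⬝ᵥ (((frame Ω)ᴴ * A * frame Ω) *ᵥ z)).re := by
    rw [encoded_eq_mulVec, expectation, Matrix.star_mulVec, ← Matrix.dotProduct_mulVec,
      Matrix.mulVec_mulVec, Matrix.mulVec_mulVec, Matrix.mul_assoc]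
  rw [hexpect, ← hlabel, ← Complex.sub_re, ← dotProduct_sub, ← Matrix.sub_mulVec]
  refine (Complex.abs_re_le_norm _).trans ((norm_dotProduct_mulVec_le _ z).trans ?_)
  rw [hnorm, mul_one]

/-- Reduces the theorem to a norm estimate for 2×2 matrices, one per noise operator of positive
probability. -/
theorem decodingError_le {p : ℕ} (μ : MeasureTheory.Measure (ℝ × ℝ))
    [MeasureTheory.IsFiniteMeasure μ] {prob : PauliString n → ℝ} (hprob : IsNoise p prob)
    (Ω : Fin 2 → Vec n) (Q : LogicalBasis) (O : Op n) {δ : ℝ}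
    (h : ∀ P, prob P ≠ 0 → ‖(frame Ω)ᴴ * (pauliOp P * O * pauliOp P) * frame Ω - Q.mat‖ ≤ δ) :
    decodingError μ prob Ω Q O ≤ δ ^ 2 * μ.real Set.univ := by
  set I := Set.Icc (0 : ℝ) Real.pi ×ˢ Set.Icc (0 : ℝ) (2 * Real.pi) with hI
  have h1 : ∀ P, prob P * ∫ x in I,
      (expectation (pauliOp P * O * pauliOp P) (encoded Ω x.1 x.2) - label Q x.1 x.2) ^ 2 ∂μ ≤
      prob P * (δ ^ 2 * μ.real Set.univ) := by
    intro P
    by_cases hP : prob P = 0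
    · simp [hP]
    · refine mul_le_mul_of_nonneg_left ?_ (hprob.1 P)
      calc _ ≤ ∫ x in I, δ ^ 2 ∂μ := by
            refine MeasureTheory.integral_mono_of_nonneg (Filter.Eventually.of_forall
              fun x => sq_nonneg _) (MeasureTheory.integrable_const _)
              (Filter.Eventually.of_forall fun x => ?_)
            refine sq_le_sq' ?_ ?_
            · exact (abs_le.1 ((abs_expectation_sub_label_le _ Ω Q x.1 x.2).trans (h P hP))).1
            · exact (abs_le.1 ((abs_expectation_sub_label_le _ Ω Q x.1 x.2).trans (h P hP))).2
        _ = μ.real I * δ ^ 2 := by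
            rw [MeasureTheory.setIntegral_const, smul_eq_mul]
        _ ≤ δ ^ 2 * μ.real Set.univ := by
            rw [mul_comm]
            exact mul_le_mul_of_nonneg_left
              (MeasureTheory.measureReal_mono (Set.subset_univ _)) (sq_nonneg _)
  unfold decodingError
  refine (Finset.sum_le_sum fun P _ => h1 P).trans (le_of_eq ?_)
  rw [← Finset.sum_mul, hprob.2.1, one_mul]

end PerturbedCode

namespace PerturbedCode

open scoped ComplexOrder Matrix.Norms.L2Operator Kronecker

variable {n k : ℕ}

theorem exists_uniform_bound {α : Type*} [Finite α] {p : α → ℝ → ℝ → Prop}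
    (hp : ∀ a K K' l, K ≤ K' → p a K l → p a K' l)
    (h : ∀ a, ∃ K l₀, 0 ≤ K ∧ 0 < l₀ ∧ ∀ l : ℝ, |l| < l₀ → p a K l) :
    ∃ K l₀, 0 ≤ K ∧ 0 < l₀ ∧ ∀ l : ℝ, |l| < l₀ → ∀ a, p a K l := by
  have := Fintype.ofFinite α
  choose K l₀ hK hl₀ h using h
  rcases isEmpty_or_nonempty α with hα | hα
  · exact ⟨0, 1, le_rfl, one_pos, fun l _ a => isEmptyElim a⟩
  · obtain ⟨a₀, ha₀⟩ := Finite.exists_min l₀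
    refine ⟨∑ a, K a, l₀ a₀, Finset.sum_nonneg fun a _ => hK a, hl₀ a₀, fun l hl a => ?_⟩
    exact hp a _ _ l (Finset.single_le_sum (fun b _ => hK b) (Finset.mem_univ a))
      (h a l (hl.trans_le (ha₀ a)))

/-! ### Block matrices -/

section Blocks

variable {ι : Type*} [Fintype ι] [DecidableEq ι]

/-- The inclusion of the pair of coordinates with label `b`. -/
def blockIncl (b : ι) : Matrix (ι × Fin 2) (Fin 2) ℂ :=
  Matrix.of fun a j => if a = (b, j) then 1 else 0

theorem mul_blockIncl {α : Type*} (M : Matrix α (ι × Fin 2) ℂ) (b : ι) :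
    M * blockIncl b = Matrix.of fun x j => M x (b, j) := by
  ext x j
  simp [blockIncl, Matrix.mul_apply]

theorem blockIncl_mul {α : Type*} (b : ι) (M : Matrix (ι × Fin 2) α ℂ) :
    (blockIncl b)ᴴ * M = Matrix.of fun j x => M (b, j) x := by
  ext j x
  simp [blockIncl, Matrix.mul_apply, Matrix.conjTranspose_apply, apply_ite]

theorem blockIncl_conjTranspose_mul (b c : ι) :
    (blockIncl b)ᴴ * blockIncl c = if b = c then 1 else 0 := by
  rw [blockIncl_mul]
  ext i j
  by_cases h : b = c
  · simp [h, blockIncl, Matrix.one_apply]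
  · simp [h, blockIncl]

theorem norm_blockIncl_le_one (b : ι) : ‖blockIncl b‖ ≤ 1 :=
  norm_le_one_of_isometry (by rw [blockIncl_conjTranspose_mul, if_pos rfl])

theorem sum_blockIncl_mul : ∑ b : ι, blockIncl b * (blockIncl b)ᴴ = 1 := by
  ext a c
  obtain ⟨c1, c2⟩ := c
  rw [Matrix.sum_apply, Finset.sum_eq_single c1]
  · obtain ⟨a1, a2⟩ := a
    simp only [blockIncl, Matrix.mul_apply, Matrix.of_apply, Matrix.conjTranspose_apply,
      Matrix.one_apply, Prod.mk.injEq, true_and]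
    simp [apply_ite, Finset.sum_ite_eq]
  · intro b _ hb
    rw [Matrix.mul_apply]
    refine Finset.sum_eq_zero fun j _ => ?_
    simp [blockIncl, hb.symm]
  · simp

theorem eq_sum_blocks (M : Matrix (ι × Fin 2) (ι × Fin 2) ℂ) :
    M = ∑ b : ι, ∑ c : ι, blockIncl b * ((blockIncl b)ᴴ * M * blockIncl c) * (blockIncl c)ᴴ := by
  calc M = (∑ b : ι, blockIncl b * (blockIncl b)ᴴ) * M * ∑ c : ι, blockIncl c * (blockIncl c)ᴴ := by
        rw [sum_blockIncl_mul, one_mul, mul_one]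
    _ = _ := by
        rw [Finset.sum_mul, Finset.sum_mul]
        refine Finset.sum_congr rfl fun b _ => ?_
        rw [Finset.mul_sum]
        exact Finset.sum_congr rfl fun c _ => by simp only [Matrix.mul_assoc]

theorem ext_blocks {M N : Matrix (ι × Fin 2) (ι × Fin 2) ℂ}
    (h : ∀ b c : ι, (blockIncl b)ᴴ * M * blockIncl c = (blockIncl b)ᴴ * N * blockIncl c) : M = N := by
  rw [eq_sum_blocks M, eq_sum_blocks N]
  simp only [h]

theorem norm_sandwich_le {α β γ δ : Type*} [Fintype α] [Fintype β] [Fintype γ] [Fintype δ]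
    [DecidableEq α] [DecidableEq β] [DecidableEq γ] [DecidableEq δ]
    {A : Matrix α β ℂ} (M : Matrix β γ ℂ) {B : Matrix γ δ ℂ} (hA : ‖A‖ ≤ 1) (hB : ‖B‖ ≤ 1) :
    ‖A * M * B‖ ≤ ‖M‖ :=
  (Matrix.l2_opNorm_mul _ _).trans ((mul_le_of_le_one_right (norm_nonneg _) hB).trans
    ((Matrix.l2_opNorm_mul _ _).trans (mul_le_of_le_one_left (norm_nonneg _) hA)))

theorem norm_le_of_blocks {M : Matrix (ι × Fin 2) (ι × Fin 2) ℂ} {r : ℝ}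
    (h : ∀ b c : ι, ‖(blockIncl b)ᴴ * M * blockIncl c‖ ≤ r) :
    ‖M‖ ≤ (Fintype.card ι : ℝ) ^ 2 * r := by
  conv_lhs => rw [eq_sum_blocks M]
  have h1 : ∀ b c : ι, ‖blockIncl b * ((blockIncl b)ᴴ * M * blockIncl c) * (blockIncl c)ᴴ‖ ≤ r :=
    fun b c => (norm_sandwich_le _ (norm_blockIncl_le_one b)
      (by rw [Matrix.l2_opNorm_conjTranspose]; exact norm_blockIncl_le_one c)).trans (h b c)
  refine (norm_sum_le_of_le _ fun b _ => norm_sum_le_of_le _ fun c _ => h1 b c).trans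
    (le_of_eq ?_)
  simp
  ring

theorem kronecker_mul_blockIncl (σ : Matrix (Fin 2) (Fin 2) ℂ) (b : ι) :
    ((1 : Matrix ι ι ℂ) ⊗ₖ σ) * blockIncl b = blockIncl b * σ := by
  rw [mul_blockIncl]
  ext a j
  obtain ⟨a1, a2⟩ := a
  by_cases h : a1 = b
  · simp [blockIncl, Matrix.mul_apply, h]
  · simp [blockIncl, Matrix.mul_apply, h]

theorem blockIncl_mul_kronecker (σ : Matrix (Fin 2) (Fin 2) ℂ) (b : ι) :
    (blockIncl b)ᴴ * ((1 : Matrix ι ι ℂ) ⊗ₖ σ) = σ * (blockIncl b)ᴴ := by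
  have h := congrArg Matrix.conjTranspose (kronecker_mul_blockIncl σᴴ b)
  rw [Matrix.conjTranspose_mul, Matrix.conjTranspose_mul, Matrix.conjTranspose_kronecker,
    Matrix.conjTranspose_conjTranspose, Matrix.conjTranspose_one] at h
  exact h

theorem blockIncl_mul_kronecker_one_mul (c : Matrix ι ι ℂ) (a b : ι) :
    (blockIncl a)ᴴ * (c ⊗ₖ (1 : Matrix (Fin 2) (Fin 2) ℂ)) * blockIncl b = c a b • 1 := by
  rw [blockIncl_mul, mul_blockIncl]
  ext i j
  simp

theorem norm_apply_self_le {κ : Type*} [Fintype κ] [DecidableEq κ] (M : Matrix κ κ ℂ) (i : κ) :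
    ‖M i i‖ ≤ ‖M‖ := by
  have h := norm_dotProduct_mulVec_le M (Pi.single i 1)
  have hs : star (Pi.single i 1 : κ → ℂ) = Pi.single i 1 := by rw [← Pi.single_star, star_one]
  rw [hs, Matrix.mulVec_single_one, single_one_dotProduct, single_one_dotProduct,
    Pi.single_eq_same, norm_one, mul_one] at h
  exact h

/-- Replaces an unspecified scalar by a canonical one at the cost of a factor 2, so that the scalar
part of a Gram matrix can be chosen Hermitian. -/
theorem norm_sub_half_trace_le (M : Matrix (Fin 2) (Fin 2) ℂ) (c : ℂ) :
    ‖M - (M.trace / 2) • 1‖ ≤ 2 * ‖M - c • 1‖ := by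
  have h1 : M - (M.trace / 2) • 1 = (M - c • 1) - ((M - c • 1).trace / 2) • 1 := by
    rw [Matrix.trace_sub, Matrix.trace_smul, Matrix.trace_one]
    simp only [Fintype.card_fin, smul_eq_mul]
    push_cast
    module
  have h2 : ‖(M - c • 1).trace / 2‖ ≤ ‖M - c • 1‖ := by
    rw [norm_div, Matrix.trace_fin_two, Complex.norm_ofNat]
    have := norm_add_le ((M - c • 1) 0 0) ((M - c • 1) 1 1)
    have := norm_apply_self_le (M - c • 1) 0
    have := norm_apply_self_le (M - c • 1) 1
    linarith
  rw [h1]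
  refine (norm_sub_le _ _).trans ?_
  rw [norm_smul]
  have h3 := norm_one_matrix_le (κ := Fin 2)
  have := mul_le_of_le_one_right (norm_nonneg ((M - c • 1).trace / 2)) h3
  linarith

end Blocks

namespace StabilizerCode

variable (C : StabilizerCode n)

/-! ### Syndromes -/

/-- The syndrome of a Pauli string: the signs with which it commutes with the generators. -/
noncomputable def syndrome (P : PauliString n) (a : Fin (n - 1)) : ℤˣ :=
  (C.S_mul_pauliOp a P).choose

theorem S_mul_pauliOp_eq (P : PauliString n) (a : Fin (n - 1)) :
    C.S a * pauliOp P = ((C.syndrome P a : ℤ) : ℂ) • (pauliOp P * C.S a) :=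
  (C.S_mul_pauliOp a P).choose_spec

theorem S_mul_pauliOp_mul_pauliOp (P R : PauliString n) (a : Fin (n - 1)) :
    C.S a * (pauliOp P * pauliOp R) =
      (((C.syndrome P a * C.syndrome R a : ℤˣ) : ℤ) : ℂ) • (pauliOp P * pauliOp R * C.S a) := by
  rw [← mul_assoc, S_mul_pauliOp_eq, smul_mul_assoc, mul_assoc, S_mul_pauliOp_eq, mul_smul_comm,
    smul_smul, mul_assoc]
  push_cast
  rfl

/-- The product commutes with all generators and has weight at most 2p < d, so it cannot be logical.
-/
theorem inStabilizer_of_syndrome_eq {d p : ℕ} (hd : C.HasDistance d) (hp : 2 * p < d)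
    {P R : PauliString n} (hP : weight P ≤ p) (hR : weight R ≤ p)
    (h : C.syndrome P = C.syndrome R) : C.InStabilizer (pauliOp P * pauliOp R) := by
  obtain ⟨c, hc, hPR⟩ := pauliOp_mul P R
  set L := fun i => Pauli.mulLabel (P i) (R i) with hL
  have hcomm : ∀ a, Commute (pauliOp L) (C.S a) := by
    intro a
    have h1 := C.S_mul_pauliOp_mul_pauliOp P R a
    rw [h, Int.units_mul_self, Units.val_one, Int.cast_one, one_smul] at h1
    have h2 : Commute (pauliOp P * pauliOp R) (C.S a) := h1.symm
    have h3 : pauliOp L = c⁻¹ • (pauliOp P * pauliOp R) := by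
      rw [hPR, smul_smul, inv_mul_cancel₀ hc, one_smul]
    rw [h3]
    exact h2.smul_left _
  rw [hPR]
  refine C.inStabilizer_smul c ?_
  by_contra hs
  have h1 := hd.2 L ⟨hcomm, hs⟩
  have h2 : weight L ≤ weight P + weight R := weight_mulLabel_le P R
  omega

theorem proj_mul_mul_proj_of_syndrome_ne {P R : PauliString n}
    (h : C.syndrome P ≠ C.syndrome R) : C.proj * (pauliOp P * pauliOp R) * C.proj = 0 := by
  obtain ⟨a, ha⟩ := Function.ne_iff.1 h
  have hs : C.syndrome P a * C.syndrome R a = -1 := by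
    rcases Int.units_eq_one_or (C.syndrome P a) with h1 | h1 <;>
      rcases Int.units_eq_one_or (C.syndrome R a) with h2 | h2 <;> simp_all
  have h1 : C.proj * (pauliOp P * pauliOp R) * C.proj =
      -(C.proj * (pauliOp P * pauliOp R) * C.proj) := by
    calc C.proj * (pauliOp P * pauliOp R) * C.proj
        = C.proj * (C.S a * (pauliOp P * pauliOp R)) * C.proj := by
          rw [← mul_assoc C.proj (C.S a), C.proj_mul_S]
      _ = -(C.proj * (pauliOp P * pauliOp R * (C.S a * C.proj))) := by
          rw [S_mul_pauliOp_mul_pauliOp, hs]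
          simp [mul_assoc]
      _ = _ := by rw [C.S_mul_proj]; simp only [mul_assoc]
  have h2 : (2 : ℂ) • (C.proj * (pauliOp P * pauliOp R) * C.proj) = 0 := by
    rw [two_smul]
    exact add_eq_zero_iff_eq_neg.2 h1
  exact (smul_eq_zero.1 h2).resolve_left two_ne_zero

theorem commute_excitation {M : Op n} (h : ∀ a, Commute M (C.S a)) : Commute M C.excitation :=
  Commute.sum_right _ _ _ fun a _ => (Commute.one_right M).sub_right (h a)

theorem commute_proj {M : Op n} (h : ∀ a, Commute M (C.S a)) : Commute M C.proj := by
  refine Commute.list_prod_right _ _ fun x hx => ?_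
  obtain ⟨a, rfl⟩ := (List.mem_ofFn' _ _).1 hx
  exact ((Commute.one_right M).add_right (h a)).smul_right _

/-- One representative for each syndrome that occurs; distinct syndromes send the code to orthogonal
spaces. Representatives have positive probability, so that the weight bound and the independence
hypothesis apply to them. -/
theorem exists_syndrome_representatives {d p : ℕ} (hd : C.HasDistance d) (hp : 2 * p < d)
    {prob : PauliString n → ℝ} (hprob : IsNoise p prob) :
    ∃ (ι : Type) (_ : Fintype ι) (_ : DecidableEq ι) (r : ι → PauliString n),
      (∀ i, prob (r i) ≠ 0) ∧
      (∀ i j, i ≠ j → C.proj * (pauliOp (r i) * pauliOp (r j)) * C.proj = 0) ∧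
      ∀ P, prob P ≠ 0 → ∃ i, C.InStabilizer (pauliOp (r i) * pauliOp P) := by
  classical
  let ι := {s : Fin (n - 1) → ℤˣ // ∃ P, prob P ≠ 0 ∧ C.syndrome P = s}
  refine ⟨ι, inferInstance, inferInstance, fun s => s.2.choose, fun s => s.2.choose_spec.1, ?_, ?_⟩
  · intro i j hij
    refine C.proj_mul_mul_proj_of_syndrome_ne fun h => hij ?_
    rw [i.2.choose_spec.2, j.2.choose_spec.2] at h
    exact Subtype.ext h
  · intro P hP
    let i : ι := ⟨C.syndrome P, P, hP, rfl⟩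
    exact ⟨i, C.inStabilizer_of_syndrome_eq hd hp (hprob.2.2 _ i.2.choose_spec.1)
      (hprob.2.2 _ hP) i.2.choose_spec.2⟩

theorem exists_scalar_of_inStabilizer {P R : PauliString n}
    (h : C.InStabilizer (pauliOp R * pauliOp P)) :
    ∃ x : ℂ, C.proj * (pauliOp R * pauliOp P) = x • C.proj ∧
      (pauliOp R * pauliOp P) * C.proj = x • C.proj := by
  obtain ⟨x, hx⟩ := h.mul_proj
  exact ⟨x, by rw [← hx]; exact (C.commute_proj (h.commute_S)).eq.symm, hx⟩

theorem norm_sq_scalar_eq_one {P R : PauliString n} {x : ℂ} {F : Matrix (Bits n) (Fin 2) ℂ}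
    (hF : Fᴴ * F = 1) (h : (pauliOp R * pauliOp P) * F = x • F) : star x * x = 1 := by
  have h1 : ((pauliOp R * pauliOp P) * F)ᴴ * ((pauliOp R * pauliOp P) * F) = 1 := by
    rw [Matrix.conjTranspose_mul, Matrix.conjTranspose_mul, pauliOp_isHermitian,
      pauliOp_isHermitian]
    calc _ = Fᴴ * (pauliOp P * (pauliOp R * pauliOp R) * pauliOp P * F) := by
          simp only [Matrix.mul_assoc]
      _ = 1 := by rw [pauliOp_mul_self, mul_one, pauliOp_mul_self, Matrix.one_mul, hF]
  rw [h, Matrix.conjTranspose_smul, Matrix.smul_mul, Matrix.mul_smul, hF, smul_smul] at h1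
  simpa using congrFun (congrFun h1 0) 0

theorem mul_eq_smul_of_mul_mul_eq_smul {P R : PauliString n} {x : ℂ}
    {F : Matrix (Bits n) (Fin 2) ℂ} (h : (pauliOp R * pauliOp P) * F = x • F) :
    pauliOp P * F = x • (pauliOp R * F) := by
  rw [← Matrix.mul_smul, ← h, ← Matrix.mul_assoc, ← Matrix.mul_assoc, pauliOp_mul_self,
    Matrix.one_mul]

/-! ### Decoding to leading order -/

/-- The decoder is built for the unperturbed code with the basis obtained by projecting and
renormalizing Ω. The excited part Ξ of Ω is first order, but it enters the Gram matrix of PΩ and the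
decoded matrix only quadratically. -/
theorem exists_first_order_decoder {d p : ℕ} (hd : C.HasDistance d) (hp : 2 * p < d)
    {prob : PauliString n → ℝ} (hprob : IsNoise p prob) (V : Op n) (t : Fin n)
    (Q : LogicalBasis) :
    ∃ K l₀, 0 ≤ K ∧ 0 < l₀ ∧ ∀ l : ℝ, |l| < l₀ → ∀ Ω : Matrix (Bits n) (Fin 2) ℂ,
      C.IsLowFrame V l Ω → ∃ U ∈ Matrix.unitaryGroup (Bits n) ℂ, ∀ P, prob P ≠ 0 →
        ‖Ωᴴ * (pauliOp P * qnnObservable t U * pauliOp P) * Ω - Q.mat‖ ≤ K * |l| ^ 2 := by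
  obtain ⟨ι, _, _, r, -, hr, hrep⟩ := C.exists_syndrome_representatives hd hp hprob
  obtain ⟨K, hK, hKb⟩ := C.exists_norm_excited_part_le V
  refine ⟨4 * K ^ 2, 1 / (2 * (1 + K ^ 2)), by positivity, by positivity, fun l hl Ω hΩ => ?_⟩
  rw [lt_div_iff₀ (by positivity)] at hl
  have ha0 := abs_nonneg l
  have hK2 : 0 ≤ K ^ 2 := by positivity
  have hl1 : |l| ≤ 1 := by nlinarith
  have hK2a : K ^ 2 * |l| ^ 2 ≤ 1 / 2 := by
    have : |l| ^ 2 ≤ |l| := pow_le_of_le_one ha0 hl1 two_ne_zero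
    nlinarith
  obtain ⟨Ξ, hΞ⟩ : ∃ Ξ, Ξ = (1 - C.proj) * Ω := ⟨_, rfl⟩
  have hΞn : ‖Ξ‖ * ‖Ξ‖ ≤ K ^ 2 * |l| ^ 2 := by
    have := hKb l Ω hΩ
    rw [← hΞ] at this
    rw [← mul_pow, ← sq]
    exact pow_le_pow_left₀ (norm_nonneg _) this 2
  have hPΞ : C.proj * Ξ = 0 := by
    rw [hΞ, ← Matrix.mul_assoc, mul_sub, mul_one, C.proj_mul_self, sub_self, Matrix.zero_mul]
  set q := Ωᴴ * C.proj * Ω with hq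
  have hPΩ : (C.proj * Ω)ᴴ * (C.proj * Ω) = q := by
    rw [Matrix.conjTranspose_mul, C.proj_isHermitian, Matrix.mul_assoc, ← Matrix.mul_assoc C.proj,
      C.proj_mul_self, hq, Matrix.mul_assoc]
  have hqΞ : q - 1 = -(Ξᴴ * Ξ) := by
    have h1 : Ξᴴ * Ξ = 1 - q := by
      have h2 : Ξ = Ω - C.proj * Ω := by rw [hΞ, Matrix.sub_mul, Matrix.one_mul]
      conv_lhs => rw [show Ξᴴ = Ωᴴ * (1 - C.proj) by rw [hΞ, Matrix.conjTranspose_mul,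
        Matrix.conjTranspose_sub, C.proj_isHermitian, Matrix.conjTranspose_one], Matrix.mul_assoc, Matrix.sub_mul, hPΞ, sub_zero, Matrix.one_mul,
        h2, Matrix.mul_sub, hΩ.1]
      rw [hq, Matrix.mul_assoc]
    rw [h1]; abel
  have hqn : ‖q - 1‖ ≤ K ^ 2 * |l| ^ 2 := by
    rw [hqΞ, norm_neg, Matrix.l2_opNorm_conjTranspose_mul_self]
    exact hΞn
  obtain ⟨Y, hYh, hYY, hY1, -, -⟩ := exists_sqrt_one_add (X := q - 1)
    (by rw [hqΞ, Matrix.conjTranspose_neg, Matrix.conjTranspose_mul,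
      Matrix.conjTranspose_conjTranspose]) (hqn.trans hK2a)
  have hYY' : Y * Y = q := by rw [hYY]; abel
  have hYn := hY1.trans hqn
  obtain ⟨I, hYI, hIY, -⟩ := exists_inv_of_norm_sub_one_le (hYn.trans hK2a)
  -- Orthonormalization of PΩ: its Gram matrix q = Y² differs from 1 by Ξ†Ξ, a second-order term.
  obtain ⟨Ω₀, hΩ₀⟩ : ∃ Ω₀, Ω₀ = C.proj * Ω * I := ⟨_, rfl⟩
  have hΩ₀1 : Ω₀ᴴ * Ω₀ = 1 := by
    have h1 := congrArg Matrix.conjTranspose hYI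
    rw [Matrix.conjTranspose_mul, hYh, Matrix.conjTranspose_one] at h1
    calc Ω₀ᴴ * Ω₀ = Iᴴ * ((C.proj * Ω)ᴴ * (C.proj * Ω)) * I := by
          rw [hΩ₀, Matrix.conjTranspose_mul (C.proj * Ω)]; simp only [Matrix.mul_assoc]
      _ = (Iᴴ * Y) * (Y * I) := by rw [hPΩ, ← hYY']; simp only [Matrix.mul_assoc]
      _ = 1 := by rw [h1, hYI, Matrix.one_mul]
  have hΩ₀P : C.proj * Ω₀ = Ω₀ := by
    rw [hΩ₀, ← Matrix.mul_assoc, ← Matrix.mul_assoc, C.proj_mul_self]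
  have hΩ₀P' : Ω₀ᴴ * C.proj = Ω₀ᴴ := by
    have := congrArg Matrix.conjTranspose hΩ₀P
    rwa [Matrix.conjTranspose_mul, C.proj_isHermitian] at this
  have hΩeq : Ω = Ω₀ * Y + Ξ := by
    rw [hΩ₀, Matrix.mul_assoc, hIY, Matrix.mul_one, hΞ, Matrix.sub_mul, Matrix.one_mul]
    abel
  set W : Matrix (Bits n) (ι × Fin 2) ℂ := ∑ b, pauliOp (r b) * Ω₀ * (blockIncl b)ᴴ with hW
  have hWb : ∀ b, W * blockIncl b = pauliOp (r b) * Ω₀ := by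
    intro b
    rw [hW, Matrix.sum_mul, Finset.sum_eq_single b]
    · rw [Matrix.mul_assoc, blockIncl_conjTranspose_mul, if_pos rfl, Matrix.mul_one]
    · intro c _ hc
      rw [Matrix.mul_assoc, blockIncl_conjTranspose_mul, if_neg hc, Matrix.mul_zero]
    · simp
  have hWW : Wᴴ * W = 1 := by
    refine ext_blocks fun b c => ?_
    have h1 : (blockIncl b)ᴴ * (Wᴴ * W) * blockIncl c = (W * blockIncl b)ᴴ * (W * blockIncl c) := by
      rw [Matrix.conjTranspose_mul]; simp only [Matrix.mul_assoc]
    rw [h1, hWb, hWb, Matrix.mul_one, blockIncl_conjTranspose_mul, Matrix.conjTranspose_mul,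
      pauliOp_isHermitian]
    split_ifs with h
    · subst h
      rw [Matrix.mul_assoc, ← Matrix.mul_assoc (pauliOp (r b)), pauliOp_mul_self, Matrix.one_mul,
        hΩ₀1]
    · calc _ = Ω₀ᴴ * (C.proj * (pauliOp (r b) * pauliOp (r c)) * C.proj) * Ω₀ := by
            conv_lhs => rw [← hΩ₀P', ← hΩ₀P]
            simp only [Matrix.mul_assoc]
            rw [hΩ₀P]
        _ = 0 := by rw [hr b c h, Matrix.mul_zero, Matrix.zero_mul]
  obtain ⟨U, hU, hOW⟩ := exists_decoder t Q hWW
  refine ⟨U, hU, fun P hP => ?_⟩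
  set O := qnnObservable t U with hO
  have hOh : Oᴴ = O := qnnObservable_isHermitian t U
  obtain ⟨b, hb⟩ := hrep P hP
  obtain ⟨x, hx1, hx2⟩ := C.exists_scalar_of_inStabilizer hb
  have hMΩ₀ : (pauliOp (r b) * pauliOp P) * Ω₀ = x • Ω₀ := by
    conv_lhs => rw [← hΩ₀P, ← Matrix.mul_assoc, hx2, Matrix.smul_mul, hΩ₀P]
  have hxx := norm_sq_scalar_eq_one hΩ₀1 hMΩ₀
  have hPΩ₀ := mul_eq_smul_of_mul_mul_eq_smul hMΩ₀
  obtain ⟨w, hw⟩ : ∃ w, w = pauliOp (r b) * Ω₀ := ⟨_, rfl⟩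
  rw [← hw] at hPΩ₀
  have hOw : O * w = w * Q.mat := by
    rw [hw, ← hWb, ← Matrix.mul_assoc, hOW, Matrix.mul_assoc, kronecker_mul_blockIncl,
      ← Matrix.mul_assoc]
  have hww : wᴴ * w = 1 := by
    rw [hw, Matrix.conjTranspose_mul, pauliOp_isHermitian, Matrix.mul_assoc,
      ← Matrix.mul_assoc (pauliOp (r b)), pauliOp_mul_self, Matrix.one_mul, hΩ₀1]
  have hwO : wᴴ * O = Q.mat * wᴴ := by
    have := congrArg Matrix.conjTranspose hOw
    rwa [Matrix.conjTranspose_mul, Matrix.conjTranspose_mul, hOh, Q.mat_conjTranspose] at this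
  -- E_bE is a stabilizer up to phase, so it acts on the code projector by a scalar, and the
  -- projector kills Ξ. The cross terms vanish because O maps the range of `w` to itself.
  have hwΞ : wᴴ * (pauliOp P * Ξ) = 0 := by
    rw [hw, Matrix.conjTranspose_mul, pauliOp_isHermitian, ← hΩ₀P']
    calc _ = Ω₀ᴴ * (C.proj * (pauliOp (r b) * pauliOp P)) * Ξ := by simp only [Matrix.mul_assoc]
      _ = 0 := by rw [hx1, Matrix.mul_smul, Matrix.smul_mul, Matrix.mul_assoc, hPΞ]; simp
  have hΞw : (pauliOp P * Ξ)ᴴ * w = 0 := by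
    have := congrArg Matrix.conjTranspose hwΞ
    rwa [Matrix.conjTranspose_mul, Matrix.conjTranspose_conjTranspose,
      Matrix.conjTranspose_zero] at this
  have hmain : Ωᴴ * (pauliOp P * O * pauliOp P) * Ω =
      Y * Q.mat * Y + Ξᴴ * (pauliOp P * O * pauliOp P) * Ξ := by
    have h1 : pauliOp P * Ω = x • (w * Y) + pauliOp P * Ξ := by
      conv_lhs => rw [hΩeq, Matrix.mul_add, ← Matrix.mul_assoc, hPΩ₀, Matrix.smul_mul]
    have h2 : Ωᴴ * (pauliOp P * O * pauliOp P) * Ω = (pauliOp P * Ω)ᴴ * (O * (pauliOp P * Ω)) := by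
      rw [Matrix.conjTranspose_mul, pauliOp_isHermitian]; simp only [Matrix.mul_assoc]
    have h3 : Ξᴴ * (pauliOp P * O * pauliOp P) * Ξ = (pauliOp P * Ξ)ᴴ * (O * (pauliOp P * Ξ)) := by
      rw [Matrix.conjTranspose_mul, pauliOp_isHermitian]; simp only [Matrix.mul_assoc]
    have e1 : (w * Y)ᴴ * (O * (w * Y)) = Y * Q.mat * Y := by
      rw [Matrix.conjTranspose_mul, hYh, ← Matrix.mul_assoc O, hOw]
      calc _ = Y * (wᴴ * w) * Q.mat * Y := by simp only [Matrix.mul_assoc]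
        _ = _ := by rw [hww, Matrix.mul_one]
    have e2 : (w * Y)ᴴ * (O * (pauliOp P * Ξ)) = 0 := by
      rw [Matrix.conjTranspose_mul, Matrix.mul_assoc, ← Matrix.mul_assoc wᴴ, hwO, Matrix.mul_assoc,
        hwΞ]
      simp
    have e3 : (pauliOp P * Ξ)ᴴ * (O * (w * Y)) = 0 := by
      rw [← Matrix.mul_assoc O, hOw, Matrix.mul_assoc, ← Matrix.mul_assoc, hΞw, Matrix.zero_mul]
    rw [h2, h3, h1, Matrix.conjTranspose_add, Matrix.conjTranspose_smul, Matrix.mul_add O,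
      Matrix.add_mul, Matrix.mul_add, Matrix.mul_add, Matrix.mul_smul O, Matrix.mul_smul,
      Matrix.mul_smul, Matrix.smul_mul, Matrix.smul_mul, e1, e2, e3, smul_smul, mul_comm x, hxx]
    simp
  have hPn := norm_pauliOp_le_one P
  have hOn : ‖O‖ ≤ 1 := norm_qnnObservable_le_one t hU
  have hPOP : ‖pauliOp P * O * pauliOp P‖ ≤ 1 := by
    have := norm_triple_le _ _ _ hPn hOn hPn
    linarith
  have hΞΞ : ‖Ξᴴ * (pauliOp P * O * pauliOp P) * Ξ‖ ≤ K ^ 2 * |l| ^ 2 := by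
    refine ((Matrix.l2_opNorm_mul _ _).trans (mul_le_mul_of_nonneg_right
      (Matrix.l2_opNorm_mul _ _) (norm_nonneg _))).trans ?_
    rw [Matrix.l2_opNorm_conjTranspose]
    calc ‖Ξ‖ * ‖pauliOp P * O * pauliOp P‖ * ‖Ξ‖ ≤ ‖Ξ‖ * 1 * ‖Ξ‖ := by gcongr
      _ ≤ _ := by rw [mul_one]; exact hΞn
  have h1n := norm_one_matrix_le (κ := Fin 2)
  have hYb : ‖Y‖ ≤ 3 / 2 := by
    have h1 : Y = 1 + (Y - 1) := by abel
    have h2 : ‖Y‖ ≤ ‖(1 : Matrix (Fin 2) (Fin 2) ℂ)‖ + ‖Y - 1‖ := by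
      conv_lhs => rw [h1]
      exact norm_add_le _ _
    linarith
  have hYQY : ‖Y * Q.mat * Y - Q.mat‖ ≤ 5 / 2 * (K ^ 2 * |l| ^ 2) := by
    have h1 : Y * Q.mat * Y - Q.mat = (Y - 1) * Q.mat * Y + 1 * Q.mat * (Y - 1) := by
      noncomm_ring
    have b1 := norm_triple_le (Y - 1) Q.mat Y hYn Q.norm_mat_le_one hYb
    have b2 := norm_triple_le 1 Q.mat (Y - 1) h1n Q.norm_mat_le_one hYn
    rw [h1]
    refine (norm_add_le _ _).trans ?_
    linarith
  rw [hmain, add_sub_right_comm]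
  refine (norm_add_le _ _).trans ?_
  have : 0 ≤ K ^ 2 * |l| ^ 2 := by positivity
  linarith

/-! ### Decoding to higher order for independent errors -/

/-- The decoder acts on the orthonormalization of the noisy perturbed codewords, one block per
syndrome. Diagonal blocks of their Gram matrix are exactly 1, so its nonscalar part affects decoding
only at second order. -/
theorem exists_higher_order_decoder {d p m : ℕ} (hd : C.HasDistance d)
    (hm : 2 * p + m * k < d) {prob : PauliString n → ℝ} (hprob : IsNoise p prob) {V : Op n}
    (hV : V ∈ localOps n k) (hind : IndependentErrors C V prob) (t : Fin n) (Q : LogicalBasis) :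
    ∃ K l₀, 0 ≤ K ∧ 0 < l₀ ∧ ∀ l : ℝ, |l| < l₀ → ∀ Ω : Matrix (Bits n) (Fin 2) ℂ,
      C.IsLowFrame V l Ω → ∃ U ∈ Matrix.unitaryGroup (Bits n) ℂ, ∀ P, prob P ≠ 0 →
        ‖Ωᴴ * (pauliOp P * qnnObservable t U * pauliOp P) * Ω - Q.mat‖ ≤
          K * |l| ^ (2 * (m + 1)) := by
  obtain ⟨ι, _, _, r, hr0, hr, hrep⟩ := C.exists_syndrome_representatives hd (by omega) hprob
  obtain ⟨K₁, hK₁, hK₁b⟩ := C.exists_norm_excited_part_le V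
  obtain ⟨l₂, hl₂, hsym⟩ := C.exists_symmetry_mul_eq_smul V
  obtain ⟨K, l₁, hK, hl₁, hKL⟩ := exists_uniform_bound (α := ι × ι)
    (p := fun b K l => ∀ Ω : Matrix (Bits n) (Fin 2) ℂ, C.IsLowFrame V l Ω →
      ∃ c : ℂ, ‖Ωᴴ * (pauliOp (r b.1) * pauliOp (r b.2)) * Ω - c • 1‖ ≤ K * |l| ^ (m + 1))
    (fun b K K' l hKK' h Ω hΩ => by
      obtain ⟨c, hc⟩ := h Ω hΩ
      exact ⟨c, hc.trans (mul_le_mul_of_nonneg_right hKK' (by positivity))⟩)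
    (fun b => C.exists_lowFrame_knill_laflamme hd hV (w := 2 * p) (localOps_mono
      (by
        have h1 := hprob.2.2 _ (hr0 b.1)
        have h2 := hprob.2.2 _ (hr0 b.2)
        omega)
      (mul_mem_localOps (pauliOp_mem_localOps le_rfl) (pauliOp_mem_localOps le_rfl))) hm)
  set N : ℝ := (Fintype.card ι : ℝ) ^ 2 with hN
  have hN0 : 0 ≤ N := by positivity
  -- For |λ| < 1/(8L), both ‖D − 1‖ and ‖R‖ are at most 1/8, within the range of the Gram
  -- factorization. In the constants, N comes from summing over blocks, and the 2 in 2K from using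
  -- half the trace as the scalar.
  obtain ⟨L, hL⟩ : ∃ L, L = 1 + N * (2 * K₁) + N * (2 * K) := ⟨_, rfl⟩
  have hL1 : 1 ≤ L := by
    have : 0 ≤ N * (2 * K₁) + N * (2 * K) := by positivity
    linarith
  refine ⟨108 * (N * (2 * K)) ^ 2, min (min l₁ l₂) (1 / (8 * L)), by positivity, by positivity,
    fun l hl Ω hΩ => ?_⟩
  have hll₁ : |l| < l₁ := hl.trans_le ((min_le_left _ _).trans (min_le_left _ _))
  have hll₂ : |l| < l₂ := hl.trans_le ((min_le_left _ _).trans (min_le_right _ _))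
  have hl3 := hl.trans_le (min_le_right _ _)
  rw [lt_div_iff₀ (by positivity)] at hl3
  obtain ⟨a, ha⟩ : ∃ a, a = |l| := ⟨_, rfl⟩
  rw [← ha] at hll₁ hll₂ hl3
  have ha0 : 0 ≤ a := ha ▸ abs_nonneg l
  have ha1 : a ≤ 1 := by nlinarith
  have haK₁ : N * (2 * K₁) * a ≤ 1 / 8 := by
    have h1 : N * (2 * K₁) ≤ L := by
      have : 0 ≤ N * (2 * K) := by positivity
      linarith
    have := mul_le_mul_of_nonneg_right h1 ha0
    linarith
  have haK : N * (2 * K) * a ≤ 1 / 8 := by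
    have h1 : N * (2 * K) ≤ L := by
      have : 0 ≤ N * (2 * K₁) := by positivity
      linarith
    have := mul_le_mul_of_nonneg_right h1 ha0
    linarith
  have hpa : a ^ (m + 1) ≤ a := pow_le_of_le_one ha0 ha1 (by omega)
  have hΩ1 := hΩ.norm_le_one
  have hΩ1' : ‖Ωᴴ‖ ≤ 1 := by rw [Matrix.l2_opNorm_conjTranspose]; exact hΩ1
  let g : ι → ι → Matrix (Fin 2) (Fin 2) ℂ := fun b c =>
    Ωᴴ * (pauliOp (r b) * pauliOp (r c)) * Ω
  have hgh : ∀ b c, (g b c)ᴴ = g c b := by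
    intro b c
    simp only [g]
    rw [Matrix.conjTranspose_mul, Matrix.conjTranspose_mul, Matrix.conjTranspose_mul,
      pauliOp_isHermitian, pauliOp_isHermitian, Matrix.conjTranspose_conjTranspose,
      Matrix.mul_assoc Ωᴴ]
  have hgbb : ∀ b, g b b = 1 := by
    intro b
    simp only [g]
    rw [pauliOp_mul_self, Matrix.mul_one, hΩ.1]
  -- Different syndromes are orthogonal on the code space, so off-diagonal blocks need the excited
  -- part. First order is enough here; it only keeps D close to the identity.
  have hgn : ∀ b c, b ≠ c → ‖g b c‖ ≤ 2 * K₁ * a := by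
    intro b c hbc
    obtain ⟨Ξ, hΞ⟩ : ∃ Ξ, Ξ = (1 - C.proj) * Ω := ⟨_, rfl⟩
    have hΞn : ‖Ξ‖ ≤ K₁ * a := hΞ ▸ ha ▸ hK₁b l Ω hΩ
    have hΩeq : Ω = C.proj * Ω + Ξ := by
      rw [hΞ, Matrix.sub_mul, Matrix.one_mul]; abel
    set M := pauliOp (r b) * pauliOp (r c) with hM
    have hMn : ‖M‖ ≤ 1 := (norm_mul_le _ _).trans
      (mul_le_one₀ (norm_pauliOp_le_one _) (norm_nonneg _) (norm_pauliOp_le_one _))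
    have h1 : (C.proj * Ω)ᴴ * M * (C.proj * Ω) = 0 := by
      calc _ = Ωᴴ * (C.proj * M * C.proj) * Ω := by
            rw [Matrix.conjTranspose_mul, C.proj_isHermitian]; simp only [Matrix.mul_assoc]
        _ = 0 := by rw [hM, hr b c hbc, Matrix.mul_zero, Matrix.zero_mul]
    have h2 : g b c = Ωᴴ * M * Ξ + Ξᴴ * M * (C.proj * Ω) := by
      calc g b c = Ωᴴ * M * (C.proj * Ω + Ξ) := by rw [← hΩeq]
        _ = (C.proj * Ω + Ξ)ᴴ * M * (C.proj * Ω) + Ωᴴ * M * Ξ := by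
          rw [Matrix.mul_add, ← hΩeq]
        _ = _ := by
          rw [Matrix.conjTranspose_add, Matrix.add_mul, Matrix.add_mul, h1, zero_add, add_comm]
    have b1 : ‖Ωᴴ * M * Ξ‖ ≤ ‖Ξ‖ := (Matrix.l2_opNorm_mul _ _).trans
      (mul_le_of_le_one_left (norm_nonneg _) ((Matrix.l2_opNorm_mul _ _).trans
        (mul_le_one₀ hΩ1' (norm_nonneg _) hMn)))
    have b2 : ‖Ξᴴ * M * (C.proj * Ω)‖ ≤ ‖Ξ‖ := by
      refine (Matrix.l2_opNorm_mul _ _).trans ((mul_le_of_le_one_right (norm_nonneg _)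
        ((Matrix.l2_opNorm_mul _ _).trans
          (mul_le_one₀ C.norm_proj_le_one (norm_nonneg _) hΩ1))).trans ?_)
      refine (Matrix.l2_opNorm_mul _ _).trans ?_
      rw [Matrix.l2_opNorm_conjTranspose]
      exact mul_le_of_le_one_right (norm_nonneg _) hMn
    rw [h2]
    refine (norm_add_le _ _).trans ?_
    linarith
  set v : Matrix (Bits n) (ι × Fin 2) ℂ := ∑ b, pauliOp (r b) * Ω * (blockIncl b)ᴴ with hv
  have hvb : ∀ b, v * blockIncl b = pauliOp (r b) * Ω := by
    intro b
    rw [hv, Matrix.sum_mul, Finset.sum_eq_single b]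
    · rw [Matrix.mul_assoc, blockIncl_conjTranspose_mul, if_pos rfl, Matrix.mul_one]
    · intro c _ hc
      rw [Matrix.mul_assoc, blockIncl_conjTranspose_mul, if_neg hc, Matrix.mul_zero]
    · simp
  have hvv : ∀ b c : ι, (blockIncl b)ᴴ * (vᴴ * v) * blockIncl c = g b c := by
    intro b c
    have h1 : (blockIncl b)ᴴ * (vᴴ * v) * blockIncl c = (v * blockIncl b)ᴴ * (v * blockIncl c) := by
      rw [Matrix.conjTranspose_mul]; simp only [Matrix.mul_assoc]
    rw [h1, hvb, hvb, Matrix.conjTranspose_mul, pauliOp_isHermitian]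
    simp only [g, Matrix.mul_assoc]
  -- The scalar part of every block. It commutes with 1 ⊗ σ whatever its size, and the rest `R` is
  -- of order m + 1 by the approximate Knill–Laflamme condition.
  let c : Matrix ι ι ℂ := Matrix.of fun b b' => (g b b').trace / 2
  set D : Matrix (ι × Fin 2) (ι × Fin 2) ℂ := c ⊗ₖ (1 : Matrix (Fin 2) (Fin 2) ℂ) with hD
  set R := vᴴ * v - D with hR
  have hch : cᴴ = c := by
    ext b b'
    simp only [c, Matrix.conjTranspose_apply, Matrix.of_apply]
    rw [← hgh b' b, Matrix.trace_conjTranspose]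
    simp
  have hDh : Dᴴ = D := by
    rw [hD, Matrix.conjTranspose_kronecker, hch, Matrix.conjTranspose_one]
  have hRh : Rᴴ = R := by
    rw [hR, Matrix.conjTranspose_sub, hDh, Matrix.conjTranspose_mul,
      Matrix.conjTranspose_conjTranspose]
  have hDb : ∀ b b' : ι, (blockIncl b)ᴴ * D * blockIncl b' = c b b' • 1 :=
    blockIncl_mul_kronecker_one_mul c
  have hcbb : ∀ b, c b b = 1 := by
    intro b
    simp only [c, Matrix.of_apply, hgbb, Matrix.trace_one, Fintype.card_fin]
    norm_num
  have hD1 : ‖D - 1‖ ≤ 1 / 2 := by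
    have : ‖D - 1‖ ≤ N * (2 * K₁ * a) := by
      refine norm_le_of_blocks fun b b' => ?_
      rw [Matrix.mul_sub, Matrix.sub_mul, hDb, Matrix.mul_one, blockIncl_conjTranspose_mul]
      split_ifs with h
      · rw [h, hcbb, one_smul, sub_self, norm_zero]; positivity
      · have h1 := norm_apply_self_le (g b b') 0
        have h2 := norm_apply_self_le (g b b') 1
        have h3 := norm_add_le (g b b' 0 0) (g b b' 1 1)
        have h4 : ‖c b b'‖ ≤ ‖g b b'‖ := by
          change ‖(g b b').trace / 2‖ ≤ _
          rw [norm_div, Matrix.trace_fin_two, Complex.norm_ofNat]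
          linarith
        rw [sub_zero, norm_smul]
        exact (mul_le_of_le_one_right (norm_nonneg _) norm_one_matrix_le).trans
          (h4.trans (hgn b b' h))
    linarith
  have hRb : ∀ b b' : ι, (blockIncl b)ᴴ * R * blockIncl b' = g b b' - ((g b b').trace / 2) • 1 := by
    intro b b'
    rw [hR, Matrix.mul_sub, Matrix.sub_mul, hvv, hDb]
    rfl
  have hRbb : ∀ b : ι, (blockIncl b)ᴴ * R * blockIncl b = 0 := by
    intro b
    rw [hRb]
    have := hcbb b
    simp only [c, Matrix.of_apply] at this
    rw [this, hgbb, one_smul, sub_self]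
  have hRn : ‖R‖ ≤ N * (2 * K) * a ^ (m + 1) := by
    have : ‖R‖ ≤ N * (2 * (K * a ^ (m + 1))) := by
      refine norm_le_of_blocks fun b b' => ?_
      rw [hRb]
      obtain ⟨x, hx⟩ := hKL l (ha ▸ hll₁) (b, b') Ω hΩ
      rw [← ha] at hx
      exact (norm_sub_half_trace_le _ x).trans (mul_le_mul_of_nonneg_left hx zero_le_two)
    linarith
  have hR8 : ‖R‖ ≤ 1 / 8 := by
    have : N * (2 * K) * a ^ (m + 1) ≤ N * (2 * K) * a :=
      mul_le_mul_of_nonneg_left hpa (by positivity)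
    linarith
  set S : Matrix (ι × Fin 2) (ι × Fin 2) ℂ := (1 : Matrix ι ι ℂ) ⊗ₖ Q.mat with hS
  have hSn : ‖S‖ ≤ 1 := norm_le_one_of_isometry (by
    rw [hS, Matrix.conjTranspose_kronecker, ← Matrix.mul_kronecker_mul, Q.mat_conjTranspose,
      Q.mat_mul_self]
    simp)
  have hDS : Commute D S := by
    change D * S = S * D
    rw [hD, hS, ← Matrix.mul_kronecker_mul, ← Matrix.mul_kronecker_mul]
    simp
  obtain ⟨A, B, hAB, hAA, hASA⟩ := exists_gram_factorization hDh hRh hSn hDS hD1 hR8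
  have hBA : B * A = 1 := mul_eq_one_comm.1 hAB
  have hAA' : Aᴴ * A = vᴴ * v := by rw [hAA, hR]; abel
  set W := v * B with hW
  have hWA : W * A = v := by rw [hW, Matrix.mul_assoc, hBA, Matrix.mul_one]
  have hWW : Wᴴ * W = 1 := by
    have h1 := congrArg Matrix.conjTranspose hAB
    rw [Matrix.conjTranspose_mul, Matrix.conjTranspose_one] at h1
    calc Wᴴ * W = Bᴴ * (vᴴ * v) * B := by
          rw [hW, Matrix.conjTranspose_mul]; simp only [Matrix.mul_assoc]
      _ = (Bᴴ * Aᴴ) * (A * B) := by rw [← hAA']; simp only [Matrix.mul_assoc]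
      _ = 1 := by rw [h1, hAB, mul_one]
  obtain ⟨U, hU, hOW⟩ := exists_decoder t Q hWW
  refine ⟨U, hU, fun P hP => ?_⟩
  set O := qnnObservable t U with hO
  have hvOv : vᴴ * O * v = Aᴴ * S * A := by
    calc vᴴ * O * v = Aᴴ * (Wᴴ * (O * W)) * A := by
          rw [← hWA, Matrix.conjTranspose_mul]; simp only [Matrix.mul_assoc]
      _ = Aᴴ * S * A := by rw [hOW, ← Matrix.mul_assoc Wᴴ, hWW, Matrix.one_mul]
  have hrepb : ∀ b, ‖(pauliOp (r b) * Ω)ᴴ * O * (pauliOp (r b) * Ω) - Q.mat‖ ≤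
      108 * (N * (2 * K)) ^ 2 * a ^ (2 * (m + 1)) := by
    intro b
    have h1 : (pauliOp (r b) * Ω)ᴴ * O * (pauliOp (r b) * Ω) =
        (blockIncl b)ᴴ * (Aᴴ * S * A) * blockIncl b := by
      rw [← hvb, ← hvOv, Matrix.conjTranspose_mul]; simp only [Matrix.mul_assoc]
    -- On a diagonal block the first-order terms SR and RS reduce to σ times the diagonal block of
    -- R, which is zero.
    have h2 : (blockIncl b)ᴴ * (D * S + (1 / 2 : ℂ) • (S * R + R * S)) * blockIncl b = Q.mat := by
      have e1 : (blockIncl b)ᴴ * (D * S) * blockIncl b = Q.mat := by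
        calc _ = (blockIncl b)ᴴ * D * (S * blockIncl b) := by simp only [Matrix.mul_assoc]
          _ = (blockIncl b)ᴴ * D * blockIncl b * Q.mat := by
            rw [hS, kronecker_mul_blockIncl, Matrix.mul_assoc _ _ Q.mat]
          _ = Q.mat := by rw [hDb, hcbb, one_smul, Matrix.one_mul]
      have e2 : (blockIncl b)ᴴ * (S * R) * blockIncl b = 0 := by
        calc _ = ((blockIncl b)ᴴ * S) * R * blockIncl b := by simp only [Matrix.mul_assoc]
          _ = Q.mat * ((blockIncl b)ᴴ * R * blockIncl b) := by
            rw [hS, blockIncl_mul_kronecker]; simp only [Matrix.mul_assoc]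
          _ = 0 := by rw [hRbb, Matrix.mul_zero]
      have e3 : (blockIncl b)ᴴ * (R * S) * blockIncl b = 0 := by
        calc _ = (blockIncl b)ᴴ * R * (S * blockIncl b) := by simp only [Matrix.mul_assoc]
          _ = ((blockIncl b)ᴴ * R * blockIncl b) * Q.mat := by
            rw [hS, kronecker_mul_blockIncl]; simp only [Matrix.mul_assoc]
          _ = 0 := by rw [hRbb, Matrix.zero_mul]
      rw [Matrix.mul_add, Matrix.add_mul, e1, Matrix.mul_smul, Matrix.smul_mul, Matrix.mul_add,
        Matrix.add_mul, e2, e3]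
      simp
    rw [h1, ← h2, ← Matrix.sub_mul, ← Matrix.mul_sub]
    refine (norm_sandwich_le _ (by
      rw [Matrix.l2_opNorm_conjTranspose]; exact norm_blockIncl_le_one b)
      (norm_blockIncl_le_one b)).trans (hASA.trans ?_)
    have h3 : ‖R‖ ^ 2 ≤ (N * (2 * K) * a ^ (m + 1)) ^ 2 := pow_le_pow_left₀ (norm_nonneg _) hRn 2
    have h4 : (N * (2 * K) * a ^ (m + 1)) ^ 2 = (N * (2 * K)) ^ 2 * a ^ (2 * (m + 1)) := by
      rw [mul_pow, ← pow_mul, mul_comm (m + 1) 2]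
    linarith
  obtain ⟨b, hb⟩ := hrep P hP
  obtain ⟨x, hx1, -⟩ := C.exists_scalar_of_inStabilizer hb
  -- The only use of independence: it extends exact degeneracy from the unperturbed code to the
  -- perturbed one, so that E acts on the codewords like its representative up to a phase.
  have hMΩ : (pauliOp (r b) * pauliOp P) * Ω = x • Ω :=
    hsym l (ha ▸ hll₂) Ω hΩ _ x hx1 (C.commute_excitation hb.commute_S)
      (hind _ _ (hr0 b) hP hb)
  have hxx := norm_sq_scalar_eq_one hΩ.1 hMΩ
  have hPΩ := mul_eq_smul_of_mul_mul_eq_smul hMΩ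
  have hfin : Ωᴴ * (pauliOp P * O * pauliOp P) * Ω =
      (pauliOp (r b) * Ω)ᴴ * O * (pauliOp (r b) * Ω) := by
    calc _ = (pauliOp P * Ω)ᴴ * O * (pauliOp P * Ω) := by
          rw [Matrix.conjTranspose_mul, pauliOp_isHermitian]; simp only [Matrix.mul_assoc]
      _ = _ := by
          rw [hPΩ, Matrix.conjTranspose_smul, Matrix.smul_mul, Matrix.smul_mul, Matrix.mul_smul,
            smul_smul, hxx, one_smul]
  rw [hfin, ← ha]
  exact hrepb b

end StabilizerCode

end PerturbedCode

/-! ### The theorem: the three ranges of d − 2p -/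

open scoped Matrix.Norms.L2Operator in
theorem theorem3 {n k d p : ℕ} (C : StabilizerCode n) (hd : C.HasDistance d)
    (hk : 1 ≤ k) (hkd : k < d) (V : Op n) (hV : IsLocal k V)
    (prob : PauliString n → ℝ) (hprob : IsNoise p prob)
    (hind : k + 2 * p < d → IndependentErrors C V prob)
    (μ : MeasureTheory.Measure (ℝ × ℝ)) [MeasureTheory.IsFiniteMeasure μ]
    (t : Fin n) (Q : LogicalBasis) :
    ∃ K l₀ : ℝ, 0 < l₀ ∧ ∀ l : ℝ, 0 < |l| → |l| < l₀ →
      ∀ ψ : Fin 2 → Vec n, IsLowestPair (C.hamiltonian V l) ψ →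
        ∀ u ∈ Matrix.unitaryGroup (Fin 2) ℂ,
          ∃ U ∈ Matrix.unitaryGroup (Bits n) ℂ,
            decodingError μ prob (codeword u ψ) Q (qnnObservable t U) ≤
              K * |l| ^ (4 * ⌈((d : ℚ) - 2 * (p : ℚ)) / (k : ℚ)⌉) := by
  have hn : 1 ≤ n := Fin.pos t
  have hk0 : (0 : ℚ) < k := by exact_mod_cast hk
  -- The exponent doubles here because the decoding error is a mean square.
  have hfinish : ∀ m : ℕ, ⌈((d : ℚ) - 2 * (p : ℚ)) / (k : ℚ)⌉ = ((m + 1 : ℕ) : ℤ) →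
      (∃ K l₀, 0 ≤ K ∧ 0 < l₀ ∧ ∀ l : ℝ, |l| < l₀ → ∀ Ω : Matrix (Bits n) (Fin 2) ℂ,
        C.IsLowFrame V l Ω → ∃ U ∈ Matrix.unitaryGroup (Bits n) ℂ, ∀ P, prob P ≠ 0 →
          ‖Ωᴴ * (pauliOp P * qnnObservable t U * pauliOp P) * Ω - Q.mat‖ ≤
            K * |l| ^ (2 * (m + 1))) →
      ∃ K l₀ : ℝ, 0 < l₀ ∧ ∀ l : ℝ, 0 < |l| → |l| < l₀ →
      ∀ ψ : Fin 2 → Vec n, IsLowestPair (C.hamiltonian V l) ψ →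
        ∀ u ∈ Matrix.unitaryGroup (Fin 2) ℂ,
          ∃ U ∈ Matrix.unitaryGroup (Bits n) ℂ,
            decodingError μ prob (codeword u ψ) Q (qnnObservable t U) ≤
              K * |l| ^ (4 * ⌈((d : ℚ) - 2 * (p : ℚ)) / (k : ℚ)⌉) := by
    rintro m hm ⟨K, l₀, -, hl₀, h⟩
    refine ⟨K ^ 2 * μ.real Set.univ, l₀, hl₀, fun l _ hl ψ hψ u hu => ?_⟩
    obtain ⟨U, hU, hUP⟩ := h l hl _ (C.isLowFrame_codeword hn hV.isHermitian hψ hu)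
    refine ⟨U, hU, (decodingError_le μ hprob _ Q _ hUP).trans (le_of_eq ?_)⟩
    have h1 : |l| ^ (4 * ⌈((d : ℚ) - 2 * (p : ℚ)) / (k : ℚ)⌉) = |l| ^ (4 * (m + 1)) := by
      rw [hm, ← zpow_natCast]
      congr 1
    rw [h1, mul_pow, ← pow_mul]
    ring
  by_cases hp : d ≤ 2 * p
  -- The deviation of two matrices of norm at most 1 is at most 2, while |λ| < 1 raised to a
  -- nonpositive power is at least 1; `U = 1` suffices.
  · refine ⟨2 ^ 2 * μ.real Set.univ, 1, one_pos, fun l hl0 hl ψ hψ u hu => ⟨1, one_mem _, ?_⟩⟩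
    have hΩ := (C.isLowFrame_codeword hn hV.isHermitian hψ hu)
    refine (decodingError_le μ hprob (codeword u ψ) Q _ (δ := 2) fun P _ => ?_).trans ?_
    · have hP := norm_pauliOp_le_one P
      have h1 := norm_triple_le _ _ _ hP (norm_qnnObservable_le_one t (one_mem _)) hP
      have h2 := norm_sandwich_le (pauliOp P * qnnObservable t 1 * pauliOp P)
        (A := (frame (codeword u ψ))ᴴ) (B := frame (codeword u ψ))
        (by rw [Matrix.l2_opNorm_conjTranspose]; exact hΩ.norm_le_one) hΩ.norm_le_one
      have h3 := Q.norm_mat_le_one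
      refine (norm_sub_le _ _).trans ?_
      linarith
    · refine le_mul_of_one_le_right (by positivity) ?_
      refine one_le_zpow_of_nonpos₀ hl0 hl.le ?_
      have : ⌈((d : ℚ) - 2 * (p : ℚ)) / (k : ℚ)⌉ ≤ 0 := by
        rw [Int.ceil_le, Int.cast_zero]
        refine div_nonpos_of_nonpos_of_nonneg ?_ hk0.le
        have : (d : ℚ) ≤ 2 * p := by exact_mod_cast hp
        linarith
      linarith
  · push Not at hp
    by_cases hkp : k + 2 * p < d
    · obtain ⟨c, hc⟩ : ∃ c, c = ⌈((d : ℚ) - 2 * (p : ℚ)) / (k : ℚ)⌉ := ⟨_, rfl⟩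
      have hpQ : (2 * p : ℚ) < d := by exact_mod_cast hp
      have hc0 : 0 < c := by
        rw [hc, Int.ceil_pos]
        exact div_pos (by linarith) hk0
      -- One below the ceiling, so m < (d − 2p)/k strictly, which is the weight condition 2p + mk <
      -- d.
      obtain ⟨m, hm⟩ : ∃ m : ℕ, c = ((m + 1 : ℕ) : ℤ) := ⟨(c - 1).toNat, by omega⟩
      have h1 : (m : ℚ) < ((d : ℚ) - 2 * p) / k := by
        have h2 := Int.ceil_lt_add_one (((d : ℚ) - 2 * (p : ℚ)) / (k : ℚ))
        rw [← hc, hm] at h2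
        push_cast at h2
        linarith
      rw [lt_div_iff₀ hk0] at h1
      have h3 : 2 * p + m * k < d := by
        have : (2 * p + m * k : ℚ) < d := by linarith
        exact_mod_cast this
      exact hfinish m (hc ▸ hm) (C.exists_higher_order_decoder hd h3 hprob hV.mem_localOps
        (hind hkp) t Q)
    -- Here 0 < d − 2p ≤ k, so the ceiling is 1.
    · refine hfinish 0 ?_ (C.exists_first_order_decoder hd hp hprob V t Q)
      rw [Int.ceil_eq_iff]
      have h1 : (2 * p : ℚ) < d := by exact_mod_cast hp
      have h2 : (d : ℚ) ≤ k + 2 * p := by exact_mod_cast not_lt.1 hkp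
      push_cast
      constructor
      · have := div_pos (show (0 : ℚ) < (d : ℚ) - 2 * p by linarith) hk0
        linarith
      · rw [div_le_iff₀ hk0]; linarith
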